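/- Let $c>0$ and let $\lambda\in C^1((0,\infty),[0,\infty))$ satisfy $\Lambda(t)=\int_0^t\lambda(s)\,ds<\infty$ for all $t>0$. Let $(X(t),Y(t))_{t\ge 0}$ be a reflecting orthogonal planar random motion with speed $c$ and rate function $\lambda$. That is, the particle starts at the origin and moves at every time with speed $c$ in one of the directions $d_k=(\cos(k\pi/2),\sin(k\pi/2))$, $k=0,1,2,3$. The initial direction is uniformly distributed. At each event of a non-homogeneous Poisson process with rate function $\lambda$ the particle switches to one of the three directions different from the current one, chosen uniformly, and these choices are independent of the Poisson process. Then there is a function $f(\eta,t)$, of class $C^1$ on $\{(\eta,t):|\eta|<ct\}$ (and of class $C^2$ there if $\lambda\in C^2((0,\infty))$), such that for every $t>0$ $$P\{X(t)+Y(t)=ct,\ X(t)-Y(t)\in d\eta\}=f(\eta,t)\,d\eta ,\qquad |\eta|<ct,$$ and $f$ satisfies $$\begin{cases}\dfrac{\partial^2 f}{\partial t^2}+2\lambda(t)\dfrac{\partial f}{\partial t}+\dfrac23\Bigl(\dfrac43\lambda(t)^2+\lambda'(t)\Bigr)f=c^2\dfrac{\partial^2 f}{\partial\eta^2},\qquad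 |\eta|<ct,\\[4pt] f(\eta,t)\ge 0,\\[2pt] \displaystyle\int_{-ct}^{ct}f(\eta,t)\,d\eta=\frac12\bigl(e^{-2\Lambda(t)/3}-e^{-\Lambda(t)}\bigr),\end{cases}$$ where the differential equation holds in the sense of distributions on $\{|\eta|<ct\}$, and also pointwise, with classical derivatives, if $\lambda\in C^2((0,\infty))$. Moreover, for $|\eta|<ct$, $$f(\eta,t)=\frac{e^{-2\Lambda(t)/3}}{4}\,\bar p\Bigl(\frac{\eta}{2},t\Bigr),$$ where, for each $t>0$, $\bar p(\cdot,t)$ is a nonnegative density of the absolutely continuous component of the law at time $t$ of a one-dimensional telegraph process with velocity $c/2$ and rate function $\lambda(t)/3$ (started at $0$ with velocity $c/2$ or $-c/2$ with probability $1/2$ each, the sign of the velocity changing at the events of an independent Poisson process with rate function $\lambda/3$). -/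

import Mathlib

open MeasureTheory ProbabilityTheory Set
open scoped NNReal ENNReal

/-- A non-homogeneous Poisson process with rate function `lam` on the probability space `(Ω, P)`:
a nondecreasing right-continuous `ℕ`-valued process with `N 0 = 0` and with independent increments,
such that `N t - N s` is Poisson distributed with mean `∫ u in s..t, lam u` for `s ≤ t`.
(Paths are nondecreasing, so that the subtraction in `ℕ` is never truncated.) -/
structure IsPoissonProcess {Ω : Type*} [MeasurableSpace Ω] (P : Measure Ω) (lam : ℝ → ℝ)
    (N : ℝ≥0 → Ω → ℕ) : Prop where
  measurable : ∀ t, Measurable (N t)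
  zero : ∀ ω, N 0 ω = 0
  mono : ∀ ω, Monotone fun t => N t ω
  rightContinuous : ∀ ω t, ContinuousWithinAt (fun s => N s ω) (Ici t) t
  indepIncrements : HasIndepIncrements N P
  law : ∀ s t : ℝ≥0, s ≤ t →
    P.map (fun ω => N t ω - N s ω) = poissonMeasure (∫ u in (s : ℝ)..t, lam u).toNNReal

/-- First coordinate of the direction `d_k = (cos (k π / 2), sin (k π / 2))`. -/
def dirX : Fin 4 → ℝ := ![1, 0, -1, 0]

/-- Second coordinate of the direction `d_k = (cos (k π / 2), sin (k π / 2))`. -/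
def dirY : Fin 4 → ℝ := ![0, 1, 0, -1]

/-- The sequence of successive directions of the reflecting motion: a Markov chain on the four
directions, with uniform initial direction, which at each step chooses uniformly one of the three
directions that differ from the current one. -/
structure IsReflectingChain {Ω : Type*} [MeasurableSpace Ω] (P : Measure Ω)
    (E : ℕ → Ω → Fin 4) : Prop where
  measurable : ∀ n, Measurable (E n)
  law : ∀ (n : ℕ) (e : ℕ → Fin 4),
    P.real {ω | ∀ k ≤ n, E k ω = e k} =
      (1 / 4) * ∏ k ∈ Finset.range n, if e (k + 1) = e k then (0 : ℝ) else 1 / 3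

/-- `(X, Y)` is a reflecting orthogonal planar random motion with speed `c`, started at the origin,
whose changes of direction are paced by a Poisson process with rate function `lam`:
at time `s` the particle moves with velocity `c d_k`, where `k = E (N s)`. -/
def IsReflectingMotion {Ω : Type*} [MeasurableSpace Ω] (P : Measure Ω) (c : ℝ) (lam : ℝ → ℝ)
    (X Y : ℝ≥0 → Ω → ℝ) : Prop :=
  ∃ (N : ℝ≥0 → Ω → ℕ) (E : ℕ → Ω → Fin 4),
    IsPoissonProcess P lam N ∧ IsReflectingChain P E ∧
    IndepFun (fun ω t => N t ω) (fun ω n => E n ω) P ∧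
    (∀ t ω, X t ω = ∫ s in (0 : ℝ)..t, c * dirX (E (N s.toNNReal ω) ω)) ∧
    (∀ t ω, Y t ω = ∫ s in (0 : ℝ)..t, c * dirY (E (N s.toNNReal ω) ω))

/-- `T` is a (symmetric, one-dimensional) telegraph process with velocity `v` and rate function
`mu`: it starts at `0` with velocity `v` or `-v`, with probability `1 / 2` each, and its velocity
changes sign at the events of an independent Poisson process with rate function `mu`. -/
def IsTelegraphProcess {Ω : Type*} [MeasurableSpace Ω] (P : Measure Ω) (v : ℝ) (mu : ℝ → ℝ)
    (T : ℝ≥0 → Ω → ℝ) : Prop :=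
  ∃ (N : ℝ≥0 → Ω → ℕ) (S : Ω → ℝ),
    IsPoissonProcess P mu N ∧
    Measurable S ∧ P.real {ω | S ω = 1} = 1 / 2 ∧ P.real {ω | S ω = -1} = 1 / 2 ∧
    IndepFun (fun ω t => N t ω) S P ∧
    ∀ t ω, T t ω = ∫ s in (0 : ℝ)..t, v * S ω * (-1) ^ N s.toNNReal ω

/-- The space-time domain `{(η, t) : |η| < c t}`. -/
def edgeCone (c : ℝ) : Set (ℝ × ℝ) := {z | |z.1| < c * z.2}

/-- `f` solves, pointwise on `edgeCone c` and with classical derivatives,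
`f_tt + 2 lam f_t + (2/3) ((4/3) lam ^ 2 + lam') f = c ^ 2 f_ηη`. -/
def IsClassicalEdgeSolution (c : ℝ) (lam : ℝ → ℝ) (f : ℝ → ℝ → ℝ) : Prop :=
  ∀ η t : ℝ, (η, t) ∈ edgeCone c →
    iteratedDeriv 2 (fun s => f η s) t + 2 * lam t * deriv (fun s => f η s) t
      + 2 / 3 * (4 / 3 * lam t ^ 2 + deriv lam t) * f η t
      = c ^ 2 * iteratedDeriv 2 (fun x => f x t) η

/-- `f` solves, on `edgeCone c` and in the sense of distributions,
`f_tt + 2 lam f_t + (2/3) ((4/3) lam ^ 2 + lam') f = c ^ 2 f_ηη`. -/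
def IsWeakEdgeSolution (c : ℝ) (lam : ℝ → ℝ) (f : ℝ → ℝ → ℝ) : Prop :=
  ∀ φ : ℝ × ℝ → ℝ, ContDiff ℝ (⊤ : ℕ∞) φ → HasCompactSupport φ → tsupport φ ⊆ edgeCone c →
    ∫ z : ℝ × ℝ, f z.1 z.2 *
      (iteratedDeriv 2 (fun s => φ (z.1, s)) z.2
        - deriv (fun s => 2 * lam s * φ (z.1, s)) z.2
        + 2 / 3 * (4 / 3 * lam z.2 ^ 2 + deriv lam z.2) * φ z
        - c ^ 2 * iteratedDeriv 2 (fun x => φ (x, z.2)) z.1) = 0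

open Filter Topology

/-! Since `|dirX i + dirY i| ≤ 1`, with value `1` only for `d_0` and `d_1`, the particle lies on the
edge `x + y = c t` exactly when all directions used so far alternate between these two, up to a null
set (`IsPoissonProcess.edge_event_iff`, `IsPoissonProcess.ae_exists_eq`). Given `N t = n` and the
path of `N`, each of the two alternating words has probability `(1/4) (1/3)^n`, and `X - Y` is then
`± c U`, with `U` the signed time `∫ (-1)^N`. So the edge law is one quarter of the law of `± c U`
weighted by `z ^ N t` with `z = 1/3`, summed over both signs (`IsPoissonProcess.measure_altDir`).

Let `a` and `b` be the times spent in the current sense of motion and in the opposite one. With the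
factor `exp (-Λ)` removed and each event weighted by `z`, the density `p(a, b)` of `b` satisfies, by
conditioning on the last event, `p(a, b) = m(b) + ∫_0^a m(s + b) p(b, s) ds` with `m = z λ`. This
equation has a nonnegative solution `edgeKernel`, the limit of a monotone iteration controlled by a
Gronwall bound. That this solution is the right density is shown by characteristic functions: the
normalised functions of `edgeKernel` and of the Poisson process both solve `L_ξ' = m exp(-2 i ξ t)
L_{-ξ}`, `L_ξ(0) = 1` (`isCharSolution_edgeChar`, `IsPoissonProcess.isCharSolution`), and the
solution is unique (`IsCharSolution.unique`). The result is `IsPoissonProcess.map_signedTime_add`.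

Only the product `m = z λ` enters the kernel. The edge problem (`z = 1/3`, rate `λ`) and the
telegraph process (`z = 1`, rate `λ / 3`) therefore share one kernel and differ by an explicit
exponential factor and a scaling, which is the explicit formula. Evaluating the characteristic
functions at `ξ = 0` gives the total mass.

For the differential equation, the integral equation yields `∂_a p(a, b) = m(a + b) p(b, a)`. In the
coordinates `a, b = (t ± η/c)/2` the function `exp(-Λ) p` and its reflection in `η` solve two
coupled transport equations; their sum `f` and difference `w` solve a first-order system
(`isEdgeSystem_edgeDensity`), and eliminating `w` gives the second-order equation. The elimination
is classical when `λ` is `C²`, and is done against test functions when `λ` is only `C¹`. Smoothness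
of `p` is bootstrapped from the integral equation, with domination arguments because `λ` may be
unbounded at `0`. -/

/-- A rate function: nonnegative, of class `C¹` on `(0, ∞)`, integrable at `0` and, for
convenience, extended by `0` to `(-∞, 0]`. -/
structure IsRate (m : ℝ → ℝ) : Prop where
  measurable : Measurable m
  nonneg : ∀ x, 0 ≤ m x
  zero : ∀ x ≤ 0, m x = 0
  contDiffOn : ContDiffOn ℝ 1 m (Ioi 0)
  integrableOn : ∀ t, 0 < t → IntegrableOn m (Ioc 0 t)

/-! ### Rate functions and their primitives. -/

namespace IsRate

variable {m : ℝ → ℝ} (hm : IsRate m)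
include hm

lemma intervalIntegrable_zero (t : ℝ) : IntervalIntegrable m volume 0 t := by
  rcases lt_or_ge 0 t with h | h
  · exact (intervalIntegrable_iff_integrableOn_Ioc_of_le h.le).2 (hm.integrableOn t h)
  · refine IntervalIntegrable.symm ((intervalIntegrable_iff_integrableOn_Ioc_of_le h).2 ?_)
    refine (integrableOn_zero (s := Ioc t 0)).congr_fun (fun x hx => ?_) measurableSet_Ioc
    exact (hm.zero x hx.2).symm

lemma intervalIntegrable (s t : ℝ) : IntervalIntegrable m volume s t :=
  (hm.intervalIntegrable_zero s).symm.trans (hm.intervalIntegrable_zero t)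

lemma continuousOn : ContinuousOn m (Ioi 0) := hm.contDiffOn.continuousOn

lemma continuous_primitive : Continuous fun t => ∫ s in (0 : ℝ)..t, m s :=
  intervalIntegral.continuous_primitive (fun a b => hm.intervalIntegrable a b) 0

lemma hasDerivAt_primitive {t : ℝ} (ht : 0 < t) :
    HasDerivAt (fun t => ∫ s in (0 : ℝ)..t, m s) (m t) t :=
  intervalIntegral.integral_hasDerivAt_right (hm.intervalIntegrable 0 t)
    hm.measurable.stronglyMeasurable.stronglyMeasurableAtFilter
    (hm.continuousOn.continuousAt (Ioi_mem_nhds ht))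

/-- The integrand is the derivative of the exponential of the primitive. This identity closes the
Gronwall induction for the iterates without loss, so it is stated for `[0, ∞]`-valued integrals. -/
lemma lintegral_mul_exp {t : ℝ} (ht : 0 ≤ t) :
    1 + ∫⁻ r in Ioo 0 t, ENNReal.ofReal (m r) * ENNReal.ofReal (Real.exp (∫ s in (0 : ℝ)..r, m s))
      = ENNReal.ofReal (Real.exp (∫ s in (0 : ℝ)..t, m s)) := by
  have hc : Continuous fun t => Real.exp (∫ s in (0 : ℝ)..t, m s) :=
    Real.continuous_exp.comp hm.continuous_primitive
  have hint : IntervalIntegrable (fun r => m r * Real.exp (∫ s in (0 : ℝ)..r, m s)) volume 0 t :=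
    (hm.intervalIntegrable 0 t).mul_continuousOn hc.continuousOn
  have key : ∫ r in (0 : ℝ)..t, m r * Real.exp (∫ s in (0 : ℝ)..r, m s)
      = Real.exp (∫ s in (0 : ℝ)..t, m s) - 1 := by
    rw [intervalIntegral.integral_eq_sub_of_hasDerivAt_of_le ht hc.continuousOn
      (f' := fun r => m r * Real.exp (∫ s in (0 : ℝ)..r, m s)) _ hint]
    · simp
    · intro x hx
      have := (hm.hasDerivAt_primitive hx.1).exp
      rwa [mul_comm] at this
  have h2 : ∫⁻ r in Ioo 0 t, ENNReal.ofReal (m r) *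
      ENNReal.ofReal (Real.exp (∫ s in (0 : ℝ)..r, m s))
      = ENNReal.ofReal (∫ r in (0 : ℝ)..t, m r * Real.exp (∫ s in (0 : ℝ)..r, m s)) := by
    rw [intervalIntegral.integral_of_le ht, ofReal_integral_eq_lintegral_ofReal
      ((intervalIntegrable_iff_integrableOn_Ioc_of_le ht).1 hint)
      (ae_of_all _ fun r => mul_nonneg (hm.nonneg r) (Real.exp_pos _).le),
      Measure.restrict_congr_set Ioo_ae_eq_Ioc]
    simp_rw [ENNReal.ofReal_mul (hm.nonneg _)]
  rw [h2, key, ← ENNReal.ofReal_one, ← ENNReal.ofReal_add zero_le_one]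
  · congr 1; ring
  · have := intervalIntegral.integral_nonneg (μ := volume) ht (fun s _ => hm.nonneg s)
    linarith [Real.add_one_le_exp (∫ s in (0 : ℝ)..t, m s)]

end IsRate

/-! ### Construction of the kernel by monotone iteration in `[0, ∞]`. -/

/-- One step of the iteration that constructs the kernel: `q` is a function of the times spent
in the current direction and in the other one. -/
noncomputable def edgeStep (m : ℝ → ℝ) (q : ℝ × ℝ → ℝ≥0∞) (z : ℝ × ℝ) : ℝ≥0∞ :=
  ENNReal.ofReal (m z.2) + ∫⁻ s in Ioo 0 z.1, ENNReal.ofReal (m (s + z.2)) * q (z.2, s)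

/-- The iterates that converge to the kernel. -/
noncomputable def edgeIter (m : ℝ → ℝ) (n : ℕ) : ℝ × ℝ → ℝ≥0∞ := (edgeStep m)^[n] 0

/-- The kernel, with values in `[0, ∞]`. -/
noncomputable def edgeKernelE (m : ℝ → ℝ) (z : ℝ × ℝ) : ℝ≥0∞ := ⨆ n, edgeIter m n z

lemma edgeIter_succ (m : ℝ → ℝ) (n : ℕ) : edgeIter m (n + 1) = edgeStep m (edgeIter m n) :=
  Function.iterate_succ_apply' _ _ _

lemma measurable_edgeStep {m : ℝ → ℝ} (hm : Measurable m) {q : ℝ × ℝ → ℝ≥0∞} (hq : Measurable q) :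
    Measurable (edgeStep m q) := by
  have h : ∀ z : ℝ × ℝ, ∫⁻ s in Ioo 0 z.1, ENNReal.ofReal (m (s + z.2)) * q (z.2, s)
      = ∫⁻ s, {p : (ℝ × ℝ) × ℝ | 0 < p.2 ∧ p.2 < p.1.1}.indicator
        (fun p => ENNReal.ofReal (m (p.2 + p.1.2)) * q (p.1.2, p.2)) (z, s) := by
    intro z
    rw [← lintegral_indicator measurableSet_Ioo]
    rfl
  unfold edgeStep
  simp_rw [h]
  refine Measurable.add (by fun_prop) (Measurable.lintegral_prod_right' (Measurable.indicator ?_ ?_))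
  · fun_prop
  · exact (measurableSet_lt measurable_const measurable_snd).inter
      (measurableSet_lt measurable_snd (measurable_fst.comp measurable_fst))

lemma measurable_edgeIter {m : ℝ → ℝ} (hm : Measurable m) (n : ℕ) : Measurable (edgeIter m n) := by
  induction n with
  | zero => exact measurable_zero
  | succ n ih => rw [edgeIter_succ]; exact measurable_edgeStep hm ih

lemma measurable_edgeKernelE {m : ℝ → ℝ} (hm : Measurable m) : Measurable (edgeKernelE m) :=
  Measurable.iSup fun n => measurable_edgeIter hm n

lemma edgeStep_mono (m : ℝ → ℝ) : Monotone (edgeStep m) := fun q q' h z => by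
  unfold edgeStep
  gcongr
  exact h _

lemma edgeIter_mono (m : ℝ → ℝ) : Monotone (edgeIter m) := by
  refine monotone_nat_of_le_succ fun n => ?_
  induction n with
  | zero => intro z; exact zero_le
  | succ n ih => rw [edgeIter_succ, edgeIter_succ m (n + 1)]; exact edgeStep_mono m ih

/-- Monotone convergence lets the step commute with the supremum of the increasing iterates. -/
lemma edgeKernelE_eq {m : ℝ → ℝ} (hm : Measurable m) (z : ℝ × ℝ) :
    edgeKernelE m z = edgeStep m (edgeKernelE m) z := by
  have h1 : edgeKernelE m z = ⨆ n, edgeStep m (edgeIter m n) z := by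
    refine le_antisymm (iSup_le fun n => ?_) (iSup_le fun n => ?_)
    · refine le_trans (edgeIter_mono m (Nat.le_succ n) z) ?_
      rw [Nat.succ_eq_add_one, edgeIter_succ]
      exact le_iSup (fun n => edgeStep m (edgeIter m n) z) n
    · rw [← edgeIter_succ]
      exact le_iSup (fun n => edgeIter m n z) (n + 1)
  rw [h1]
  unfold edgeStep edgeKernelE
  simp_rw [ENNReal.mul_iSup]
  rw [lintegral_iSup, ENNReal.add_iSup]
  · intro n
    exact Measurable.mul (by fun_prop) ((measurable_edgeIter hm n).comp (by fun_prop))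
  · intro i j hij s
    exact mul_le_mul_right (edgeIter_mono m hij _) _

/-- The first argument occurs only as the upper limit of an integral of a nonnegative function. All
later dominations of the kernel rest on this monotonicity. -/
lemma edgeKernelE_mono (m : ℝ → ℝ) {a a' : ℝ} (h : a ≤ a') (b : ℝ) :
    edgeKernelE m (a, b) ≤ edgeKernelE m (a', b) := by
  refine iSup_mono fun n => ?_
  cases n with
  | zero => exact le_rfl
  | succ n =>
    rw [edgeIter_succ]
    unfold edgeStep
    gcongr

/-- The triangle `0 < b < r < t`. -/
def openTriangle (t : ℝ) : Set (ℝ × ℝ) := {p | 0 < p.1 ∧ p.1 < p.2 ∧ p.2 < t}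

lemma measurableSet_triangle (t : ℝ) :
    MeasurableSet (openTriangle t) :=
  (measurableSet_lt measurable_const measurable_fst).inter
    ((measurableSet_lt measurable_fst measurable_snd).inter
      (measurableSet_lt measurable_snd measurable_const))

/-- Change of variables `r = s + b` and Fubini on the triangle `0 < b < r < t`. -/
lemma lintegral_edgeStep {m : ℝ → ℝ} (hm : Measurable m) {q : ℝ × ℝ → ℝ≥0∞} (hq : Measurable q)
    (t : ℝ) :
    ∫⁻ b in Ioo 0 t, edgeStep m q (t - b, b)
      = (∫⁻ b in Ioo 0 t, ENNReal.ofReal (m b))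
        + ∫⁻ r in Ioo 0 t, ENNReal.ofReal (m r) * ∫⁻ b in Ioo 0 r, q (b, r - b) := by
  unfold edgeStep
  rw [lintegral_add_left (by fun_prop)]
  congr 1
  have h1 : ∀ b, ∫⁻ s in Ioo 0 (t - b), ENNReal.ofReal (m (s + b)) * q (b, s)
      = ∫⁻ r in Ioo b t, ENNReal.ofReal (m r) * q (b, r - b) := by
    intro b
    rw [← lintegral_indicator measurableSet_Ioo, ← lintegral_indicator measurableSet_Ioo,
      ← lintegral_sub_right_eq_self _ b]
    refine lintegral_congr fun r => ?_
    by_cases h : b < r ∧ r < t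
    · rw [indicator_of_mem (show r - b ∈ Ioo 0 (t - b) from ⟨by linarith, by linarith⟩),
        indicator_of_mem (show r ∈ Ioo b t from h), sub_add_cancel]
    · rw [indicator_of_notMem, indicator_of_notMem (show r ∉ Ioo b t from h)]
      rintro ⟨h1, h2⟩
      exact h ⟨by linarith, by linarith⟩
  simp_rw [h1]
  have h2 : ∀ b, (Ioo 0 t).indicator
      (fun b => ∫⁻ r in Ioo b t, ENNReal.ofReal (m r) * q (b, r - b)) b
      = ∫⁻ r, (openTriangle t).indicator
        (fun p => ENNReal.ofReal (m p.2) * q (p.1, p.2 - p.1)) (b, r) := by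
    intro b
    by_cases hb : 0 < b ∧ b < t
    · rw [indicator_of_mem (show b ∈ Ioo 0 t from hb), ← lintegral_indicator measurableSet_Ioo]
      refine lintegral_congr fun r => ?_
      simp only [indicator, mem_Ioo, openTriangle, mem_ofPred_eq, hb.1, true_and]
    · rw [indicator_of_notMem (show b ∉ Ioo 0 t from hb)]
      symm
      rw [lintegral_eq_zero_iff']
      · refine ae_of_all _ fun r => indicator_of_notMem ?_ _
        rintro ⟨h1, h2, h3⟩
        exact hb ⟨h1, lt_trans h2 h3⟩
      · refine Measurable.aemeasurable ((Measurable.indicator (by fun_prop) ?_).comp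
          measurable_prodMk_left)
        exact measurableSet_triangle t
  rw [← lintegral_indicator measurableSet_Ioo]
  simp_rw [h2]
  rw [lintegral_lintegral_swap]
  · rw [← lintegral_indicator measurableSet_Ioo]
    refine lintegral_congr fun r => ?_
    by_cases hr : 0 < r ∧ r < t
    · rw [indicator_of_mem (show r ∈ Ioo 0 t from hr), ← lintegral_const_mul _ (by fun_prop),
        ← lintegral_indicator measurableSet_Ioo]
      refine lintegral_congr fun b => ?_
      simp only [indicator, mem_Ioo, openTriangle, mem_ofPred_eq, hr.2, and_true]
    · rw [indicator_of_notMem (show r ∉ Ioo 0 t from hr)]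
      rw [lintegral_eq_zero_iff']
      · refine ae_of_all _ fun b => indicator_of_notMem ?_ _
        rintro ⟨h1, h2, h3⟩
        exact hr ⟨lt_trans h1 h2, h3⟩
      · refine Measurable.aemeasurable ((Measurable.indicator (by fun_prop) ?_).comp
          measurable_prodMk_right)
        exact measurableSet_triangle t
  · refine Measurable.aemeasurable (Measurable.indicator (by fun_prop) ?_)
    exact measurableSet_triangle t

lemma setLIntegral_Ioo_reflect (g : ℝ → ℝ≥0∞) (r : ℝ) :
    ∫⁻ b in Ioo 0 r, g (r - b) = ∫⁻ b in Ioo 0 r, g b := by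
  rw [← lintegral_indicator measurableSet_Ioo, ← lintegral_indicator measurableSet_Ioo,
    ← lintegral_sub_left_eq_self _ r]
  refine lintegral_congr fun b => ?_
  simp only [indicator, mem_Ioo, sub_pos, sub_lt_self_iff, sub_sub_cancel, and_comm]

/-- Gronwall along antidiagonals: integrating the step over `b` gives `∫ m(r) (1 + previous integral
at r) dr`, and `exp` of the primitive is the fixed point of this inequality. -/
lemma lintegral_edgeIter_le {m : ℝ → ℝ} (hm : IsRate m) (n : ℕ) {t : ℝ} (ht : 0 ≤ t) :
    1 + ∫⁻ b in Ioo 0 t, edgeIter m n (t - b, b)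
      ≤ ENNReal.ofReal (Real.exp (∫ s in (0 : ℝ)..t, m s)) := by
  induction n generalizing t with
  | zero =>
    simp only [edgeIter, Function.iterate_zero, id_eq, Pi.zero_apply, lintegral_zero, add_zero]
    rw [ENNReal.one_le_ofReal]
    exact Real.one_le_exp (intervalIntegral.integral_nonneg ht fun s _ => hm.nonneg s)
  | succ n ih =>
    rw [edgeIter_succ, lintegral_edgeStep hm.measurable (measurable_edgeIter hm.measurable n),
      ← lintegral_add_left (by have := hm.measurable; fun_prop), ← hm.lintegral_mul_exp ht]
    gcongr 1 + ?_
    refine setLIntegral_mono' measurableSet_Ioo fun r hr => ?_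
    have := ih hr.1.le
    -- The step swaps the two arguments of the kernel, so the induction hypothesis is needed along
    -- the reflected antidiagonal.
    rw [← setLIntegral_Ioo_reflect] at this
    simp only [sub_sub_cancel] at this
    calc ENNReal.ofReal (m r) + ENNReal.ofReal (m r) * ∫⁻ b in Ioo 0 r, edgeIter m n (b, r - b)
        = ENNReal.ofReal (m r) * (1 + ∫⁻ b in Ioo 0 r, edgeIter m n (b, r - b)) := by ring
      _ ≤ _ := by gcongr

lemma lintegral_edgeKernelE_ne_top {m : ℝ → ℝ} (hm : IsRate m) {t : ℝ} (ht : 0 ≤ t) :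
    ∫⁻ b in Ioo 0 t, edgeKernelE m (t - b, b) ≠ ∞ := by
  refine ne_top_of_le_ne_top
    (ENNReal.ofReal_ne_top (r := Real.exp (∫ s in (0 : ℝ)..t, m s))) ?_
  unfold edgeKernelE
  rw [lintegral_iSup]
  · exact iSup_le fun n => le_trans le_add_self (lintegral_edgeIter_le hm n ht)
  · intro n
    exact (measurable_edgeIter hm.measurable n).comp (by fun_prop)
  · intro i j hij b
    exact edgeIter_mono m hij _

/-- For `s < a` one has `b ≤ a + b - s`, so monotonicity in the first argument moves the segment
onto the antidiagonal at time `a + b`. -/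
lemma lintegral_edgeKernelE_line_ne_top {m : ℝ → ℝ} (hm : IsRate m) {a b : ℝ} (ha : 0 ≤ a)
    (hb : 0 ≤ b) : ∫⁻ s in Ioo 0 a, edgeKernelE m (b, s) ≠ ∞ := by
  refine ne_top_of_le_ne_top (lintegral_edgeKernelE_ne_top hm (add_nonneg ha hb)) ?_
  calc ∫⁻ s in Ioo 0 a, edgeKernelE m (b, s)
      ≤ ∫⁻ s in Ioo 0 a, edgeKernelE m (a + b - s, s) :=
        setLIntegral_mono' measurableSet_Ioo fun s hs => edgeKernelE_mono m (by linarith [hs.2]) _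
    _ ≤ _ := lintegral_mono_set (Ioo_subset_Ioo_right (by linarith))

/-- Only `m` on `[b, a + b]` enters the step, and this interval avoids the possible singularity at
`0`; the remaining factor is integrable by the previous bound. -/
lemma edgeKernelE_ne_top {m : ℝ → ℝ} (hm : IsRate m) {a b : ℝ} (ha : 0 ≤ a) (hb : 0 < b) :
    edgeKernelE m (a, b) ≠ ∞ := by
  rw [edgeKernelE_eq hm.measurable]
  unfold edgeStep
  have hsub : Icc b (a + b) ⊆ Ioi 0 := fun x hx => lt_of_lt_of_le hb hx.1
  obtain ⟨C, hC⟩ := (isCompact_Icc.image_of_continuousOn (hm.continuousOn.mono hsub)).bddAbove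
  refine ENNReal.add_ne_top.2 ⟨ENNReal.ofReal_ne_top, ?_⟩
  refine ne_top_of_le_ne_top (ENNReal.mul_ne_top (ENNReal.ofReal_ne_top (r := C))
    (lintegral_edgeKernelE_line_ne_top hm ha hb.le)) ?_
  rw [← lintegral_const_mul' _ _ ENNReal.ofReal_ne_top]
  refine setLIntegral_mono' measurableSet_Ioo fun s hs => ?_
  gcongr
  exact hC (mem_image_of_mem m ⟨by linarith [hs.1], by linarith [hs.2]⟩)

/-- The kernel: `edgeKernel m a b` is the density (up to normalisation) of the time `b` spent in
the other direction, on the event that the particle has spent the time `a` in its current one. -/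
noncomputable def edgeKernel (m : ℝ → ℝ) (a b : ℝ) : ℝ := (edgeKernelE m (a, b)).toReal

lemma edgeKernel_nonneg (m : ℝ → ℝ) (a b : ℝ) : 0 ≤ edgeKernel m a b := ENNReal.toReal_nonneg

lemma measurable_edgeKernel {m : ℝ → ℝ} (hm : IsRate m) :
    Measurable fun z : ℝ × ℝ => edgeKernel m z.1 z.2 :=
  (measurable_edgeKernelE hm.measurable).ennreal_toReal

lemma ofReal_edgeKernel {m : ℝ → ℝ} (hm : IsRate m) {a b : ℝ} (ha : 0 ≤ a) (hb : 0 < b) :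
    ENNReal.ofReal (edgeKernel m a b) = edgeKernelE m (a, b) :=
  ENNReal.ofReal_toReal (edgeKernelE_ne_top hm ha hb)

lemma edgeKernel_mono {m : ℝ → ℝ} (hm : IsRate m) {a a' b : ℝ} (ha : 0 ≤ a) (h : a ≤ a')
    (hb : 0 < b) : edgeKernel m a b ≤ edgeKernel m a' b :=
  ENNReal.toReal_mono (edgeKernelE_ne_top hm (ha.trans h) hb) (edgeKernelE_mono m h b)

lemma integrableOn_edgeKernel {m : ℝ → ℝ} (hm : IsRate m) {a b : ℝ} (ha : 0 ≤ a) (hb : 0 ≤ b) :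
    IntegrableOn (fun s => edgeKernel m b s) (Ioc 0 a) := by
  rw [← integrableOn_Icc_iff_integrableOn_Ioc, integrableOn_Icc_iff_integrableOn_Ioo]
  refine integrable_toReal_of_lintegral_ne_top ?_ (lintegral_edgeKernelE_line_ne_top hm ha hb)
  exact ((measurable_edgeKernelE hm.measurable).comp (by fun_prop)).aemeasurable

lemma integrableOn_edgeKernel_antidiag {m : ℝ → ℝ} (hm : IsRate m) {t : ℝ} (ht : 0 ≤ t) :
    IntegrableOn (fun b => edgeKernel m (t - b) b) (Ioc 0 t) := by
  rw [← integrableOn_Icc_iff_integrableOn_Ioc, integrableOn_Icc_iff_integrableOn_Ioo]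
  refine integrable_toReal_of_lintegral_ne_top ?_ (lintegral_edgeKernelE_ne_top hm ht)
  exact ((measurable_edgeKernelE hm.measurable).comp (by fun_prop)).aemeasurable

lemma edgeKernel_eq {m : ℝ → ℝ} (hm : IsRate m) {a b : ℝ} (ha : 0 ≤ a) (hb : 0 < b) :
    edgeKernel m a b = m b + ∫ s in (0 : ℝ)..a, m (s + b) * edgeKernel m b s := by
  have h := edgeKernelE_ne_top hm ha hb
  rw [edgeKernelE_eq hm.measurable] at h
  unfold edgeStep at h
  have h2 := (ENNReal.add_ne_top.1 h).2
  rw [edgeKernel, edgeKernelE_eq hm.measurable, edgeStep, ENNReal.toReal_add ENNReal.ofReal_ne_top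
    h2, ENNReal.toReal_ofReal (hm.nonneg b), intervalIntegral.integral_of_le ha,
    integral_Ioc_eq_integral_Ioo, integral_eq_lintegral_of_nonneg_ae]
  · congr 2
    refine setLIntegral_congr_fun measurableSet_Ioo fun s hs => ?_
    simp only
    rw [ENNReal.ofReal_mul (hm.nonneg _), ofReal_edgeKernel hm hb.le hs.1]
  · exact ae_of_all _ fun s => mul_nonneg (hm.nonneg _) (edgeKernel_nonneg _ _ _)
  · have := measurable_edgeKernel hm
    have h3 := hm.measurable
    refine Measurable.aestronglyMeasurable (Measurable.mul (by fun_prop) ?_)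
    exact this.comp (by fun_prop : Measurable fun s : ℝ => (b, s))

/-- Needed for Fubini. The absolute integral is at most the supremum of `|g|` on `[0, t]` times a
quantity that is a summand of the integrated fixed-point equation, hence finite. -/
lemma integrable_edge_triangle {m : ℝ → ℝ} (hm : IsRate m) {g : ℝ → ℂ} (hg : Continuous g) {t : ℝ}
    (ht : 0 ≤ t) :
    Integrable ((openTriangle t).indicator fun p =>
      g p.1 * ((m p.2 * edgeKernel m p.1 (p.2 - p.1) : ℝ) : ℂ)) (volume.prod volume) := by
  have h1 := hm.measurable
  have h2 : Measurable fun p : ℝ × ℝ => edgeKernel m p.1 (p.2 - p.1) :=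
    (measurable_edgeKernel hm).comp (by fun_prop : Measurable fun p : ℝ × ℝ => (p.1, p.2 - p.1))
  have hmeas : Measurable ((openTriangle t).indicator fun p =>
      g p.1 * ((m p.2 * edgeKernel m p.1 (p.2 - p.1) : ℝ) : ℂ)) :=
    Measurable.indicator (by fun_prop) (measurableSet_triangle t)
  refine ⟨hmeas.aestronglyMeasurable, ?_⟩
  obtain ⟨C, hC⟩ := ((isCompact_Icc (a := 0) (b := t)).image_of_continuousOn
    hg.norm.continuousOn).bddAbove
  rw [hasFiniteIntegral_iff_enorm, lintegral_prod_symm' _ hmeas.enorm]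
  have hfin : ENNReal.ofReal C * ∫⁻ r in Ioo 0 t, ENNReal.ofReal (m r) *
      ∫⁻ b in Ioo 0 r, edgeKernelE m (b, r - b) < ∞ := by
    refine ENNReal.mul_lt_top ENNReal.ofReal_lt_top (lt_of_le_of_lt (le_add_self
      (b := ∫⁻ b in Ioo 0 t, ENNReal.ofReal (m b))) ?_)
    rw [← lintegral_edgeStep hm.measurable (measurable_edgeKernelE hm.measurable)]
    simp_rw [← edgeKernelE_eq hm.measurable]
    exact (lintegral_edgeKernelE_ne_top hm ht).lt_top
  refine lt_of_le_of_lt ?_ hfin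
  rw [← lintegral_const_mul' _ _ ENNReal.ofReal_ne_top, ← lintegral_indicator measurableSet_Ioo]
  refine lintegral_mono fun r => ?_
  by_cases hr : 0 < r ∧ r < t
  · rw [indicator_of_mem (show r ∈ Ioo 0 t from hr), ← mul_assoc,
      ← lintegral_const_mul' _ _ (ENNReal.mul_ne_top ENNReal.ofReal_ne_top ENNReal.ofReal_ne_top),
      ← lintegral_indicator measurableSet_Ioo]
    refine lintegral_mono fun b => ?_
    by_cases hb : 0 < b ∧ b < r
    · rw [indicator_of_mem (show b ∈ Ioo 0 r from hb),
        indicator_of_mem (show (b, r) ∈ openTriangle t from ⟨hb.1, hb.2, hr.2⟩), enorm_mul,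
        ← ofReal_edgeKernel hm hb.1.le (sub_pos.2 hb.2), mul_assoc,
        ← ENNReal.ofReal_mul (hm.nonneg r), ← ofReal_norm, ← ofReal_norm,
        Complex.norm_of_nonneg (mul_nonneg (hm.nonneg r) (edgeKernel_nonneg _ _ _))]
      gcongr
      exact hC (mem_image_of_mem _ ⟨hb.1.le, (hb.2.trans hr.2).le⟩)
    · rw [indicator_of_notMem (fun h => hb ⟨h.1, h.2.1⟩)]
      simp
  · rw [indicator_of_notMem (show r ∉ Ioo 0 t from hr)]
    refine le_of_eq ((lintegral_congr fun b => ?_).trans lintegral_zero)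
    rw [indicator_of_notMem, enorm_zero]
    exact fun h => hr ⟨h.1.trans h.2.1, h.2.2⟩

lemma integral_edge_triangle_section (m : ℝ → ℝ) (g : ℝ → ℂ) {t r : ℝ} (hr : r ∈ Ioo 0 t) :
    ∫ b, ((openTriangle t).indicator fun p =>
      g p.1 * ((m p.2 * edgeKernel m p.1 (p.2 - p.1) : ℝ) : ℂ)) (b, r)
      = (m r : ℂ) * ∫ b in (0 : ℝ)..r, g b * (edgeKernel m b (r - b) : ℂ) := by
  rw [intervalIntegral.integral_of_le hr.1.le, integral_Ioc_eq_integral_Ioo,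
    ← integral_const_mul, ← integral_indicator measurableSet_Ioo]
  refine integral_congr_ae (ae_of_all _ fun b => ?_)
  by_cases hb : 0 < b ∧ b < r
  · simp only
    rw [indicator_of_mem (show b ∈ Ioo 0 r from hb),
      indicator_of_mem (show (b, r) ∈ openTriangle t from ⟨hb.1, hb.2, hr.2⟩)]
    push_cast; ring
  · simp only
    rw [indicator_of_notMem (show b ∉ Ioo 0 r from hb),
      indicator_of_notMem (fun h => hb ⟨h.1, h.2.1⟩)]

/-- The Volterra equation for integrals of the kernel along antidiagonals. -/
lemma integral_edgeKernel_antidiag {m : ℝ → ℝ} (hm : IsRate m) {g : ℝ → ℂ} (hg : Continuous g)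
    {t : ℝ} (ht : 0 ≤ t) :
    ∫ b in (0 : ℝ)..t, g b * (edgeKernel m (t - b) b : ℂ)
      = (∫ b in (0 : ℝ)..t, g b * (m b : ℂ))
        + ∫ r in (0 : ℝ)..t, (m r : ℂ) * ∫ b in (0 : ℝ)..r, g b * (edgeKernel m b (r - b) : ℂ) := by
  -- The inner integral over `r` is `g b (p(t - b, b) - m b)` by the integral equation of the
  -- kernel; the inner integral over `b` is the right-hand integrand.
  have hswap := integral_integral_swap (f := fun b r => ((openTriangle t).indicator fun p =>
      g p.1 * ((m p.2 * edgeKernel m p.1 (p.2 - p.1) : ℝ) : ℂ)) (b, r))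
    (integrable_edge_triangle hm hg ht)
  have h1 : ∀ b ∈ Ioo 0 t, ∫ r, ((openTriangle t).indicator fun p =>
      g p.1 * ((m p.2 * edgeKernel m p.1 (p.2 - p.1) : ℝ) : ℂ)) (b, r)
      = g b * (edgeKernel m (t - b) b : ℂ) - g b * (m b : ℂ) := by
    intro b hb
    rw [edgeKernel_eq hm (sub_nonneg.2 hb.2.le) hb.1]
    have : ∫ s in (0 : ℝ)..(t - b), m (s + b) * edgeKernel m b s
        = ∫ r in b..t, m r * edgeKernel m b (r - b) := by
      rw [← sub_self b, ← intervalIntegral.integral_comp_sub_right]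
      simp
    rw [this, intervalIntegral.integral_of_le hb.2.le, integral_Ioc_eq_integral_Ioo]
    push_cast
    rw [mul_add, add_sub_cancel_left, ← integral_complex_ofReal, ← integral_const_mul,
      ← integral_indicator measurableSet_Ioo]
    refine integral_congr_ae (ae_of_all _ fun r => ?_)
    by_cases hr : b < r ∧ r < t
    · simp only
      rw [indicator_of_mem (show r ∈ Ioo b t from hr), indicator_of_mem (show (b, r) ∈ openTriangle t from ⟨hb.1, hr.1, hr.2⟩)]
      push_cast; rfl
    · simp only
      rw [indicator_of_notMem (show r ∉ Ioo b t from hr), indicator_of_notMem (fun h => hr ⟨h.2.1, h.2.2⟩)]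
  have e1 : ∫ b, ∫ r, ((openTriangle t).indicator fun p =>
      g p.1 * ((m p.2 * edgeKernel m p.1 (p.2 - p.1) : ℝ) : ℂ)) (b, r)
      = ∫ b in Ioo 0 t, (g b * (edgeKernel m (t - b) b : ℂ) - g b * (m b : ℂ)) := by
    rw [← setIntegral_eq_integral_of_forall_compl_eq_zero (s := Ioo 0 t)]
    · exact setIntegral_congr_fun measurableSet_Ioo h1
    · intro b hb
      refine (integral_congr_ae (ae_of_all _ fun r => ?_)).trans (integral_zero _ _)
      exact indicator_of_notMem (fun h => hb ⟨h.1, h.2.1.trans h.2.2⟩) _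
  have e2 : ∫ r, ∫ b, ((openTriangle t).indicator fun p =>
      g p.1 * ((m p.2 * edgeKernel m p.1 (p.2 - p.1) : ℝ) : ℂ)) (b, r)
      = ∫ r in Ioo 0 t, (m r : ℂ) * ∫ b in (0 : ℝ)..r, g b * (edgeKernel m b (r - b) : ℂ) := by
    rw [← setIntegral_eq_integral_of_forall_compl_eq_zero (s := Ioo 0 t)]
    · exact setIntegral_congr_fun measurableSet_Ioo fun r hr => integral_edge_triangle_section m g hr
    · intro r hr
      refine (integral_congr_ae (ae_of_all _ fun b => ?_)).trans (integral_zero _ _)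
      exact indicator_of_notMem (fun h => hr ⟨h.1.trans h.2.1, h.2.2⟩) _
  rw [e1, e2] at hswap
  have i1 : IntervalIntegrable (fun b => g b * (edgeKernel m (t - b) b : ℂ)) volume 0 t :=
    IntervalIntegrable.continuousOn_mul
      (((intervalIntegrable_iff_integrableOn_Ioc_of_le ht).2
        (integrableOn_edgeKernel_antidiag hm ht).ofReal)) hg.continuousOn
  have i2 : IntervalIntegrable (fun b => g b * (m b : ℂ)) volume 0 t :=
    IntervalIntegrable.continuousOn_mul
      ((intervalIntegrable_iff_integrableOn_Ioc_of_le ht).2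
        ((intervalIntegrable_iff_integrableOn_Ioc_of_le ht).1
          (hm.intervalIntegrable 0 t)).ofReal) hg.continuousOn
  rw [← integral_Ioc_eq_integral_Ioo, ← intervalIntegral.integral_of_le ht,
    intervalIntegral.integral_sub i1 i2, ← integral_Ioc_eq_integral_Ioo,
    ← intervalIntegral.integral_of_le ht] at hswap
  rw [← hswap]; ring

/-! ### Regularity of integrals depending on a parameter. -/

lemma hasFDerivAt_of_partials {S : Set (ℝ × ℝ)} (hS : IsOpen S) {F F1 F2 : ℝ × ℝ → ℝ}
    (h1 : ∀ z ∈ S, HasDerivAt (fun x => F (x, z.2)) (F1 z) z.1)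
    (h2 : ∀ z ∈ S, HasDerivAt (fun y => F (z.1, y)) (F2 z) z.2)
    (c1 : ContinuousOn F1 S) (c2 : ContinuousOn F2 S) {z : ℝ × ℝ} (hz : z ∈ S) :
    HasFDerivAt F (F1 z • ContinuousLinearMap.fst ℝ ℝ ℝ + F2 z • ContinuousLinearMap.snd ℝ ℝ ℝ) z := by
  have key := hasStrictFDerivAt_uncurry_coprod (𝕜 := ℝ) (u := z) (f := fun x y => F (x, y))
    (f₁ := fun x y => F1 (x, y) • ContinuousLinearMap.id ℝ ℝ)
    (f₂ := fun x y => F2 (x, y) • ContinuousLinearMap.id ℝ ℝ) ?_ ?_ ?_ ?_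
  · convert! key.hasFDerivAt using 1
  · filter_upwards [hS.mem_nhds hz] with v hv
    convert! (h1 v hv).hasFDerivAt using 1
    ext; simp [Function.HasUncurry.uncurry]
  · filter_upwards [hS.mem_nhds hz] with v hv
    convert! (h2 v hv).hasFDerivAt using 1
    ext; simp [Function.HasUncurry.uncurry]
  · exact (c1.continuousAt (hS.mem_nhds hz)).smul continuousAt_const
  · exact (c2.continuousAt (hS.mem_nhds hz)).smul continuousAt_const

lemma contDiffOn_succ_of_partials {S : Set (ℝ × ℝ)} (hS : IsOpen S) {F F1 F2 : ℝ × ℝ → ℝ} (n : ℕ)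
    (h1 : ∀ z ∈ S, HasDerivAt (fun x => F (x, z.2)) (F1 z) z.1)
    (h2 : ∀ z ∈ S, HasDerivAt (fun y => F (z.1, y)) (F2 z) z.2)
    (c1 : ContDiffOn ℝ n F1 S) (c2 : ContDiffOn ℝ n F2 S) : ContDiffOn ℝ (n + 1) F S := by
  rw [contDiffOn_succ_iff_hasFDerivWithinAt_of_uniqueDiffOn hS.uniqueDiffOn]
  -- The clause about analytic functions is void, since `n` is a natural number.
  refine ⟨fun h => absurd h (by exact_mod_cast WithTop.coe_ne_top), _, ?_, fun z hz =>
    (hasFDerivAt_of_partials hS h1 h2 c1.continuousOn c2.continuousOn hz).hasFDerivWithinAt⟩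
  exact (c1.smul contDiffOn_const).add (c2.smul contDiffOn_const)

/-- The open first quadrant. -/
def quadrant : Set (ℝ × ℝ) := Ioi 0 ×ˢ Ioi 0

lemma isOpen_quadrant : IsOpen quadrant := isOpen_Ioi.prod isOpen_Ioi

/-- `k (s, b)` is, for `b` in a compact subset of `(0, ∞)` and `s` in `(0, A]`, bounded by an
integrable function of `s`. -/
def LocallyDominated (k : ℝ × ℝ → ℝ) : Prop :=
  ∀ A β B : ℝ, 0 < A → 0 < β → β < B → ∃ g : ℝ → ℝ, IntegrableOn g (Ioc 0 A) ∧
    ∀ s ∈ Ioc 0 A, ∀ b ∈ Icc β B, |k (s, b)| ≤ g s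

lemma LocallyDominated.add {k k' : ℝ × ℝ → ℝ} (h : LocallyDominated k) (h' : LocallyDominated k') :
    LocallyDominated fun z => k z + k' z := by
  intro A β B hA hβ hB
  obtain ⟨g, hg, hb⟩ := h A β B hA hβ hB
  obtain ⟨g', hg', hb'⟩ := h' A β B hA hβ hB
  exact ⟨fun s => g s + g' s, hg.add hg', fun s hs b hb0 =>
    (abs_add_le _ _).trans (add_le_add (hb s hs b hb0) (hb' s hs b hb0))⟩

/-- Multiplication by `φ (s + b)`, with `φ` continuous on `(0, ∞)`, preserves domination. -/
lemma LocallyDominated.mul_left {k : ℝ × ℝ → ℝ} (h : LocallyDominated k) {φ : ℝ → ℝ}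
    (hφ : ContinuousOn φ (Ioi 0)) : LocallyDominated fun z => φ (z.1 + z.2) * k z := by
  intro A β B hA hβ hB
  obtain ⟨g, hg, hb⟩ := h A β B hA hβ hB
  have hsub : Icc β (A + B) ⊆ Ioi 0 := fun x hx => lt_of_lt_of_le hβ hx.1
  obtain ⟨C, hC⟩ := (isCompact_Icc.image_of_continuousOn (hφ.mono hsub).abs).bddAbove
  refine ⟨fun s => C * g s, hg.const_mul C, fun s hs b hb0 => ?_⟩
  have h1 : |φ (s + b)| ≤ C :=
    hC (mem_image_of_mem _ ⟨by linarith [hs.1, hb0.1], by linarith [hs.2, hb0.2]⟩)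
  rw [abs_mul]
  exact mul_le_mul h1 (hb s hs b hb0) (abs_nonneg _) ((abs_nonneg _).trans h1)

lemma LocallyDominated.integrableOn {k : ℝ × ℝ → ℝ} (h : LocallyDominated k) {a b : ℝ}
    (ha : 0 < a) (hb : 0 < b)
    (hmeas : AEStronglyMeasurable (fun s => k (s, b)) (volume.restrict (Ioi 0))) :
    IntegrableOn (fun s => k (s, b)) (Ioc 0 a) := by
  obtain ⟨g, hg, hgb⟩ := h a b (b + 1) ha hb (by linarith)
  refine Integrable.mono' hg (hmeas.mono_set Ioc_subset_Ioi_self) ?_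
  exact (ae_restrict_iff' measurableSet_Ioc).2
    (ae_of_all _ fun s hs => hgb s hs b ⟨le_rfl, by linarith⟩)

/-- The integral `∫ s in 0..a, k (s, b)` as a function of `(a, b)`. -/
noncomputable def partialIntegral (k : ℝ × ℝ → ℝ) (z : ℝ × ℝ) : ℝ :=
  ∫ s in (0 : ℝ)..z.1, k (s, z.2)

/-- Only separate continuity in `b` is assumed, because the first application precedes the joint
continuity of the kernel; domination supplies the rest. -/
lemma continuousOn_partialIntegral {k : ℝ × ℝ → ℝ}
    (hmeas : ∀ b, 0 < b → AEStronglyMeasurable (fun s => k (s, b)) (volume.restrict (Ioi 0)))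
    (hcont : ∀ s, 0 < s → ContinuousOn (fun b => k (s, b)) (Ioi 0)) (hdom : LocallyDominated k) :
    ContinuousOn (partialIntegral k) quadrant := by
  rintro ⟨a₀, b₀⟩ ⟨ha₀, hb₀⟩
  simp only [mem_Ioi] at ha₀ hb₀
  refine ContinuousAt.continuousWithinAt ?_
  obtain ⟨g, hg, hgb⟩ := hdom (a₀ + 1) (b₀ / 2) (b₀ + 1) (by linarith) (by linarith) (by linarith)
  have hev : ∀ᶠ z : ℝ × ℝ in 𝓝 (a₀, b₀), z.1 ∈ Ioo 0 (a₀ + 1) ∧ z.2 ∈ Icc (b₀ / 2) (b₀ + 1) := by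
    refine (continuousAt_fst.eventually (Ioo_mem_nhds ha₀ (lt_add_one _))).and
      (continuousAt_snd.eventually (Icc_mem_nhds (by simpa using hb₀) (lt_add_one _)))
  -- With an indicator on a fixed interval, the moving endpoint and the parameter are treated by one
  -- dominated convergence.
  have heq : partialIntegral k =ᶠ[𝓝 (a₀, b₀)] fun z => ∫ s in Ioc 0 (a₀ + 1),
      (Iic z.1).indicator (fun s => k (s, z.2)) s := by
    filter_upwards [hev] with z hz
    rw [partialIntegral, intervalIntegral.integral_of_le hz.1.1.le,
      setIntegral_indicator measurableSet_Iic, Ioc_inter_Iic, min_eq_right hz.1.2.le]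
  refine ContinuousAt.congr ?_ heq.symm
  refine continuousAt_of_dominated (bound := g) ?_ ?_ hg ?_
  · filter_upwards [hev] with z hz
    exact ((hmeas z.2 (by linarith [hz.2.1])).mono_set Ioc_subset_Ioi_self).indicator
      measurableSet_Iic
  · filter_upwards [hev] with z hz
    refine (ae_restrict_iff' measurableSet_Ioc).2 (ae_of_all _ fun s hs => ?_)
    refine (norm_indicator_le_norm_self _ _).trans (hgb s hs z.2 hz.2)
  -- The indicator is locally constant in `z` unless `s = a₀`, a null set.
  · have : ∀ᵐ s ∂(volume.restrict (Ioc 0 (a₀ + 1))), s ≠ a₀ :=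
      ae_restrict_of_ae (Measure.ae_ne volume a₀)
    filter_upwards [this, ae_restrict_mem measurableSet_Ioc] with s hs hs0
    rcases lt_or_gt_of_ne hs with h | h
    · have h1 : (fun z : ℝ × ℝ => (Iic z.1).indicator (fun s => k (s, z.2)) s)
          =ᶠ[𝓝 (a₀, b₀)] fun z => k (s, z.2) := by
        filter_upwards [continuousAt_fst.eventually (lt_mem_nhds h)] with z hz
        exact indicator_of_mem (show s ∈ Iic z.1 from le_of_lt hz) _
      refine ContinuousAt.congr ?_ h1.symm
      exact ContinuousAt.comp (f := Prod.snd) (g := fun b => k (s, b))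
        ((hcont s hs0.1).continuousAt (Ioi_mem_nhds hb₀)) continuousAt_snd
    · have h1 : (fun z : ℝ × ℝ => (Iic z.1).indicator (fun s => k (s, z.2)) s)
          =ᶠ[𝓝 (a₀, b₀)] fun z => 0 := by
        filter_upwards [continuousAt_fst.eventually (gt_mem_nhds h)] with z hz
        exact indicator_of_notMem (s := Iic z.1) (fun h' : s ≤ z.1 => (lt_irrefl _ (lt_of_lt_of_le hz h'))) _
      exact ContinuousAt.congr continuousAt_const h1.symm

lemma ContinuousOn.aestronglyMeasurable_section {k : ℝ × ℝ → ℝ} (hk : ContinuousOn k quadrant)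
    {b : ℝ} (hb : 0 < b) :
    AEStronglyMeasurable (fun s => k (s, b)) (volume.restrict (Ioi 0)) :=
  (hk.comp (f := fun s => (s, b)) (by fun_prop) fun _ hs => ⟨hs, hb⟩).aestronglyMeasurable
    measurableSet_Ioi

lemma hasDerivAt_partialIntegral_fst {k : ℝ × ℝ → ℝ} (hk : ContinuousOn k quadrant)
    (hdom : LocallyDominated k) {z : ℝ × ℝ} (hz : z ∈ quadrant) :
    HasDerivAt (fun a => partialIntegral k (a, z.2)) (k z) z.1 := by
  have hc : ContinuousOn (fun s => k (s, z.2)) (Ioi 0) :=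
    hk.comp (f := fun s => (s, z.2)) (by fun_prop) fun _ hs => ⟨hs, hz.2⟩
  refine intervalIntegral.integral_hasDerivAt_right (f := fun s => k (s, z.2)) ?_
    (hc.stronglyMeasurableAtFilter isOpen_Ioi _ hz.1) (hc.continuousAt (Ioi_mem_nhds hz.1))
  rw [intervalIntegrable_iff_integrableOn_Ioc_of_le (le_of_lt hz.1)]
  exact hdom.integrableOn hz.1 hz.2 (hk.aestronglyMeasurable_section hz.2)

lemma hasDerivAt_partialIntegral_snd {k k' : ℝ × ℝ → ℝ} (hk : ContinuousOn k quadrant)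
    (hk' : ContinuousOn k' quadrant)
    (hd : ∀ z ∈ quadrant, HasDerivAt (fun b => k (z.1, b)) (k' z) z.2)
    (hdom : LocallyDominated k) (hdom' : LocallyDominated k') {z : ℝ × ℝ} (hz : z ∈ quadrant) :
    HasDerivAt (fun b => partialIntegral k (z.1, b)) (partialIntegral k' z) z.2 := by
  obtain ⟨a, b⟩ := z
  obtain ⟨ha, hb⟩ := hz
  simp only [mem_Ioi] at ha hb
  obtain ⟨g, hg, hgb⟩ := hdom' a (b / 2) (b + 1) ha (by linarith) (by linarith)
  refine (intervalIntegral.hasDerivAt_integral_of_dominated_loc_of_deriv_le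
    (F := fun b s => k (s, b)) (F' := fun b s => k' (s, b)) (bound := g)
    (s := Icc (b / 2) (b + 1)) (Icc_mem_nhds (by linarith) (by linarith)) ?_ ?_ ?_ ?_ ?_ ?_).2
  · filter_upwards [Ioi_mem_nhds hb] with x hx
    rw [uIoc_of_le ha.le]
    exact (hk.aestronglyMeasurable_section hx).mono_set Ioc_subset_Ioi_self
  · rw [intervalIntegrable_iff_integrableOn_Ioc_of_le ha.le]
    exact hdom.integrableOn ha hb (hk.aestronglyMeasurable_section hb)
  · rw [uIoc_of_le ha.le]
    exact (hk'.aestronglyMeasurable_section hb).mono_set Ioc_subset_Ioi_self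
  · rw [uIoc_of_le ha.le]
    exact ae_of_all _ fun s hs x hx => hgb s hs x hx
  · rwa [intervalIntegrable_iff_integrableOn_Ioc_of_le ha.le]
  · rw [uIoc_of_le ha.le]
    exact ae_of_all _ fun s hs x hx => hd (s, x) ⟨hs.1, by simp only [mem_Ioi]; linarith [hx.1]⟩

/-- One order is gained: the partial derivative in `a` is `k` itself, and the one in `b` is the
partial integral of `k'`. -/
lemma contDiffOn_partialIntegral {k k' : ℝ × ℝ → ℝ} (n : ℕ) (hk : ContDiffOn ℝ n k quadrant)
    (hk' : ContinuousOn k' quadrant)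
    (hd : ∀ z ∈ quadrant, HasDerivAt (fun b => k (z.1, b)) (k' z) z.2)
    (hdom : LocallyDominated k) (hdom' : LocallyDominated k')
    (hn : ContDiffOn ℝ n (partialIntegral k') quadrant) :
    ContDiffOn ℝ (n + 1) (partialIntegral k) quadrant :=
  contDiffOn_succ_of_partials isOpen_quadrant n
    (fun _ hz => hasDerivAt_partialIntegral_fst hk.continuousOn hdom hz)
    (fun _ hz => hasDerivAt_partialIntegral_snd hk.continuousOn hk' hd hdom hdom' hz) hk hn

namespace IsRate

variable {m : ℝ → ℝ} (hm : IsRate m)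
include hm

lemma hasDerivAt {x : ℝ} (hx : 0 < x) : HasDerivAt m (deriv m x) x :=
  ((hm.contDiffOn.contDiffAt (Ioi_mem_nhds hx)).differentiableAt one_ne_zero).hasDerivAt

lemma continuousOn_deriv : ContinuousOn (deriv m) (Ioi 0) :=
  hm.contDiffOn.continuousOn_deriv_of_isOpen isOpen_Ioi le_rfl

end IsRate

lemma add_mem_Ioi_of_mem_quadrant {z : ℝ × ℝ} (hz : z ∈ quadrant) : z.1 + z.2 ∈ Ioi (0 : ℝ) :=
  mem_Ioi.2 (add_pos (mem_Ioi.1 hz.1) (mem_Ioi.1 hz.2))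

lemma contDiffOn_comp_add {n : WithTop ℕ∞} {φ : ℝ → ℝ} (h : ContDiffOn ℝ n φ (Ioi 0)) :
    ContDiffOn ℝ n (fun z : ℝ × ℝ => φ (z.1 + z.2)) quadrant :=
  h.comp (by fun_prop) fun _ hz => add_mem_Ioi_of_mem_quadrant hz

lemma contDiffOn_comp_snd {n : WithTop ℕ∞} {φ : ℝ → ℝ} (h : ContDiffOn ℝ n φ (Ioi 0)) :
    ContDiffOn ℝ n (fun z : ℝ × ℝ => φ z.2) quadrant :=
  h.comp (by fun_prop) fun _ hz => hz.2

lemma contDiffOn_comp_swap {n : WithTop ℕ∞} {F : ℝ × ℝ → ℝ} (h : ContDiffOn ℝ n F quadrant) :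
    ContDiffOn ℝ n (fun z : ℝ × ℝ => F (z.2, z.1)) quadrant :=
  h.comp (by fun_prop) fun _ hz => ⟨hz.2, hz.1⟩

/-! ### Smoothness of the kernel on the open quadrant. -/

/-- The integrand of the integral equation of the kernel. -/
noncomputable def edgeIntegrand (m : ℝ → ℝ) (z : ℝ × ℝ) : ℝ :=
  m (z.1 + z.2) * edgeKernel m z.2 z.1

/-- The derivative of `edgeIntegrand` with respect to the second variable. -/
noncomputable def edgeIntegrandDeriv (m : ℝ → ℝ) (z : ℝ × ℝ) : ℝ :=
  deriv m (z.1 + z.2) * edgeKernel m z.2 z.1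
    + m (z.1 + z.2) * (m (z.1 + z.2) * edgeKernel m z.1 z.2)

section Kernel

variable {m : ℝ → ℝ} (hm : IsRate m)
include hm

/-- By monotonicity `p(b, s) ≤ p(B, s)`, which is integrable in `s` although it may be unbounded as
`s → 0`. -/
lemma locallyDominated_edgeKernel_swap : LocallyDominated fun z => edgeKernel m z.2 z.1 := by
  intro A β B hA hβ hB
  refine ⟨fun s => edgeKernel m B s, integrableOn_edgeKernel hm hA.le (hβ.trans hB).le,
    fun s hs b hb => ?_⟩
  rw [abs_of_nonneg (edgeKernel_nonneg _ _ _)]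
  exact edgeKernel_mono hm (hβ.le.trans hb.1) hb.2 hs.1

lemma locallyDominated_edgeIntegrand : LocallyDominated (edgeIntegrand m) :=
  (locallyDominated_edgeKernel_swap hm).mul_left hm.continuousOn

lemma measurable_edgeIntegrand_section (b : ℝ) : Measurable fun s => edgeIntegrand m (s, b) := by
  have h1 := hm.measurable
  have h2 : Measurable fun s => edgeKernel m b s :=
    (measurable_edgeKernel hm).comp (by fun_prop : Measurable fun s : ℝ => (b, s))
  exact (h1.comp (measurable_id.add_const b)).mul h2

lemma edgeKernel_eq_partialIntegral {z : ℝ × ℝ} (hz : z ∈ quadrant) :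
    edgeKernel m z.1 z.2 = m z.2 + partialIntegral (edgeIntegrand m) z :=
  edgeKernel_eq hm (le_of_lt hz.1) hz.2

/-- Start of the bootstrap: for fixed `b` the kernel is a constant plus a primitive of an integrable
function, so continuity in `a` needs no regularity of the integrand. -/
lemma continuousOn_edgeKernel_left {b : ℝ} (hb : 0 < b) :
    ContinuousOn (fun a => edgeKernel m a b) (Ioi 0) := by
  intro a ha
  have ha' : 0 < a := ha
  have hint : IntegrableOn (fun s => edgeIntegrand m (s, b)) (Ioc 0 (a + 1)) :=
    (locallyDominated_edgeIntegrand hm).integrableOn (by linarith) hb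
      (measurable_edgeIntegrand_section hm b).aestronglyMeasurable
  have h1 : ContinuousAt (fun x => partialIntegral (edgeIntegrand m) (x, b)) a := by
    have := intervalIntegral.continuousOn_primitive_interval (a := 0) (b := a + 1)
      (f := fun s => edgeIntegrand m (s, b)) (μ := volume)
      (by rw [uIcc_of_le (by linarith)]; rwa [integrableOn_Icc_iff_integrableOn_Ioc])
    refine this.continuousAt ?_
    rw [uIcc_of_le (by linarith)]
    exact Icc_mem_nhds ha (by linarith)
  refine ContinuousAt.continuousWithinAt ((continuousAt_const.add h1).congr
    (f := fun x => m b + partialIntegral (edgeIntegrand m) (x, b)) ?_)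
  filter_upwards [Ioi_mem_nhds ha'] with x hx
  exact (edgeKernel_eq_partialIntegral hm (z := (x, b)) ⟨hx, hb⟩).symm

/-- The integrand contains `p(b, s)`, with swapped arguments, so continuity of `p` in its first
variable is exactly the continuity in `b` that `continuousOn_partialIntegral` requires. -/
lemma continuousOn_edgeKernel :
    ContinuousOn (fun z : ℝ × ℝ => edgeKernel m z.1 z.2) quadrant := by
  refine ContinuousOn.congr (f := fun z => m z.2 + partialIntegral (edgeIntegrand m) z) ?_
    fun z hz => edgeKernel_eq_partialIntegral hm hz
  refine (hm.continuousOn.comp continuousOn_snd fun z hz => hz.2).add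
    (continuousOn_partialIntegral
      (fun b _ => (measurable_edgeIntegrand_section hm b).aestronglyMeasurable) (fun s hs => ?_)
      (locallyDominated_edgeIntegrand hm))
  exact (hm.continuousOn.comp (f := fun b => s + b) (by fun_prop)
    fun b hb => add_pos hs hb).mul (continuousOn_edgeKernel_left hm hs)

lemma continuousOn_edgeIntegrand : ContinuousOn (edgeIntegrand m) quadrant :=
  (hm.continuousOn.comp (by fun_prop) fun _ hz => add_mem_Ioi_of_mem_quadrant hz).mul
    ((continuousOn_edgeKernel hm).comp (f := fun z : ℝ × ℝ => (z.2, z.1)) (by fun_prop)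
      fun _ hz => ⟨hz.2, hz.1⟩)

lemma hasDerivAt_edgeKernel_fst {z : ℝ × ℝ} (hz : z ∈ quadrant) :
    HasDerivAt (fun a => edgeKernel m a z.2) (edgeIntegrand m z) z.1 := by
  refine ((hasDerivAt_partialIntegral_fst (continuousOn_edgeIntegrand hm)
    (locallyDominated_edgeIntegrand hm) hz).const_add (m z.2)).congr_of_eventuallyEq ?_
  filter_upwards [Ioi_mem_nhds hz.1] with x hx
  exact edgeKernel_eq_partialIntegral hm (z := (x, z.2)) ⟨hx, hz.2⟩

/-- Here the second argument stays in a compact subset of `(0, ∞)`, so the dominating function is a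
constant, the maximum of `p(A, ·)` on `[β, B]`. -/
lemma locallyDominated_edgeKernel : LocallyDominated fun z => edgeKernel m z.1 z.2 := by
  intro A β B hA hβ hB
  have hc : ContinuousOn (fun b => edgeKernel m A b) (Icc β B) :=
    (continuousOn_edgeKernel hm).comp (f := fun b => (A, b)) (by fun_prop)
      fun b hb => ⟨hA, hβ.trans_le hb.1⟩
  obtain ⟨C, hC⟩ := (isCompact_Icc.image_of_continuousOn hc).bddAbove
  refine ⟨fun _ => C, by simp [integrableOn_const_iff], fun s hs b hb => ?_⟩
  rw [abs_of_nonneg (edgeKernel_nonneg _ _ _)]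
  exact (edgeKernel_mono hm hs.1.le hs.2 (hβ.trans_le hb.1)).trans (hC (mem_image_of_mem _ hb))

lemma locallyDominated_edgeIntegrandDeriv : LocallyDominated (edgeIntegrandDeriv m) :=
  ((locallyDominated_edgeKernel_swap hm).mul_left hm.continuousOn_deriv).add
    (((locallyDominated_edgeKernel hm).mul_left hm.continuousOn).mul_left hm.continuousOn)

lemma continuousOn_edgeIntegrandDeriv : ContinuousOn (edgeIntegrandDeriv m) quadrant := by
  have h1 : ContinuousOn (fun z : ℝ × ℝ => m (z.1 + z.2)) quadrant :=
    hm.continuousOn.comp (by fun_prop) fun _ hz => add_mem_Ioi_of_mem_quadrant hz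
  have h2 : ContinuousOn (fun z : ℝ × ℝ => deriv m (z.1 + z.2)) quadrant :=
    hm.continuousOn_deriv.comp (by fun_prop) fun _ hz => add_mem_Ioi_of_mem_quadrant hz
  have h3 : ContinuousOn (fun z : ℝ × ℝ => edgeKernel m z.2 z.1) quadrant :=
    (continuousOn_edgeKernel hm).comp (f := fun z : ℝ × ℝ => (z.2, z.1)) (by fun_prop)
      fun _ hz => ⟨hz.2, hz.1⟩
  exact (h2.mul h3).add (h1.mul (h1.mul (continuousOn_edgeKernel hm)))

/-- There is no circularity: because of the swap of arguments, differentiating the integrand in `b`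
uses only the derivative of the kernel in its first argument, which is already known. -/
lemma hasDerivAt_edgeIntegrand_snd {z : ℝ × ℝ} (hz : z ∈ quadrant) :
    HasDerivAt (fun b => edgeIntegrand m (z.1, b)) (edgeIntegrandDeriv m z) z.2 := by
  have h1 : HasDerivAt (fun b => m (z.1 + b)) (deriv m (z.1 + z.2)) z.2 :=
    HasDerivAt.comp_const_add z.1 z.2 (hm.hasDerivAt (add_mem_Ioi_of_mem_quadrant hz))
  have h2 := hasDerivAt_edgeKernel_fst hm (z := (z.2, z.1)) ⟨hz.2, hz.1⟩
  convert! h1.mul h2 using 1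
  simp [edgeIntegrandDeriv, edgeIntegrand, add_comm]

lemma hasDerivAt_edgeKernel_snd {z : ℝ × ℝ} (hz : z ∈ quadrant) :
    HasDerivAt (fun b => edgeKernel m z.1 b)
      (deriv m z.2 + partialIntegral (edgeIntegrandDeriv m) z) z.2 := by
  refine ((hm.hasDerivAt hz.2).add (hasDerivAt_partialIntegral_snd (continuousOn_edgeIntegrand hm)
    (continuousOn_edgeIntegrandDeriv hm) (fun z hz => hasDerivAt_edgeIntegrand_snd hm hz)
    (locallyDominated_edgeIntegrand hm) (locallyDominated_edgeIntegrandDeriv hm)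
    hz)).congr_of_eventuallyEq ?_
  filter_upwards [Ioi_mem_nhds hz.2] with x hx
  exact edgeKernel_eq_partialIntegral hm (z := (z.1, x)) ⟨hz.1, hx⟩

lemma continuousOn_partialIntegral_edgeIntegrandDeriv :
    ContinuousOn (partialIntegral (edgeIntegrandDeriv m)) quadrant :=
  continuousOn_partialIntegral
    (fun _ hb => (continuousOn_edgeIntegrandDeriv hm).aestronglyMeasurable_section hb)
    (fun s hs => (continuousOn_edgeIntegrandDeriv hm).comp (f := fun b => (s, b)) (by fun_prop)
      fun _ hb => ⟨hs, hb⟩)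
    (locallyDominated_edgeIntegrandDeriv hm)

lemma contDiffOn_edgeKernel_one :
    ContDiffOn ℝ 1 (fun z : ℝ × ℝ => edgeKernel m z.1 z.2) quadrant := by
  refine ContDiffOn.congr (f := fun z => m z.2 + partialIntegral (edgeIntegrand m) z) ?_
    fun z hz => edgeKernel_eq_partialIntegral hm hz
  refine (contDiffOn_comp_snd hm.contDiffOn).add ?_
  have := contDiffOn_partialIntegral 0 (contDiffOn_zero.2 (continuousOn_edgeIntegrand hm))
    (continuousOn_edgeIntegrandDeriv hm) (fun z hz => hasDerivAt_edgeIntegrand_snd hm hz)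
    (locallyDominated_edgeIntegrand hm) (locallyDominated_edgeIntegrandDeriv hm)
    (contDiffOn_zero.2 (continuousOn_partialIntegral_edgeIntegrandDeriv hm))
  simpa using this

/-- The bootstrap is run once more, on the formula for `∂_b p`. It suffices that `partialIntegral
(edgeIntegrandDeriv m)` is `C¹`. -/
lemma contDiffOn_edgeKernel_two (hm2 : ContDiffOn ℝ 2 m (Ioi 0)) :
    ContDiffOn ℝ 2 (fun z : ℝ × ℝ => edgeKernel m z.1 z.2) quadrant := by
  have hd1 : ContDiffOn ℝ 1 (deriv m) (Ioi 0) := hm2.deriv_of_isOpen isOpen_Ioi (by norm_num)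
  have hd2 : ContinuousOn (deriv (deriv m)) (Ioi 0) :=
    hd1.continuousOn_deriv_of_isOpen isOpen_Ioi le_rfl
  have hdd : ∀ x, 0 < x → HasDerivAt (deriv m) (deriv (deriv m) x) x := fun x hx =>
    ((hd1.contDiffAt (Ioi_mem_nhds hx)).differentiableAt one_ne_zero).hasDerivAt
  -- This is `∂_b p`, by `hasDerivAt_edgeKernel_snd`.
  set p2 : ℝ × ℝ → ℝ := fun z => deriv m z.2 + partialIntegral (edgeIntegrandDeriv m) z with hp2
  have hp2c : ContinuousOn p2 quadrant :=
    (hm.continuousOn_deriv.comp continuousOn_snd fun z hz => hz.2).add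
      (continuousOn_partialIntegral_edgeIntegrandDeriv hm)
  have hp2d : LocallyDominated p2 := by
    intro A β B hA hβ hB
    obtain ⟨g, hg, hgb⟩ := locallyDominated_edgeIntegrandDeriv hm A β B hA hβ hB
    obtain ⟨C, hC⟩ := (isCompact_Icc.image_of_continuousOn (hm.continuousOn_deriv.mono
      (fun x hx => lt_of_lt_of_le hβ hx.1 : Icc β B ⊆ Ioi 0)).abs).bddAbove
    refine ⟨fun _ => C + ∫ s in Ioc 0 A, g s, by simp [integrableOn_const_iff], fun s hs b hb => ?_⟩
    refine (abs_add_le _ _).trans (add_le_add (hC (mem_image_of_mem _ hb)) ?_)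
    simp only [partialIntegral]
    rw [intervalIntegral.integral_of_le hs.1.le]
    refine (norm_integral_le_integral_norm (μ := volume.restrict (Ioc 0 s))
      (f := fun r => edgeIntegrandDeriv m (r, b))).trans ?_
    have hI : IntegrableOn (fun r => ‖edgeIntegrandDeriv m (r, b)‖) (Ioc 0 A) :=
      ((locallyDominated_edgeIntegrandDeriv hm).integrableOn hA (hβ.trans_le hb.1)
        ((continuousOn_edgeIntegrandDeriv hm).aestronglyMeasurable_section
          (hβ.trans_le hb.1))).norm
    calc ∫ r in Ioc 0 s, ‖edgeIntegrandDeriv m (r, b)‖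
        ≤ ∫ r in Ioc 0 A, ‖edgeIntegrandDeriv m (r, b)‖ :=
          setIntegral_mono_set hI (ae_of_all _ fun _ => norm_nonneg _)
            (Ioc_subset_Ioc_right hs.2).eventuallyLE
      _ ≤ _ := setIntegral_mono_on hI hg measurableSet_Ioc fun r hr => hgb r hr b hb
  -- The derivative of `edgeIntegrandDeriv` in `b`, the only place where the second derivative of
  -- `m` occurs.
  set k2 : ℝ × ℝ → ℝ := fun z =>
    deriv (deriv m) (z.1 + z.2) * edgeKernel m z.2 z.1
      + deriv m (z.1 + z.2) * (m (z.1 + z.2) * edgeKernel m z.1 z.2)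
      + (deriv m (z.1 + z.2) * (m (z.1 + z.2) * edgeKernel m z.1 z.2)
      + m (z.1 + z.2) * (deriv m (z.1 + z.2) * edgeKernel m z.1 z.2 + m (z.1 + z.2) * p2 z))
    with hk2
  have hadd : ∀ {φ : ℝ → ℝ}, ContinuousOn φ (Ioi 0) →
      ContinuousOn (fun z : ℝ × ℝ => φ (z.1 + z.2)) quadrant := fun h =>
    h.comp (by fun_prop) fun _ hz => add_mem_Ioi_of_mem_quadrant hz
  have hsw : ContinuousOn (fun z : ℝ × ℝ => edgeKernel m z.2 z.1) quadrant :=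
    (continuousOn_edgeKernel hm).comp (f := fun z : ℝ × ℝ => (z.2, z.1)) (by fun_prop)
      fun _ hz => ⟨hz.2, hz.1⟩
  have hp := continuousOn_edgeKernel hm
  have hm0 := hm.continuousOn
  have hm1 := hm.continuousOn_deriv
  have hk2c : ContinuousOn k2 quadrant :=
    (((hadd hd2).mul hsw).add ((hadd hm1).mul ((hadd hm0).mul hp))).add
      (((hadd hm1).mul ((hadd hm0).mul hp)).add
        ((hadd hm0).mul (((hadd hm1).mul hp).add ((hadd hm0).mul hp2c))))
  have hdp := locallyDominated_edgeKernel hm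
  have hk2d : LocallyDominated k2 :=
    (((locallyDominated_edgeKernel_swap hm).mul_left hd2).add
      ((hdp.mul_left hm0).mul_left hm1)).add
      (((hdp.mul_left hm0).mul_left hm1).add
        (((hdp.mul_left hm1).add (hp2d.mul_left hm0)).mul_left hm0))
  have hderiv : ∀ z ∈ quadrant,
      HasDerivAt (fun b => edgeIntegrandDeriv m (z.1, b)) (k2 z) z.2 := by
    intro z hz
    have hz' := add_mem_Ioi_of_mem_quadrant hz
    have e0 : HasDerivAt (fun b => m (z.1 + b)) (deriv m (z.1 + z.2)) z.2 :=
      HasDerivAt.comp_const_add z.1 z.2 (hm.hasDerivAt hz')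
    have e1 : HasDerivAt (fun b => deriv m (z.1 + b)) (deriv (deriv m) (z.1 + z.2)) z.2 :=
      HasDerivAt.comp_const_add z.1 z.2 (hdd _ hz')
    have e2 := hasDerivAt_edgeKernel_fst hm (z := (z.2, z.1)) ⟨hz.2, hz.1⟩
    have e3 := hasDerivAt_edgeKernel_snd hm hz
    convert! (e1.mul e2).add (e0.mul (e0.mul e3)) using 1
    simp only [hk2, hp2, edgeIntegrand, add_comm z.2 z.1, Pi.mul_apply]
  have hC1 : ContDiffOn ℝ 1 (partialIntegral (edgeIntegrandDeriv m)) quadrant := by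
    have := contDiffOn_partialIntegral 0 (contDiffOn_zero.2 (continuousOn_edgeIntegrandDeriv hm))
      hk2c hderiv (locallyDominated_edgeIntegrandDeriv hm) hk2d
      (contDiffOn_zero.2 (continuousOn_partialIntegral
        (fun _ hb => hk2c.aestronglyMeasurable_section hb)
        (fun s hs => hk2c.comp (f := fun b => (s, b)) (by fun_prop) fun _ hb => ⟨hs, hb⟩) hk2d))
    simpa using this
  refine ContDiffOn.congr (f := fun z => m z.2 + partialIntegral (edgeIntegrand m) z) ?_
    fun z hz => edgeKernel_eq_partialIntegral hm hz
  refine (contDiffOn_comp_snd hm2).add ?_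
  have := contDiffOn_partialIntegral 1 (k := edgeIntegrand m)
    ((contDiffOn_comp_add hm.contDiffOn).mul (contDiffOn_comp_swap (contDiffOn_edgeKernel_one hm)))
    (continuousOn_edgeIntegrandDeriv hm) (fun z hz => hasDerivAt_edgeIntegrand_snd hm hz)
    (locallyDominated_edgeIntegrand hm) (locallyDominated_edgeIntegrandDeriv hm) hC1
  norm_num at this
  exact this

end Kernel

/-! ### From the first-order system to the second-order equation. -/

lemma isOpen_edgeCone (c : ℝ) : IsOpen (edgeCone c) :=
  isOpen_lt (by fun_prop) (by fun_prop)

lemma pos_of_mem_edgeCone {c : ℝ} (hc : 0 < c) {z : ℝ × ℝ} (hz : z ∈ edgeCone c) : 0 < z.2 :=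
  pos_of_mul_pos_right (lt_of_le_of_lt (abs_nonneg _) hz) hc.le

section SecondDerivatives

variable {F : ℝ × ℝ → ℝ} {S : Set (ℝ × ℝ)} {z : ℝ × ℝ}

lemma hasDerivAt_snd_of_hasFDerivAt {F' : ℝ × ℝ →L[ℝ] ℝ} (h : HasFDerivAt F F' z) :
    HasDerivAt (fun s => F (z.1, s)) (F' (0, 1)) z.2 := by
  have h2 : HasDerivAt (fun s : ℝ => (z.1, s)) ((0 : ℝ), (1 : ℝ)) z.2 :=
    (hasDerivAt_const z.2 z.1).prodMk (hasDerivAt_id z.2)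
  exact HasFDerivAt.comp_hasDerivAt (x := z.2) (l := F) (f := fun s : ℝ => (z.1, s)) h h2

lemma hasDerivAt_fst_of_hasFDerivAt {F' : ℝ × ℝ →L[ℝ] ℝ} (h : HasFDerivAt F F' z) :
    HasDerivAt (fun x => F (x, z.2)) (F' (1, 0)) z.1 := by
  have h2 : HasDerivAt (fun x : ℝ => (x, z.2)) ((1 : ℝ), (0 : ℝ)) z.1 :=
    (hasDerivAt_id z.1).prodMk (hasDerivAt_const z.1 z.2)
  exact HasFDerivAt.comp_hasDerivAt (x := z.1) (l := F) (f := fun x : ℝ => (x, z.2)) h h2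

lemma differentiableAt_of_contDiffOn (hS : IsOpen S) (hF : ContDiffOn ℝ 1 F S) (hz : z ∈ S) :
    DifferentiableAt ℝ F z :=
  (hF.contDiffAt (hS.mem_nhds hz)).differentiableAt one_ne_zero

lemma differentiableAt_fderiv_of_contDiffOn (hS : IsOpen S) (hF : ContDiffOn ℝ 2 F S)
    (hz : z ∈ S) : DifferentiableAt ℝ (fderiv ℝ F) z :=
  ((hF.fderiv_of_isOpen hS (by norm_num : (1 : WithTop ℕ∞) + 1 ≤ 2)).contDiffAt
    (hS.mem_nhds hz)).differentiableAt one_ne_zero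

lemma iteratedDeriv_two_snd (hS : IsOpen S) (hF : ContDiffOn ℝ 2 F S) (hz : z ∈ S) :
    iteratedDeriv 2 (fun s => F (z.1, s)) z.2 = fderiv ℝ (fderiv ℝ F) z (0, 1) (0, 1) := by
  rw [iteratedDeriv_succ, iteratedDeriv_one]
  have h1 : deriv (fun s => F (z.1, s)) =ᶠ[𝓝 z.2] fun s => fderiv ℝ F (z.1, s) (0, 1) := by
    have : ∀ᶠ s in 𝓝 z.2, (z.1, s) ∈ S :=
      (show ContinuousAt (fun s => (z.1, s)) z.2 by fun_prop).preimage_mem_nhds (hS.mem_nhds hz)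
    filter_upwards [this] with s hs
    exact (hasDerivAt_snd_of_hasFDerivAt (z := (z.1, s)) (differentiableAt_of_contDiffOn hS
      (hF.of_le one_le_two) hs).hasFDerivAt).deriv
  rw [h1.deriv_eq]
  have h2 := ((differentiableAt_fderiv_of_contDiffOn hS hF hz).hasFDerivAt).clm_apply
    (hasFDerivAt_const ((0 : ℝ), (1 : ℝ)) z)
  have h3 := hasDerivAt_snd_of_hasFDerivAt h2
  rw [h3.deriv]; simp

lemma iteratedDeriv_two_fst (hS : IsOpen S) (hF : ContDiffOn ℝ 2 F S) (hz : z ∈ S) :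
    iteratedDeriv 2 (fun x => F (x, z.2)) z.1 = fderiv ℝ (fderiv ℝ F) z (1, 0) (1, 0) := by
  rw [iteratedDeriv_succ, iteratedDeriv_one]
  have h1 : deriv (fun x => F (x, z.2)) =ᶠ[𝓝 z.1] fun x => fderiv ℝ F (x, z.2) (1, 0) := by
    have : ∀ᶠ x in 𝓝 z.1, (x, z.2) ∈ S :=
      (show ContinuousAt (fun x => (x, z.2)) z.1 by fun_prop).preimage_mem_nhds (hS.mem_nhds hz)
    filter_upwards [this] with x hx
    exact (hasDerivAt_fst_of_hasFDerivAt (z := (x, z.2)) (differentiableAt_of_contDiffOn hS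
      (hF.of_le one_le_two) hx).hasFDerivAt).deriv
  rw [h1.deriv_eq]
  have h2 := ((differentiableAt_fderiv_of_contDiffOn hS hF hz).hasFDerivAt).clm_apply
    (hasFDerivAt_const ((1 : ℝ), (0 : ℝ)) z)
  have h3 := hasDerivAt_fst_of_hasFDerivAt h2
  rw [h3.deriv]; simp

lemma contDiff_of_support_subset (hS : IsOpen S) {K : Set (ℝ × ℝ)} (hK : IsCompact K)
    (hKS : K ⊆ S) (hF : ContDiffOn ℝ 1 F S) (h0 : ∀ z ∉ K, F z = 0) : ContDiff ℝ 1 F := by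
  rw [contDiff_iff_contDiffAt]
  intro z
  by_cases hz : z ∈ K
  · exact hF.contDiffAt (hS.mem_nhds (hKS hz))
  · refine (contDiffAt_const (c := (0 : ℝ))).congr_of_eventuallyEq ?_
    filter_upwards [hK.isClosed.isOpen_compl.mem_nhds hz] with y hy using h0 y hy

lemma integral_fderiv_eq_zero (hF : ContDiff ℝ 1 F) (hs : HasCompactSupport F) (v : ℝ × ℝ) :
    ∫ z, fderiv ℝ F z v = 0 := by
  have h := integral_mul_fderiv_eq_neg_fderiv_mul_of_integrable (μ := (volume : Measure (ℝ × ℝ)))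
    (𝕜 := ℝ) (f := fun _ : ℝ × ℝ => (1 : ℝ)) (g := F) (v := v) (by simp) ?_ ?_
    (fun _ _ => differentiableAt_const _) (fun z _ => hF.differentiable one_ne_zero z)
  · simpa using h
  · simp only [one_mul]
    exact ((hF.continuous_fderiv one_ne_zero).clm_apply continuous_const).integrable_of_hasCompactSupport
      (hs.fderiv_apply (𝕜 := ℝ) v)
  · simp only [one_mul]
    exact hF.continuous.integrable_of_hasCompactSupport hs

end SecondDerivatives

/-- The first-order system satisfied by the density `f` and by the flow `w`. -/
structure IsEdgeSystem (c : ℝ) (m : ℝ → ℝ) (f w : ℝ × ℝ → ℝ) : Prop where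
  contDiffOn_density : ContDiffOn ℝ 1 f (edgeCone c)
  contDiffOn_flow : ContDiffOn ℝ 1 w (edgeCone c)
  density_eq : ∀ z ∈ edgeCone c,
    fderiv ℝ f z (0, 1) = -(c * fderiv ℝ w z (1, 0)) - 2 * m z.2 * f z
  flow_eq : ∀ z ∈ edgeCone c,
    fderiv ℝ w z (0, 1) = -(c * fderiv ℝ f z (1, 0)) - 4 * m z.2 * w z

namespace IsEdgeSystem

variable {c : ℝ} {m lam : ℝ → ℝ} {f w : ℝ × ℝ → ℝ} (h : IsEdgeSystem c m f w) (hc : 0 < c)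
  (hm : ContDiffOn ℝ 1 m (Ioi 0)) (hlam : ∀ t, 0 < t → lam t = 3 * m t)
include h hc hm hlam

/-- The density equation is differentiated in `t` and the flow equation in `η`; symmetry of the
mixed derivatives of `w` removes the second derivatives of `w`. The outcome is `f_tt + 6 m f_t + (8
m² + 2 m') f = c² f_ηη`, the claim for `lam = 3 m`. -/
lemma classical (hf2 : ContDiffOn ℝ 2 f (edgeCone c)) (hw2 : ContDiffOn ℝ 2 w (edgeCone c)) :
    IsClassicalEdgeSolution c lam fun η t => f (η, t) := by
  intro η t hz
  have hS := isOpen_edgeCone c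
  have ht : 0 < t := pos_of_mem_edgeCone hc hz
  have hmd : HasDerivAt m (deriv m t) t :=
    ((hm.contDiffAt (Ioi_mem_nhds ht)).differentiableAt one_ne_zero).hasDerivAt
  have hlam' : deriv lam t = 3 * deriv m t := by
    have : lam =ᶠ[𝓝 t] fun s => 3 * m s := by
      filter_upwards [Ioi_mem_nhds ht] with s hs using hlam s hs
    rw [this.deriv_eq, (hmd.const_mul 3).deriv]
  have hm2 : HasFDerivAt (fun z : ℝ × ℝ => m z.2)
      (deriv m t • ContinuousLinearMap.snd ℝ ℝ ℝ) (η, t) :=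
    HasDerivAt.comp_hasFDerivAt (x := (η, t)) (f := Prod.snd) (h₂ := m) hmd hasFDerivAt_snd
  have hfd := (differentiableAt_of_contDiffOn hS h.contDiffOn_density hz).hasFDerivAt
  have hwd := (differentiableAt_of_contDiffOn hS h.contDiffOn_flow hz).hasFDerivAt
  have hfdd := (differentiableAt_fderiv_of_contDiffOn hS hf2 hz).hasFDerivAt
  have hwdd := (differentiableAt_fderiv_of_contDiffOn hS hw2 hz).hasFDerivAt
  have happ : ∀ {G : ℝ × ℝ → ℝ × ℝ →L[ℝ] ℝ} {G' v}, HasFDerivAt G G' (η, t) →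
      HasFDerivAt (fun z => G z v) (G'.flip v) (η, t) := fun {G G' v} hG => by
    simpa using hG.clm_apply (hasFDerivAt_const v (η, t))
  have e1 : fderiv ℝ (fderiv ℝ f) (η, t) (0, 1) (0, 1)
      = -(c * fderiv ℝ (fderiv ℝ w) (η, t) (0, 1) (1, 0))
        - 2 * (m t * fderiv ℝ f (η, t) (0, 1) + f (η, t) * deriv m t) := by
    have h1 := happ (v := (0, 1)) hfdd
    have h2 := (((happ (v := (1, 0)) hwdd).const_mul c).neg).sub
      ((hm2.mul hfd).const_mul 2)
    have h3 := h1.unique (h2.congr_of_eventuallyEq (by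
      filter_upwards [hS.mem_nhds hz] with z hz
      simp only [h.density_eq z hz, Pi.sub_apply, Pi.neg_apply, Pi.mul_apply]; ring))
    have h4 := congrArg (fun L => L ((0 : ℝ), (1 : ℝ))) h3
    simp at h4
    linear_combination h4
  have e2 : fderiv ℝ (fderiv ℝ w) (η, t) (1, 0) (0, 1)
      = -(c * fderiv ℝ (fderiv ℝ f) (η, t) (1, 0) (1, 0))
        - 4 * (m t * fderiv ℝ w (η, t) (1, 0)) := by
    have h1 := happ (v := (0, 1)) hwdd
    have h2 := (((happ (v := (1, 0)) hfdd).const_mul c).neg).sub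
      ((hm2.mul hwd).const_mul 4)
    have h3 := h1.unique (h2.congr_of_eventuallyEq (by
      filter_upwards [hS.mem_nhds hz] with z hz
      simp only [h.flow_eq z hz, Pi.sub_apply, Pi.neg_apply, Pi.mul_apply]; ring))
    have h4 := congrArg (fun L => L ((1 : ℝ), (0 : ℝ))) h3
    simp at h4
    linear_combination h4
  have hsymm : fderiv ℝ (fderiv ℝ w) (η, t) (0, 1) (1, 0)
      = fderiv ℝ (fderiv ℝ w) (η, t) (1, 0) (0, 1) :=
    (hw2.contDiffAt (hS.mem_nhds hz)).isSymmSndFDerivAt (by simp) _ _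
  have e3 := h.density_eq _ hz
  have e4 : deriv (fun s => f (η, s)) t = fderiv ℝ f (η, t) (0, 1) :=
    (hasDerivAt_snd_of_hasFDerivAt hfd).deriv
  have e5 := iteratedDeriv_two_snd hS hf2 hz
  have e6 := iteratedDeriv_two_fst hS hf2 hz
  simp only at e3 e5 e6
  simp only
  rw [e5, e6, e4, hlam', hlam t ht, e1, hsymm, e2]
  -- The remaining term `4 m c w_η` is replaced by means of the density equation.
  linear_combination (4 * m t) * e3

/-- With `f` and `w` only `C¹`, the integrand is written as the divergence `∂_t A + ∂_η B` of a
compactly supported `C¹` field, whose integral vanishes. -/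
lemma weak : IsWeakEdgeSolution c lam fun η t => f (η, t) := by
  intro φ hφ hφc hφs
  have hS := isOpen_edgeCone c
  have hφ2 : ContDiffOn ℝ 2 φ univ := (hφ.of_le (WithTop.coe_le_coe.2 (le_top : (2 : ℕ∞) ≤ ⊤))).contDiffOn
  have hφd : ContDiff ℝ 1 (fderiv ℝ φ) := hφ.fderiv_right (WithTop.coe_le_coe.2 (le_top : (1 + 1 : ℕ∞) ≤ ⊤))
  have hφv : ∀ v, ContDiff ℝ 1 fun z => fderiv ℝ φ z v := fun v => hφd.clm_apply contDiff_const
  have hφ0 : ∀ z ∉ tsupport φ, φ z = 0 := fun z hz => image_eq_zero_of_notMem_tsupport hz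
  have hφ0' : ∀ z ∉ tsupport φ, fderiv ℝ φ z = 0 := fun z hz =>
    image_eq_zero_of_notMem_tsupport fun h => hz (tsupport_fderiv_subset ℝ h)
  have hmC : ContDiffOn ℝ 1 (fun z : ℝ × ℝ => m z.2) (edgeCone c) :=
    hm.comp contDiffOn_snd fun z hz => pos_of_mem_edgeCone hc hz
  -- In the divergence the terms `± c w φ_tη` cancel, the coefficient of `φ_η` vanishes by the flow
  -- equation, and the density equation turns `(f_t + c w_η) (φ_t - 4 m φ)` into `-2 m f (φ_t - 4 m
  -- φ)`.
  set A : ℝ × ℝ → ℝ := fun z => f z * fderiv ℝ φ z (0, 1) - c * (w z * fderiv ℝ φ z (1, 0))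
    - 4 * (m z.2 * (f z * φ z)) with hA
  set B : ℝ × ℝ → ℝ := fun z => c * (w z * fderiv ℝ φ z (0, 1))
    - c ^ 2 * (f z * fderiv ℝ φ z (1, 0)) - 4 * c * (m z.2 * (w z * φ z)) with hB
  have hf := h.contDiffOn_density
  have hw := h.contDiffOn_flow
  have hφ1 : ContDiff ℝ 1 φ := hφ.of_le (by exact_mod_cast le_top)
  have hA1 : ContDiff ℝ 1 A := by
    refine contDiff_of_support_subset hS hφc hφs ?_ fun z hz => ?_
    · exact ((hf.mul (hφv _).contDiffOn).sub (contDiffOn_const.mul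
        (hw.mul (hφv _).contDiffOn))).sub
        (contDiffOn_const.mul (hmC.mul (hf.mul hφ1.contDiffOn)))
    · simp [hA, hφ0 z hz, hφ0' z hz]
  have hB1 : ContDiff ℝ 1 B := by
    refine contDiff_of_support_subset hS hφc hφs ?_ fun z hz => ?_
    · exact ((contDiffOn_const.mul (hw.mul (hφv _).contDiffOn)).sub (contDiffOn_const.mul
        (hf.mul (hφv _).contDiffOn))).sub
        (contDiffOn_const.mul (hmC.mul (hw.mul hφ1.contDiffOn)))
    · simp [hB, hφ0 z hz, hφ0' z hz]
  have hAc : HasCompactSupport A := HasCompactSupport.intro hφc fun z hz => by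
    simp [hA, hφ0 z hz, hφ0' z hz]
  have hBc : HasCompactSupport B := HasCompactSupport.intro hφc fun z hz => by
    simp [hB, hφ0 z hz, hφ0' z hz]
  have hint : ∀ {G : ℝ × ℝ → ℝ} (v), ContDiff ℝ 1 G → HasCompactSupport G →
      Integrable fun z => fderiv ℝ G z v := fun v hG hGc =>
    ((hG.continuous_fderiv one_ne_zero).clm_apply
      continuous_const).integrable_of_hasCompactSupport (hGc.fderiv_apply (𝕜 := ℝ) v)
  have hsum : ∫ z, (fderiv ℝ A z (0, 1) + fderiv ℝ B z (1, 0)) = 0 := by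
    rw [integral_add (hint _ hA1 hAc) (hint _ hB1 hBc), integral_fderiv_eq_zero hA1 hAc,
      integral_fderiv_eq_zero hB1 hBc, add_zero]
  rw [← hsum]
  refine integral_congr_ae (ae_of_all _ fun z => ?_)
  simp only
  rw [iteratedDeriv_two_snd isOpen_univ hφ2 (mem_univ z),
    iteratedDeriv_two_fst isOpen_univ hφ2 (mem_univ z)]
  by_cases hz : z ∈ tsupport φ
  · have hzC := hφs hz
    have ht : 0 < z.2 := pos_of_mem_edgeCone hc hzC
    have hmd : HasDerivAt m (deriv m z.2) z.2 :=
      ((hm.contDiffAt (Ioi_mem_nhds ht)).differentiableAt one_ne_zero).hasDerivAt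
    have hev : lam =ᶠ[𝓝 z.2] fun s => 3 * m s := by
      filter_upwards [Ioi_mem_nhds ht] with s hs using hlam s hs
    have hlam' : deriv lam z.2 = 3 * deriv m z.2 := by
      rw [hev.deriv_eq, (hmd.const_mul 3).deriv]
    have hφz := (hφ1.differentiable one_ne_zero z).hasFDerivAt
    have hlamφ : deriv (fun s => 2 * lam s * φ (z.1, s)) z.2
        = 6 * (deriv m z.2 * φ z + m z.2 * fderiv ℝ φ z (0, 1)) := by
      have h1 : (fun s => 2 * lam s * φ (z.1, s)) =ᶠ[𝓝 z.2]
          fun s => 6 * (m s * φ (z.1, s)) := by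
        filter_upwards [hev] with s hs
        rw [hs]; ring
      rw [h1.deriv_eq]
      exact ((hmd.mul (hasDerivAt_snd_of_hasFDerivAt hφz)).const_mul 6).deriv
    have hm2 : HasFDerivAt (fun z : ℝ × ℝ => m z.2)
        (deriv m z.2 • ContinuousLinearMap.snd ℝ ℝ ℝ) z :=
      HasDerivAt.comp_hasFDerivAt (x := z) (f := Prod.snd) (h₂ := m) hmd hasFDerivAt_snd
    have hfd := (differentiableAt_of_contDiffOn hS hf hzC).hasFDerivAt
    have hwd := (differentiableAt_of_contDiffOn hS hw hzC).hasFDerivAt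
    have hφdd : ∀ v, HasFDerivAt (fun z => fderiv ℝ φ z v)
        ((fderiv ℝ (fderiv ℝ φ) z).flip v) z := fun v => by
      simpa using (hφd.differentiable one_ne_zero z).hasFDerivAt.clm_apply
        (hasFDerivAt_const v z)
    have hA' := ((hfd.mul (hφdd (0, 1))).sub ((hwd.mul (hφdd (1, 0))).const_mul c)).sub
      ((hm2.mul (hfd.mul hφz)).const_mul 4)
    have hB' := (((hwd.mul (hφdd (0, 1))).const_mul c).sub
      ((hfd.mul (hφdd (1, 0))).const_mul (c ^ 2))).sub
      ((hm2.mul (hwd.mul hφz)).const_mul (4 * c))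
    have hA'' : fderiv ℝ A z = _ := hA'.fderiv
    have hB'' : fderiv ℝ B z = _ := hB'.fderiv
    have hsymm : fderiv ℝ (fderiv ℝ φ) z (0, 1) (1, 0) = fderiv ℝ (fderiv ℝ φ) z (1, 0) (0, 1) :=
      (hφ2.contDiffAt univ_mem).isSymmSndFDerivAt (by simp) _ _
    have e1 := h.density_eq z hzC
    have e2 := h.flow_eq z hzC
    rw [hA'', hB'', hlam', hlamφ, hlam _ ht]
    simp only [sub_apply, add_apply,
      smul_apply, ContinuousLinearMap.flip_apply, smul_eq_mul,
      ContinuousLinearMap.coe_snd', Pi.mul_apply, hsymm, e1, e2]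
    ring
  · have hz' : z ∈ (tsupport φ)ᶜ := hz
    have hev : φ =ᶠ[𝓝 z] 0 := notMem_tsupport_iff_eventuallyEq.1 hz
    have hev' : fderiv ℝ φ =ᶠ[𝓝 z] 0 := by
      filter_upwards [(isClosed_tsupport φ).isOpen_compl.mem_nhds hz] with y hy using hφ0' y hy
    have hdd : fderiv ℝ (fderiv ℝ φ) z = 0 := by
      rw [hev'.fderiv_eq]; simp
    have h2 : (fun s => 2 * lam s * φ (z.1, s)) =ᶠ[𝓝 z.2] fun _ => 0 := by
      have : ∀ᶠ s in 𝓝 z.2, φ (z.1, s) = 0 :=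
        (show ContinuousAt (fun s => (z.1, s)) z.2 by fun_prop).preimage_mem_nhds hev
      filter_upwards [this] with s hs
      rw [hs, mul_zero]
    have hA0 : fderiv ℝ A z = 0 := by
      have : A =ᶠ[𝓝 z] fun _ => 0 := by
        filter_upwards [hev, hev'] with y h1 h2
        simp [hA, h1, h2]
      rw [this.fderiv_eq]; simp
    have hB0 : fderiv ℝ B z = 0 := by
      have : B =ᶠ[𝓝 z] fun _ => 0 := by
        filter_upwards [hev, hev'] with y h1 h2
        simp [hB, h1, h2]
      rw [this.fderiv_eq]; simp
    rw [h2.deriv_eq, hdd, hA0, hB0, hφ0 z hz]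
    simp

end IsEdgeSystem

/-! ### The two waves and their transport equations. -/

/-- The contribution to the edge density of the particles that currently move towards increasing
`η`. -/
noncomputable def edgeWave (m : ℝ → ℝ) (c : ℝ) (z : ℝ × ℝ) : ℝ :=
  Real.exp (-(3 * ∫ s in (0 : ℝ)..z.2, m s)) *
    edgeKernel m ((z.2 + z.1 / c) / 2) ((z.2 - z.1 / c) / 2)

/-- The edge density. -/
noncomputable def edgeDensity (m : ℝ → ℝ) (c : ℝ) (z : ℝ × ℝ) : ℝ :=
  (8 * c)⁻¹ * (edgeWave m c z + edgeWave m c (-z.1, z.2))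

/-- The flow associated with the edge density. -/
noncomputable def edgeFlow (m : ℝ → ℝ) (c : ℝ) (z : ℝ × ℝ) : ℝ :=
  (8 * c)⁻¹ * (edgeWave m c z - edgeWave m c (-z.1, z.2))

lemma mem_quadrant_of_mem_edgeCone {c : ℝ} (hc : 0 < c) {z : ℝ × ℝ} (hz : z ∈ edgeCone c) :
    ((z.2 + z.1 / c) / 2, (z.2 - z.1 / c) / 2) ∈ quadrant := by
  obtain ⟨h1, h2⟩ := abs_lt.1 (show |z.1| < c * z.2 from hz)
  have h3 : z.1 / c < z.2 := (div_lt_iff₀ hc).2 (by linarith)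
  have h4 : -z.2 < z.1 / c := (lt_div_iff₀ hc).2 (by linarith)
  exact ⟨mem_Ioi.2 (by linarith), mem_Ioi.2 (by linarith)⟩

lemma neg_mem_edgeCone {c : ℝ} {z : ℝ × ℝ} (hz : z ∈ edgeCone c) : (-z.1, z.2) ∈ edgeCone c := by
  simpa [edgeCone] using hz

section Wave

variable {m : ℝ → ℝ} (hm : IsRate m) {c : ℝ} (hc : 0 < c)
include hm

lemma IsRate.contDiffOn_primitive (n : ℕ) (h : ContDiffOn ℝ n m (Ioi 0)) :
    ContDiffOn ℝ (n + 1) (fun t => ∫ s in (0 : ℝ)..t, m s) (Ioi 0) := by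
  rw [contDiffOn_succ_iff_deriv_of_isOpen isOpen_Ioi]
  refine ⟨fun t ht => (hm.hasDerivAt_primitive ht).differentiableAt.differentiableWithinAt,
    fun h => absurd h (by exact_mod_cast WithTop.coe_ne_top), ?_⟩
  exact h.congr fun t ht => (hm.hasDerivAt_primitive ht).deriv

include hc

omit hm in
lemma contDiffOn_edgeWave {n : WithTop ℕ∞}
    (h1 : ContDiffOn ℝ n (fun t => ∫ s in (0 : ℝ)..t, m s) (Ioi 0))
    (h2 : ContDiffOn ℝ n (fun z : ℝ × ℝ => edgeKernel m z.1 z.2) quadrant) :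
    ContDiffOn ℝ n (edgeWave m c) (edgeCone c) := by
  have e1 : ContDiffOn ℝ n (fun z : ℝ × ℝ => ∫ s in (0 : ℝ)..z.2, m s) (edgeCone c) :=
    h1.comp contDiffOn_snd fun z hz => pos_of_mem_edgeCone hc hz
  refine ((contDiffOn_const.mul e1).neg.exp).mul
    (h2.comp (s := edgeCone c) (f := fun z : ℝ × ℝ => ((z.2 + z.1 / c) / 2, (z.2 - z.1 / c) / 2))
    (by fun_prop) fun z hz => mem_quadrant_of_mem_edgeCone hc hz)

lemma contDiffOn_edgeWave_one : ContDiffOn ℝ 1 (edgeWave m c) (edgeCone c) :=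
  contDiffOn_edgeWave hc
    (by simpa using hm.contDiffOn_primitive 0 (contDiffOn_zero.2 hm.continuousOn))
    (contDiffOn_edgeKernel_one hm)

lemma contDiffOn_edgeWave_two (h : ContDiffOn ℝ 2 m (Ioi 0)) :
    ContDiffOn ℝ 2 (edgeWave m c) (edgeCone c) :=
  contDiffOn_edgeWave hc
    ((hm.contDiffOn_primitive 1 (by simpa using hm.contDiffOn)).of_le (by norm_num))
    (contDiffOn_edgeKernel_two hm h)

/-- Along `(c, 1)` the first argument of the kernel grows at unit rate and the second is fixed.
Hence the kernel contributes `∂_a p(a, b) = m(t) p(b, a)`, the reflected wave, and the exponential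
contributes the damping `-3 m`. -/
lemma fderiv_edgeWave {z : ℝ × ℝ} (hz : z ∈ edgeCone c) :
    fderiv ℝ (edgeWave m c) z (0, 1) + c * fderiv ℝ (edgeWave m c) z (1, 0)
      = -3 * m z.2 * edgeWave m c z + m z.2 * edgeWave m c (-z.1, z.2) := by
  have hd := (differentiableAt_of_contDiffOn (isOpen_edgeCone c)
    (contDiffOn_edgeWave_one hm hc) hz).hasFDerivAt
  have ht := pos_of_mem_edgeCone hc hz
  have hq := mem_quadrant_of_mem_edgeCone hc hz
  have h1 : HasDerivAt (fun s : ℝ => edgeWave m c (z + s • (c, 1)))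
      (fderiv ℝ (edgeWave m c) z (c, 1)) 0 := hd.hasLineDerivAt (c, 1)
  have h2 : HasDerivAt (fun s : ℝ => Real.exp (-(3 * ∫ r in (0 : ℝ)..(z.2 + s), m r)) *
      edgeKernel m ((z.2 + z.1 / c) / 2 + s) ((z.2 - z.1 / c) / 2))
      (Real.exp (-(3 * ∫ r in (0 : ℝ)..(z.2 + 0), m r)) * (-(3 * m z.2)) *
        edgeKernel m ((z.2 + z.1 / c) / 2 + 0) ((z.2 - z.1 / c) / 2) +
        Real.exp (-(3 * ∫ r in (0 : ℝ)..(z.2 + 0), m r)) *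
          edgeIntegrand m ((z.2 + z.1 / c) / 2, (z.2 - z.1 / c) / 2)) 0 := by
    have i1 : HasDerivAt (fun s : ℝ => ∫ r in (0 : ℝ)..(z.2 + s), m r) (m z.2) 0 :=
      HasDerivAt.comp_const_add (f := fun t => ∫ r in (0 : ℝ)..t, m r) z.2 0
        (by simpa using hm.hasDerivAt_primitive ht)
    have i2 : HasDerivAt (fun s : ℝ => edgeKernel m ((z.2 + z.1 / c) / 2 + s)
        ((z.2 - z.1 / c) / 2)) (edgeIntegrand m ((z.2 + z.1 / c) / 2, (z.2 - z.1 / c) / 2)) 0 :=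
      HasDerivAt.comp_const_add (f := fun a => edgeKernel m a ((z.2 - z.1 / c) / 2))
        ((z.2 + z.1 / c) / 2) 0 (by simpa using hasDerivAt_edgeKernel_fst hm hq)
    exact ((i1.const_mul 3).fun_neg.exp).mul i2
  have h3 : (fun s : ℝ => edgeWave m c (z + s • (c, 1))) = fun s : ℝ =>
      Real.exp (-(3 * ∫ r in (0 : ℝ)..(z.2 + s), m r)) *
      edgeKernel m ((z.2 + z.1 / c) / 2 + s) ((z.2 - z.1 / c) / 2) := by
    funext s
    simp only [edgeWave, Prod.fst_add, Prod.snd_add, Prod.smul_fst, Prod.smul_snd, smul_eq_mul,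
      mul_one]
    congr 2 <;> field_simp <;> ring
  rw [h3] at h1
  have h4 := h1.unique h2
  have h5 : ((c, 1) : ℝ × ℝ) = (0, 1) + c • (1, 0) := by ext <;> simp
  rw [h5, map_add, map_smul, smul_eq_mul] at h4
  rw [h4]
  simp only [edgeWave, edgeIntegrand, add_zero, neg_div, sub_neg_eq_add, ← sub_eq_add_neg]
  rw [show (z.2 + z.1 / c) / 2 + (z.2 - z.1 / c) / 2 = z.2 by ring]
  ring

/-- Sum and difference diagonalise the zeroth-order coupling of the wave and its reflection, with
coefficients `-3 + 1 = -2` and `-3 - 1 = -4`. -/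
lemma isEdgeSystem_edgeDensity : IsEdgeSystem c m (edgeDensity m c) (edgeFlow m c) := by
  have hK := contDiffOn_edgeWave_one hm hc
  have hK' : ContDiffOn ℝ 1 (fun z : ℝ × ℝ => edgeWave m c (-z.1, z.2)) (edgeCone c) :=
    hK.comp (by fun_prop) fun z hz => neg_mem_edgeCone hz
  have hS := isOpen_edgeCone c
  have hR : ∀ z ∈ edgeCone c, ∀ v : ℝ × ℝ,
      fderiv ℝ (fun z : ℝ × ℝ => edgeWave m c (-z.1, z.2)) z v
        = fderiv ℝ (edgeWave m c) (-z.1, z.2) (-v.1, v.2) := by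
    intro z hz v
    have h1 := (differentiableAt_of_contDiffOn hS hK (neg_mem_edgeCone hz)).hasFDerivAt
    have h2 : HasFDerivAt (fun z : ℝ × ℝ => (-z.1, z.2))
        ((-ContinuousLinearMap.fst ℝ ℝ ℝ).prod (ContinuousLinearMap.snd ℝ ℝ ℝ)) z :=
      (hasFDerivAt_fst.neg).prodMk hasFDerivAt_snd
    have h3 := (HasFDerivAt.comp (g := edgeWave m c) z h1 h2).fderiv
    simp only [Function.comp_def] at h3
    rw [h3]
    simp
  have hf : ∀ z ∈ edgeCone c, fderiv ℝ (edgeDensity m c) z = (8 * c)⁻¹ •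
      (fderiv ℝ (edgeWave m c) z + fderiv ℝ (fun z : ℝ × ℝ => edgeWave m c (-z.1, z.2)) z) :=
    fun z hz => (((differentiableAt_of_contDiffOn hS hK hz).hasFDerivAt.add
      (differentiableAt_of_contDiffOn hS hK' hz).hasFDerivAt).const_mul _).fderiv
  have hw : ∀ z ∈ edgeCone c, fderiv ℝ (edgeFlow m c) z = (8 * c)⁻¹ •
      (fderiv ℝ (edgeWave m c) z - fderiv ℝ (fun z : ℝ × ℝ => edgeWave m c (-z.1, z.2)) z) :=
    fun z hz => (((differentiableAt_of_contDiffOn hS hK hz).hasFDerivAt.sub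
      (differentiableAt_of_contDiffOn hS hK' hz).hasFDerivAt).const_mul _).fderiv
  have key : ∀ z ∈ edgeCone c,
      fderiv ℝ (fun z : ℝ × ℝ => edgeWave m c (-z.1, z.2)) z (0, 1)
        - c * fderiv ℝ (fun z : ℝ × ℝ => edgeWave m c (-z.1, z.2)) z (1, 0)
      = -3 * m z.2 * edgeWave m c (-z.1, z.2) + m z.2 * edgeWave m c z := by
    intro z hz
    have h1 := fderiv_edgeWave hm hc (neg_mem_edgeCone hz)
    simp only [neg_neg, Prod.mk.eta] at h1
    rw [hR z hz, hR z hz, ← h1]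
    have : ((-1, 0) : ℝ × ℝ) = -(1, 0) := by ext <;> simp
    simp only [neg_zero, this, map_neg]
    ring
  refine ⟨contDiffOn_const.mul (hK.add hK'), contDiffOn_const.mul (hK.sub hK'),
    fun z hz => ?_, fun z hz => ?_⟩
  · rw [hf z hz, hw z hz]
    simp only [smul_apply, add_apply, sub_apply, smul_eq_mul, edgeDensity]
    linear_combination (8 * c)⁻¹ * (fderiv_edgeWave hm hc hz + key z hz)
  · rw [hf z hz, hw z hz]
    simp only [smul_apply, add_apply, sub_apply, smul_eq_mul, edgeFlow]
    linear_combination (8 * c)⁻¹ * (fderiv_edgeWave hm hc hz - key z hz)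

lemma contDiffOn_edgeDensity_two (h : ContDiffOn ℝ 2 m (Ioi 0)) :
    ContDiffOn ℝ 2 (edgeDensity m c) (edgeCone c) :=
  contDiffOn_const.mul ((contDiffOn_edgeWave_two hm hc h).add
    ((contDiffOn_edgeWave_two hm hc h).comp (f := fun z : ℝ × ℝ => (-z.1, z.2)) (by fun_prop)
      fun z hz => neg_mem_edgeCone hz))

lemma contDiffOn_edgeFlow_two (h : ContDiffOn ℝ 2 m (Ioi 0)) :
    ContDiffOn ℝ 2 (edgeFlow m c) (edgeCone c) :=
  contDiffOn_const.mul ((contDiffOn_edgeWave_two hm hc h).sub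
    ((contDiffOn_edgeWave_two hm hc h).comp (f := fun z : ℝ × ℝ => (-z.1, z.2)) (by fun_prop)
      fun z hz => neg_mem_edgeCone hz))

omit hm in
lemma edgeDensity_nonneg (m : ℝ → ℝ) (z : ℝ × ℝ) : 0 ≤ edgeDensity m c z := by
  have h : ∀ z, 0 ≤ edgeWave m c z := fun z =>
    mul_nonneg (Real.exp_pos _).le (edgeKernel_nonneg _ _ _)
  exact mul_nonneg (by positivity) (add_nonneg (h _) (h _))

end Wave

/-! ### Characteristic functions: uniqueness, and the solution given by the kernel. -/

/-- The system of differential equations satisfied by the (normalised) characteristic functions. -/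
structure IsCharSolution (m : ℝ → ℝ) (L : ℝ → ℝ → ℂ) : Prop where
  zero : ∀ ξ, L ξ 0 = 1
  continuousOn : ∀ ξ, ContinuousOn (L ξ) (Ici 0)
  hasDerivAt : ∀ ξ t, 0 < t →
    HasDerivAt (L ξ) (m t * Complex.exp (-(2 * ξ * t : ℝ) * Complex.I) * L (-ξ) t) t

/-- An energy estimate for the pair `ξ`, `-ξ`: the phases have modulus one and `2 |x| |y| ≤ |x|² +
|y|²`, so the sum of squares weighted by `exp (-2 ∫ m)` does not increase. As `m` may be singular at
`0`, derivatives are used for `t > 0` and continuity alone at `0`. -/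
lemma IsCharSolution.unique {m : ℝ → ℝ} (hm : IsRate m) {L L' : ℝ → ℝ → ℂ}
    (h : IsCharSolution m L) (h' : IsCharSolution m L') (ξ : ℝ) {t : ℝ} (ht : 0 ≤ t) :
    L ξ t = L' ξ t := by
  set d : ℝ → ℝ → ℂ := fun ξ t => L ξ t - L' ξ t with hd
  have hdd : ∀ ξ t, 0 < t →
      HasDerivAt (d ξ) (m t * Complex.exp (-(2 * ξ * t : ℝ) * Complex.I) * d (-ξ) t) t := by
    intro ξ t ht
    convert! (h.hasDerivAt ξ t ht).sub (h'.hasDerivAt ξ t ht) using 1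
    simp only [hd]; ring
  have hdc : ∀ ξ, ContinuousOn (d ξ) (Ici 0) := fun ξ =>
    (h.continuousOn ξ).sub (h'.continuousOn ξ)
  set g : ℝ → ℝ := fun t => Real.exp (-(2 * ∫ s in (0 : ℝ)..t, m s)) *
    (‖d ξ t‖ ^ 2 + ‖d (-ξ) t‖ ^ 2) with hg
  have hgd : ∀ t, 0 < t → ∃ g', HasDerivAt g g' t ∧ g' ≤ 0 := by
    intro t ht
    have e1 := ((((hm.hasDerivAt_primitive ht).const_mul 2).fun_neg).exp).mul
      ((hdd ξ t ht).norm_sq.add (hdd (-ξ) t ht).norm_sq)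
    refine ⟨_, e1, ?_⟩
    rw [neg_neg]
    have hle : ∀ (x y : ℂ) (θ : ℝ), inner ℝ x (m t * Complex.exp (-θ * Complex.I) * y)
        ≤ m t * (‖x‖ * ‖y‖) := by
      intro x y θ
      refine (real_inner_le_norm _ _).trans (le_of_eq ?_)
      have : ‖Complex.exp (-(θ : ℂ) * Complex.I)‖ = 1 := by
        rw [← Complex.ofReal_neg, Complex.norm_exp_ofReal_mul_I]
      rw [norm_mul, norm_mul, this, Complex.norm_of_nonneg (hm.nonneg t)]
      ring
    have i1 := hle (d ξ t) (d (-ξ) t) (2 * ξ * t)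
    have i2 := hle (d (-ξ) t) (d ξ t) (2 * -ξ * t)
    have hmt := hm.nonneg t
    have hE := Real.exp_pos (-(2 * ∫ s in (0 : ℝ)..t, m s))
    have hsq := mul_nonneg hmt (sq_nonneg (‖d ξ t‖ - ‖d (-ξ) t‖))
    simp only [Pi.add_apply]
    have : ∀ E A B S : ℝ, 0 < E → A + B ≤ m t * S →
      E * -(2 * m t) * S + E * (2 * A + 2 * B) ≤ 0 := by
      intro E A B S hE hAB
      have := mul_le_mul_of_nonneg_left hAB hE.le
      nlinarith
    refine this _ _ _ _ hE ?_
    nlinarith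
  have hgc : ContinuousOn g (Ici 0) :=
    (Continuous.continuousOn (by
      have := hm.continuous_primitive
      fun_prop)).mul (((hdc ξ).norm.pow 2).add ((hdc (-ξ)).norm.pow 2))
  have hanti : AntitoneOn g (Ici 0) := by
    refine antitoneOn_of_deriv_nonpos (convex_Ici 0) hgc ?_ ?_
    · rw [interior_Ici]
      intro t ht
      obtain ⟨g', hg', -⟩ := hgd t ht
      exact hg'.differentiableAt.differentiableWithinAt
    · rw [interior_Ici]
      intro t ht
      obtain ⟨g', hg', h0⟩ := hgd t ht
      rwa [hg'.deriv]
  have h1 := hanti self_mem_Ici ht ht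
  have h0 : g 0 = 0 := by simp [hg, hd, h.zero, h'.zero]
  rw [h0] at h1
  have h2 : ‖d ξ t‖ ^ 2 + ‖d (-ξ) t‖ ^ 2 ≤ 0 :=
    nonpos_of_mul_nonpos_right h1 (Real.exp_pos _)
  have h3 : ‖d ξ t‖ = 0 := by
    have := sq_nonneg ‖d (-ξ) t‖
    have h4 := sq_nonneg ‖d ξ t‖
    exact pow_eq_zero_iff two_ne_zero |>.1 (by linarith)
  exact sub_eq_zero.1 (norm_eq_zero.1 h3)

/-- The normalised characteristic function of the kernel. -/
noncomputable def edgeChar (m : ℝ → ℝ) (ξ t : ℝ) : ℂ :=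
  1 + ∫ b in (0 : ℝ)..t, Complex.exp (-(2 * ξ * b : ℝ) * Complex.I) * (edgeKernel m (t - b) b : ℂ)

section EdgeChar

variable {m : ℝ → ℝ} (hm : IsRate m)
include hm

lemma intervalIntegrable_edge_triangle {g : ℝ → ℂ} (hg : Continuous g) {t : ℝ} (ht : 0 ≤ t) :
    IntervalIntegrable (fun r => (m r : ℂ) * ∫ b in (0 : ℝ)..r,
      g b * (edgeKernel m b (r - b) : ℂ)) volume 0 t := by
  rw [intervalIntegrable_iff_integrableOn_Ioo_of_le ht]
  refine IntegrableOn.congr_fun ((integrable_edge_triangle hm hg ht).integral_prod_right.integrableOn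
    (s := Ioo 0 t)) (fun r hr => ?_) measurableSet_Ioo
  exact integral_edge_triangle_section m g hr

omit hm in
-- The substitution `b ↦ r - b` converts the phase for `-ξ` into the phase for `ξ` and swaps the
-- kernel's arguments, as the Volterra equation requires.
lemma mul_edgeChar_neg (m : ℝ → ℝ) (ξ r : ℝ) :
    (m r : ℂ) * Complex.exp (-(2 * ξ * r : ℝ) * Complex.I) * edgeChar m (-ξ) r
      = Complex.exp (-(2 * ξ * r : ℝ) * Complex.I) * (m r : ℂ) + (m r : ℂ) * ∫ b in (0 : ℝ)..r,
        Complex.exp (-(2 * ξ * b : ℝ) * Complex.I) * (edgeKernel m b (r - b) : ℂ) := by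
  simp only [edgeChar]
  have h1 : ∫ b in (0 : ℝ)..r, Complex.exp (-(2 * -ξ * b : ℝ) * Complex.I) *
      (edgeKernel m (r - b) b : ℂ) = Complex.exp ((2 * ξ * r : ℝ) * Complex.I) *
      ∫ b in (0 : ℝ)..r, Complex.exp (-(2 * ξ * b : ℝ) * Complex.I) *
        (edgeKernel m b (r - b) : ℂ) := by
    have := intervalIntegral.integral_comp_sub_left (a := 0) (b := r) (fun b : ℝ =>
      Complex.exp (-(2 * -ξ * b : ℝ) * Complex.I) * (edgeKernel m (r - b) b : ℂ)) r
    rw [sub_self, sub_zero] at this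
    rw [← this, ← intervalIntegral.integral_const_mul]
    refine intervalIntegral.integral_congr fun b _ => ?_
    simp only [sub_sub_cancel]
    rw [← mul_assoc, ← Complex.exp_add]
    congr 2
    push_cast; ring
  rw [h1, mul_add, ← mul_assoc, mul_assoc (m r : ℂ), mul_one, mul_assoc (m r : ℂ),
    ← Complex.exp_add]
  simp only [neg_mul, neg_add_cancel, Complex.exp_zero, mul_one]
  ring

lemma intervalIntegrable_exp_mul (ξ t : ℝ) : IntervalIntegrable
    (fun b => Complex.exp (-(2 * ξ * b : ℝ) * Complex.I) * (m b : ℂ)) volume 0 t :=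
  IntervalIntegrable.continuousOn_mul
    ⟨(hm.intervalIntegrable 0 t).1.ofReal, (hm.intervalIntegrable 0 t).2.ofReal⟩
    (Continuous.continuousOn (by fun_prop))

lemma edgeChar_eq (ξ : ℝ) {t : ℝ} (ht : 0 ≤ t) :
    edgeChar m ξ t = 1 + ∫ r in (0 : ℝ)..t,
      (m r : ℂ) * Complex.exp (-(2 * ξ * r : ℝ) * Complex.I) * edgeChar m (-ξ) r := by
  have hg : Continuous fun b : ℝ => Complex.exp (-(2 * ξ * b : ℝ) * Complex.I) := by fun_prop
  rw [edgeChar, integral_edgeKernel_antidiag hm hg ht, ← intervalIntegral.integral_add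
    (intervalIntegrable_exp_mul hm ξ t) (intervalIntegrable_edge_triangle hm hg ht)]
  simp_rw [mul_edgeChar_neg]

lemma intervalIntegrable_edgeChar (ξ : ℝ) {t : ℝ} (ht : 0 ≤ t) :
    IntervalIntegrable (fun r => (m r : ℂ) * Complex.exp (-(2 * ξ * r : ℝ) * Complex.I) *
      edgeChar m (-ξ) r) volume 0 t := by
  have hg : Continuous fun b : ℝ => Complex.exp (-(2 * ξ * b : ℝ) * Complex.I) := by fun_prop
  simp_rw [mul_edgeChar_neg]
  exact (intervalIntegrable_exp_mul hm ξ t).add (intervalIntegrable_edge_triangle hm hg ht)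

/-- By `edgeChar_eq` the function is `1` plus a primitive, hence continuous. The integrand is then
continuous for `t > 0`, and the fundamental theorem of calculus applies. -/
lemma isCharSolution_edgeChar : IsCharSolution m (edgeChar m) := by
  have hcont : ∀ ξ, ContinuousOn (edgeChar m ξ) (Ici 0) := by
    intro ξ
    have key : ∀ T, 0 < T → ContinuousOn (edgeChar m ξ) (Icc 0 T) := by
      intro T hT
      have h1 := intervalIntegral.continuousOn_primitive_interval' (a := (0 : ℝ)) (μ := volume)
        (intervalIntegrable_edgeChar hm ξ hT.le) left_mem_uIcc
      rw [uIcc_of_le hT.le] at h1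
      exact (continuousOn_const.add h1).congr fun t ht => edgeChar_eq hm ξ ht.1
    intro t ht
    refine (key (t + 1) (by linarith [mem_Ici.1 ht]) t ⟨ht, by linarith⟩).mono_of_mem_nhdsWithin ?_
    refine mem_nhdsWithin.2 ⟨Iio (t + 1), isOpen_Iio, by simp, fun x hx => ⟨hx.2, hx.1.le⟩⟩
  refine ⟨fun ξ => by simp [edgeChar], hcont, fun ξ t ht => ?_⟩
  have h1 : ContinuousOn (fun r : ℝ => (m r : ℂ) * Complex.exp (-(2 * ξ * r : ℝ) * Complex.I) *
      edgeChar m (-ξ) r) (Ioi 0) :=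
    ((Complex.continuous_ofReal.comp_continuousOn hm.continuousOn).mul
      (Continuous.continuousOn (by fun_prop))).mul ((hcont (-ξ)).mono Ioi_subset_Ici_self)
  have h2 := (intervalIntegral.integral_hasDerivAt_right (intervalIntegrable_edgeChar hm ξ ht.le)
    (h1.stronglyMeasurableAtFilter isOpen_Ioi t ht)
    (h1.continuousAt (Ioi_mem_nhds ht))).const_add 1
  refine h2.congr_of_eventuallyEq ?_
  filter_upwards [Ioi_mem_nhds ht] with r hr using edgeChar_eq hm ξ (le_of_lt hr)

end EdgeChar

/-! ### Measurability of the signed time. -/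

/-- The integral of the sign `(-1) ^ N` over `[0, t]`. -/
noncomputable def signedTime {Ω : Type*} (N : ℝ≥0 → Ω → ℕ) (t : ℝ≥0) (ω : Ω) : ℝ :=
  ∫ s in (0 : ℝ)..t, (-1) ^ N s.toNNReal ω

section Measurability

variable {Ω : Type*} [MeasurableSpace Ω] {N : ℝ≥0 → Ω → ℕ}

/-- Times are approximated from the right by grids of mesh `1 / (n + 1)`. The truncation at `s` uses
`N u` for `u ≤ s` only, so the lemma also applies to the σ-algebra generated by the past. -/
lemma measurable_uncurry_of_rightContinuous {s : ℝ≥0} (hmeas : ∀ u ≤ s, Measurable (N u))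
    (hrc : ∀ ω t, ContinuousWithinAt (fun s => N s ω) (Ici t) t) :
    Measurable fun p : ℝ × Ω => N (min p.1.toNNReal s) p.2 := by
  refine measurable_of_tendsto_metrizable (f := fun (n : ℕ) (p : ℝ × Ω) =>
    N (min ((⌈((n : ℝ≥0) + 1) * p.1.toNNReal⌉₊ : ℝ≥0) / (n + 1)) s) p.2) (fun n => ?_)
    (tendsto_pi_nhds.2 fun p => ?_)
  · have h1 : Measurable fun q : ℕ × Ω => N (min ((q.1 : ℝ≥0) / (n + 1)) s) q.2 :=
      measurable_from_prod_countable_right fun k =>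
        show Measurable (N (min ((k : ℝ≥0) / (n + 1)) s)) from hmeas _ (min_le_right _ _)
    exact h1.comp (f := fun p : ℝ × Ω => (⌈((n : ℝ≥0) + 1) * p.1.toNNReal⌉₊, p.2))
      ((Nat.measurable_ceil.comp (by fun_prop)).prodMk measurable_snd)
  · set u := p.1.toNNReal
    have hlow : ∀ n : ℕ, u ≤ (⌈((n : ℝ≥0) + 1) * u⌉₊ : ℝ≥0) / (n + 1) := fun n => by
      rw [le_div_iff₀ (by positivity), mul_comm]
      exact Nat.le_ceil _
    have hup : ∀ n : ℕ, (⌈((n : ℝ≥0) + 1) * u⌉₊ : ℝ≥0) / (n + 1) ≤ u + 1 / (n + 1) := fun n => by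
      rw [div_le_iff₀ (by positivity), add_mul u, one_div, inv_mul_cancel₀ (by positivity), mul_comm u]
      exact (Nat.ceil_lt_add_one (by positivity)).le
    have hlim : Tendsto (fun n : ℕ => (⌈((n : ℝ≥0) + 1) * u⌉₊ : ℝ≥0) / (n + 1)) atTop (𝓝 u) := by
      refine tendsto_of_tendsto_of_tendsto_of_le_of_le tendsto_const_nhds ?_ hlow hup
      have : Tendsto (fun n : ℕ => (1 : ℝ≥0) / (n + 1)) atTop (𝓝 0) :=
        tendsto_one_div_add_atTop_nhds_zero_nat
      simpa using this.const_add u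
    refine (hrc p.2 (min u s)).tendsto.comp (tendsto_nhdsWithin_iff.2 ⟨hlim.min tendsto_const_nhds,
      Eventually.of_forall fun n => min_le_min_right _ (hlow n)⟩)

omit [MeasurableSpace Ω] in
lemma signedTime_eq_setIntegral (N : ℝ≥0 → Ω → ℕ) (t : ℝ≥0) (ω : Ω) :
    signedTime N t ω = ∫ r in Ioc (0 : ℝ) t, (-1) ^ N (min r.toNNReal t) ω := by
  rw [signedTime, intervalIntegral.integral_of_le t.coe_nonneg]
  refine setIntegral_congr_fun measurableSet_Ioc fun r hr => ?_
  rw [min_eq_left (Real.toNNReal_le_iff_le_coe.2 hr.2)]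

lemma measurable_signedTime {t : ℝ≥0} (hmeas : ∀ u ≤ t, Measurable (N u))
    (hrc : ∀ ω t, ContinuousWithinAt (fun s => N s ω) (Ici t) t) :
    Measurable (signedTime N t) := by
  have h1 : Measurable fun p : ℝ × Ω => (-1 : ℝ) ^ N (min p.1.toNNReal t) p.2 :=
    (measurable_of_countable fun n : ℕ => (-1 : ℝ) ^ n).comp
      (measurable_uncurry_of_rightContinuous hmeas hrc)
  have h2 := (StronglyMeasurable.integral_prod_left'
    (μ := volume.restrict (Ioc (0 : ℝ) t)) h1.stronglyMeasurable).measurable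
  rw [show signedTime N t = _ from funext fun ω => signedTime_eq_setIntegral N t ω]
  exact h2

lemma measurable_neg_one_pow_path (hmeas : ∀ u, Measurable (N u))
    (hrc : ∀ ω t, ContinuousWithinAt (fun s => N s ω) (Ici t) t) (ω : Ω) :
    Measurable fun r : ℝ => (-1 : ℝ) ^ N r.toNNReal ω := by
  refine measurable_of_tendsto_metrizable (f := fun (n : ℕ) (r : ℝ) =>
    (-1 : ℝ) ^ N (min r.toNNReal n) ω) (fun n => ?_) (tendsto_pi_nhds.2 fun r => ?_)
  · exact (measurable_of_countable fun n : ℕ => (-1 : ℝ) ^ n).comp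
      ((measurable_uncurry_of_rightContinuous (fun u _ => hmeas u) hrc).comp
        (measurable_id.prodMk measurable_const))
  · obtain ⟨n, hn⟩ := exists_nat_ge r.toNNReal
    refine tendsto_const_nhds.congr' ?_
    filter_upwards [eventually_ge_atTop n] with k hk
    rw [min_eq_left (hn.trans (by exact_mod_cast hk))]

lemma intervalIntegrable_neg_one_pow_path (hmeas : ∀ u, Measurable (N u))
    (hrc : ∀ ω t, ContinuousWithinAt (fun s => N s ω) (Ici t) t) (ω : Ω) (a b : ℝ) :
    IntervalIntegrable (fun r : ℝ => (-1 : ℝ) ^ N r.toNNReal ω) volume a b := by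
  refine (intervalIntegrable_const (c := (1 : ℝ))).mono_fun
    (measurable_neg_one_pow_path hmeas hrc ω).aestronglyMeasurable (ae_of_all _ fun r => ?_)
  simp

end Measurability

/-! ### Independence of an increment from the whole past. -/

section Poisson

variable {Ω : Type*} [MeasurableSpace Ω] {P : Measure Ω} {r : ℝ → ℝ} {N : ℝ≥0 → Ω → ℕ}

namespace IsPoissonProcess

/-- By a π-system argument finitely many past times suffice; their values are sums of increments
independent of the last one. -/
lemma indepFun_increment [IsProbabilityMeasure P] (h : IsPoissonProcess P r N) {s t : ℝ≥0}
    (hst : s ≤ t) :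
    IndepFun (fun ω (u : Iic s) => N u ω) (fun ω => N t ω - N s ω) P := by
  refine IndepFun.process_indepFun (X := fun (u : Iic s) ω => N u ω) (fun u => h.measurable u)
    ((h.measurable t).sub (h.measurable s)) fun I => ?_
  classical
  -- Adding `0` makes the partial sums start from `N 0 = 0`; adding `s`, the maximum of `J`, makes
  -- the last increment run from `s` to `t`.
  set J : Finset ℝ≥0 := insert 0 (insert s (I.image Subtype.val)) with hJ
  have hJs : ∀ u ∈ J, u ≤ s := by
    intro u hu
    simp only [hJ, Finset.mem_insert, Finset.mem_image] at hu
    rcases hu with rfl | rfl | ⟨v, _, rfl⟩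
    · exact zero_le
    · exact le_rfl
    · exact v.2
  have hpos : 0 < J.card := Finset.card_pos.2 ⟨0, Finset.mem_insert_self _ _⟩
  -- Beyond the enumeration of `J` the sequence is constant equal to `t`, which keeps it monotone.
  set τ : ℕ → ℝ≥0 := fun k => if hk : k < J.card then J.orderEmbOfFin rfl ⟨k, hk⟩ else t with hτ
  have hmem : ∀ k (hk : k < J.card), τ k ∈ J := fun k hk => by
    simp only [hτ, hk, dif_pos]; exact Finset.orderEmbOfFin_mem _ _ _
  have hmono : Monotone τ := by
    intro i j hij
    by_cases hj : j < J.card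
    · have hi : i < J.card := lt_of_le_of_lt hij hj
      simp only [hτ, hi, hj, dif_pos]
      exact (J.orderEmbOfFin rfl).monotone hij
    · by_cases hi : i < J.card
      · have h1 : τ j = t := by simp [hτ, hj]
        rw [h1]
        exact (hJs _ (hmem i hi)).trans hst
      · simp [hτ, hi, hj]
  have hsurj : ∀ u ∈ J, ∃ k < J.card, τ k = u := by
    intro u hu
    have : u ∈ Set.range (J.orderEmbOfFin rfl) := by
      rw [Finset.range_orderEmbOfFin]; exact hu
    obtain ⟨k, rfl⟩ := this
    exact ⟨k, k.2, by simp [hτ]⟩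
  have hτ0 : τ 0 = 0 := by
    obtain ⟨k, _, hk⟩ := hsurj 0 (Finset.mem_insert_self _ _)
    exact le_antisymm (hk ▸ hmono (Nat.zero_le k)) zero_le
  set n := J.card - 1 with hn
  have hn1 : n + 1 = J.card := by omega
  have hτn : τ n = s := by
    obtain ⟨k, hk, hks⟩ := hsurj s (Finset.mem_insert_of_mem (Finset.mem_insert_self _ _))
    exact le_antisymm (hJs _ (hmem n (by omega))) (hks ▸ hmono (by omega))
  have hτt : τ (n + 1) = t := by simp [hτ, hn1]
  have hind := h.indepIncrements.nat hmono
  have hmeas : ∀ i, Measurable fun ω => N (τ (i + 1)) ω - N (τ i) ω := fun i =>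
    (h.measurable _).sub (h.measurable _)
  have hind2 := hind.indepFun_finset (Finset.range n) {n} (by simp) hmeas
  have hsum : ∀ k ω, N (τ k) ω = ∑ i ∈ Finset.range k, (N (τ (i + 1)) ω - N (τ i) ω) := by
    intro k ω
    rw [Finset.sum_range_tsub (f := fun i => N (τ i) ω) (fun i j hij => h.mono ω (hmono hij)), hτ0,
      h.zero, Nat.sub_zero]
  have hchoose : ∀ u : I, ∃ k ≤ n, τ k = u.1.1 := by
    intro u
    obtain ⟨k, hk, hku⟩ := hsurj u.1.1 (by
      simp only [hJ, Finset.mem_insert, Finset.mem_image]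
      exact Or.inr (Or.inr ⟨u.1, u.2, rfl⟩))
    exact ⟨k, by omega, hku⟩
  choose κ hκ1 hκ2 using hchoose
  have := hind2.comp (_mγ := (inferInstance : MeasurableSpace (I → ℕ)))
    (_mγ' := (inferInstance : MeasurableSpace ℕ))
    (φ := fun (x : Finset.range n → ℕ) (u : I) => ∑ i : Finset.range n, if i.1 < κ u then x i else 0)
    (ψ := fun x : ({n} : Finset ℕ) → ℕ => x ⟨n, Finset.mem_singleton_self n⟩) ?_ ?_
  · convert! this using 1
    · funext ω u
      simp only [Function.comp_apply]
      rw [← hκ2 u, hsum, Finset.sum_coe_sort (Finset.range n)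
        (fun i => if i < κ u then N (τ (i + 1)) ω - N (τ i) ω else 0), ← Finset.sum_filter]
      congr 1
      ext i
      simp only [Finset.mem_range, Finset.mem_filter]
      have := hκ1 u
      omega
    · funext ω
      simp [hτn, hτt]
  · exact measurable_of_countable _
  · exact measurable_pi_apply _

end IsPoissonProcess

end Poisson

/-! ### One-step expansion of the Poisson characteristic function. -/

/-- The integrand of the weighted characteristic function of the signed time. -/
noncomputable def signChar {Ω : Type*} (N : ℝ≥0 → Ω → ℕ) (z ξ : ℝ) (t : ℝ≥0) (ω : Ω) : ℂ :=
  (z : ℂ) ^ N t ω * Complex.exp ((ξ * ((-1) ^ N t ω * signedTime N t ω) : ℝ) * Complex.I)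

section Path

variable {Ω : Type*} [MeasurableSpace Ω] {N : ℝ≥0 → Ω → ℕ} {z : ℝ}

omit [MeasurableSpace Ω] in
lemma norm_signChar_le (hz : 0 ≤ z) (hz1 : z ≤ 1) (ξ : ℝ) (t : ℝ≥0) (ω : Ω) :
    ‖signChar N z ξ t ω‖ ≤ 1 := by
  rw [signChar, norm_mul, Complex.norm_exp_ofReal_mul_I, mul_one, norm_pow,
    Complex.norm_of_nonneg hz]
  exact pow_le_one₀ hz hz1

lemma measurable_signChar (z ξ : ℝ) {t : ℝ≥0} (hmeas : ∀ u ≤ t, Measurable (N u))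
    (hrc : ∀ ω t, ContinuousWithinAt (fun s => N s ω) (Ici t) t) :
    Measurable (signChar N z ξ t) := by
  have h1 := measurable_signedTime hmeas hrc
  have h2 := hmeas t le_rfl
  have h3 : Measurable fun ω => (z : ℂ) ^ N t ω :=
    (measurable_of_countable fun n : ℕ => (z : ℂ) ^ n).comp h2
  have h4 : Measurable fun ω => (-1 : ℝ) ^ N t ω :=
    (measurable_of_countable fun n : ℕ => (-1 : ℝ) ^ n).comp h2
  exact h3.mul (Complex.measurable_exp.comp
    ((Complex.measurable_ofReal.comp ((h4.mul h1).const_mul ξ)).mul_const _))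

lemma signedTime_sub (hmeas : ∀ u, Measurable (N u))
    (hrc : ∀ ω t, ContinuousWithinAt (fun s => N s ω) (Ici t) t) (s t : ℝ≥0) (ω : Ω) :
    signedTime N t ω - signedTime N s ω = ∫ u in (s : ℝ)..t, (-1) ^ N u.toNNReal ω :=
  intervalIntegral.integral_interval_sub_left
    (intervalIntegrable_neg_one_pow_path hmeas hrc ω _ _)
    (intervalIntegrable_neg_one_pow_path hmeas hrc ω _ _)

lemma abs_signedTime_sub_le (hmeas : ∀ u, Measurable (N u))
    (hrc : ∀ ω t, ContinuousWithinAt (fun s => N s ω) (Ici t) t) {s t : ℝ≥0} (hst : s ≤ t) (ω : Ω) :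
    |signedTime N t ω - signedTime N s ω| ≤ t - s := by
  rw [signedTime_sub hmeas hrc]
  have := intervalIntegral.norm_integral_le_of_norm_le_const (a := (s : ℝ)) (b := t) (C := 1)
    (f := fun u : ℝ => (-1 : ℝ) ^ N u.toNNReal ω) (fun u _ => by simp)
  rwa [one_mul, abs_of_nonneg (sub_nonneg.2 (NNReal.coe_le_coe.2 hst))] at this

lemma signedTime_of_const (hmeas : ∀ u, Measurable (N u))
    (hrc : ∀ ω t, ContinuousWithinAt (fun s => N s ω) (Ici t) t) {s t : ℝ≥0} (hst : s ≤ t) {ω : Ω}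
    (hmono : Monotone fun t => N t ω) (h : N t ω = N s ω) :
    signedTime N t ω = signedTime N s ω + (t - s) * (-1) ^ N s ω := by
  rw [← sub_eq_iff_eq_add', signedTime_sub hmeas hrc]
  have hst' : (s : ℝ) ≤ t := NNReal.coe_le_coe.2 hst
  rw [intervalIntegral.integral_congr (g := fun _ => (-1 : ℝ) ^ N s ω)]
  · simp
  · intro u hu
    rw [uIcc_of_le hst'] at hu
    have h1 : N s ω ≤ N u.toNNReal ω := hmono (NNReal.le_toNNReal_of_coe_le hu.1)
    have h2 : N u.toNNReal ω ≤ N t ω := hmono (Real.toNNReal_le_iff_le_coe.2 hu.2)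
    simp only
    rw [le_antisymm (h2.trans h.le) h1]

lemma norm_exp_mul_I_sub_le (x y : ℝ) :
    ‖Complex.exp (x * Complex.I) - Complex.exp (y * Complex.I)‖ ≤ |x - y| := by
  have h1 : Complex.exp (x * Complex.I) - Complex.exp (y * Complex.I)
      = Complex.exp (y * Complex.I) * (Complex.exp (Complex.I * (x - y : ℝ)) - 1) := by
    rw [mul_sub, ← Complex.exp_add, mul_one]
    congr 2
    push_cast; ring
  rw [h1, norm_mul, Complex.norm_exp_ofReal_mul_I, one_mul]
  exact Real.norm_exp_I_mul_ofReal_sub_one_le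

/-- The pathwise one-step expansion of `signChar`. -/
lemma norm_signChar_sub_le (hz : 0 ≤ z) (hz1 : z ≤ 1) (ξ : ℝ) (hmeas : ∀ u, Measurable (N u))
    (hrc : ∀ ω t, ContinuousWithinAt (fun s => N s ω) (Ici t) t) {s t : ℝ≥0} (hst : s ≤ t) {ω : Ω}
    (hmono : Monotone fun t => N t ω) :
    ‖signChar N z ξ t ω
      - Complex.exp ((ξ * (t - s) : ℝ) * Complex.I) * (signChar N z ξ s ω *
        if N t ω - N s ω = 0 then 1 else 0)
      - z * (signChar N z (-ξ) s ω * if N t ω - N s ω = 1 then 1 else 0)‖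
      ≤ |ξ| * (t - s) * (if N t ω - N s ω = 1 then 1 else 0)
        + (1 - (if N t ω - N s ω = 0 then 1 else 0) - if N t ω - N s ω = 1 then 1 else 0) := by
  have hle : N s ω ≤ N t ω := hmono hst
  -- The quantity `(-1)^N U` is the time in the current sense minus the time in the other. Without
  -- event it grows by exactly `t - s`. One event reverses its sign, whence `-ξ` and the factor `z`,
  -- with phase error at most `|ξ| (t - s)`. With more events the bound `1` is enough.
  rcases Nat.lt_trichotomy (N t ω - N s ω) 1 with h | h | h
  · have h0 : N t ω - N s ω = 0 := by omega
    have he : N t ω = N s ω := by omega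
    have hU := signedTime_of_const hmeas hrc hst hmono he
    have hsq : ((-1 : ℝ) ^ N s ω) * (-1) ^ N s ω = 1 := by
      rw [← mul_pow]; simp
    have : signChar N z ξ t ω
        = Complex.exp ((ξ * (t - s) : ℝ) * Complex.I) * signChar N z ξ s ω := by
      rw [signChar, signChar, he, hU, mul_left_comm (Complex.exp _), ← Complex.exp_add, ← add_mul,
        ← Complex.ofReal_add]
      congr 4
      linear_combination ξ * (t - s) * hsq
    simp [h0, this]
  · have he : N t ω = N s ω + 1 := by omega
    have : signChar N z ξ t ω - z * signChar N z (-ξ) s ω = (z : ℂ) ^ N t ω *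
        (Complex.exp ((ξ * ((-1) ^ N t ω * signedTime N t ω) : ℝ) * Complex.I)
        - Complex.exp ((-ξ * ((-1) ^ N s ω * signedTime N s ω) : ℝ) * Complex.I)) := by
      rw [signChar, signChar, mul_sub, he, pow_succ' (z : ℂ), mul_assoc (z : ℂ), mul_assoc (z : ℂ)]
    simp only [h, one_ne_zero, if_false, if_true, mul_zero, sub_zero, mul_one]
    rw [this, norm_mul, norm_pow, Complex.norm_of_nonneg hz]
    have h1 := norm_exp_mul_I_sub_le (ξ * ((-1) ^ N t ω * signedTime N t ω))
      (-ξ * ((-1) ^ N s ω * signedTime N s ω))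
    have h2 : |ξ * ((-1) ^ N t ω * signedTime N t ω) - -ξ * ((-1) ^ N s ω * signedTime N s ω)|
        = |ξ| * |signedTime N t ω - signedTime N s ω| := by
      rw [he, ← abs_mul, pow_succ]
      have : ξ * ((-1) ^ N s ω * -1 * signedTime N t ω) - -ξ * ((-1) ^ N s ω * signedTime N s ω)
          = (-1) ^ (N s ω + 1) * (ξ * (signedTime N t ω - signedTime N s ω)) := by
        rw [pow_succ]; ring
      rw [this, abs_mul, abs_pow]; simp
    have h3 := abs_signedTime_sub_le hmeas hrc hst ω
    calc z ^ N t ω * _ ≤ 1 * (|ξ| * (t - s)) := by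
          refine mul_le_mul (pow_le_one₀ hz hz1) ?_ (norm_nonneg _) zero_le_one
          rw [h2] at h1
          exact h1.trans (mul_le_mul_of_nonneg_left h3 (abs_nonneg _))
      _ = _ := by ring
  · have h0 : N t ω - N s ω ≠ 0 := by omega
    have h1 : N t ω - N s ω ≠ 1 := by omega
    simp only [h0, h1, if_false, mul_zero, sub_zero, zero_add]
    exact norm_signChar_le hz hz1 ξ t ω

end Path

namespace IsPoissonProcess

variable {Ω : Type*} [MeasurableSpace Ω] {P : Measure Ω} [IsProbabilityMeasure P] {r : ℝ → ℝ}
  {N : ℝ≥0 → Ω → ℕ} (h : IsPoissonProcess P r N) {z : ℝ}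
include h

omit [IsProbabilityMeasure P] in
lemma measurable_increment (s t : ℝ≥0) : Measurable fun ω => N t ω - N s ω :=
  (h.measurable t).sub (h.measurable s)

omit [IsProbabilityMeasure P] in
lemma measurableSet_increment (s t : ℝ≥0) (k : ℕ) : MeasurableSet {ω | N t ω - N s ω = k} :=
  h.measurable_increment s t (measurableSet_singleton k)

omit [IsProbabilityMeasure P] in
lemma real_increment (hr : ∀ x, 0 ≤ r x) {s t : ℝ≥0} (hst : s ≤ t) (k : ℕ) :
    P.real {ω | N t ω - N s ω = k} = Real.exp (-∫ u in (s : ℝ)..t, r u) *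
      (∫ u in (s : ℝ)..t, r u) ^ k / k.factorial := by
  have h1 := h.law s t hst
  have h2 : 0 ≤ ∫ u in (s : ℝ)..t, r u :=
    intervalIntegral.integral_nonneg (NNReal.coe_le_coe.2 hst) fun u _ => hr u
  have h3 : P.real {ω | N t ω - N s ω = k} = (P.map fun ω => N t ω - N s ω).real {k} := by
    rw [map_measureReal_apply (h.measurable_increment s t) (measurableSet_singleton k)]
    rfl
  rw [h3, h1, poissonMeasure_real_singleton, Real.coe_toNNReal _ h2]

/-- `signChar` at time `s` depends only on the path up to `s`, hence is independent of the
increment. -/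
lemma integral_mul_increment {s t : ℝ≥0} (hst : s ≤ t) (ξ : ℝ) (k : ℕ) :
    ∫ ω, signChar N z ξ s ω * (if N t ω - N s ω = k then 1 else 0) ∂P
      = (∫ ω, signChar N z ξ s ω ∂P) * (P.real {ω | N t ω - N s ω = k} : ℂ) := by
  have h1 := h.indepFun_increment hst
  have h2 : IndepFun (signChar N z ξ s) (fun ω => N t ω - N s ω) P := by
    rw [IndepFun_iff_Indep] at h1 ⊢
    refine indep_of_indep_of_le_left h1 (Measurable.comap_le ?_)
    refine @measurable_signChar Ω (MeasurableSpace.comap (fun ω (u : Iic s) => N u ω) MeasurableSpace.pi)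
      N z ξ s (fun u hu => ?_) h.rightContinuous
    exact (@measurable_pi_apply (Iic s) (fun _ => ℕ) _ ⟨u, hu⟩).comp (comap_measurable _)
  have h3 := h2.comp measurable_id (measurable_of_countable fun n : ℕ => if n = k then (1 : ℂ) else 0)
  have h4 := h3.integral_fun_mul_eq_mul_integral
    (measurable_signChar z ξ (fun u _ => h.measurable u) h.rightContinuous).aestronglyMeasurable
    (((measurable_of_countable fun n : ℕ => if n = k then (1 : ℂ) else 0).comp
      (h.measurable_increment s t)).aestronglyMeasurable)
  simp only [Function.comp_apply, id_eq] at h4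
  rw [h4]
  congr 1
  have h5 : (fun ω => if N t ω - N s ω = k then (1 : ℂ) else 0)
      = {ω | N t ω - N s ω = k}.indicator fun _ => 1 := by
    funext ω; simp [indicator]
  rw [h5, integral_indicator_const _ (h.measurableSet_increment s t k)]
  simp

lemma integrable_signChar (hz : 0 ≤ z) (hz1 : z ≤ 1) (ξ : ℝ) (t : ℝ≥0) :
    Integrable (signChar N z ξ t) P :=
  Integrable.of_bound
    (measurable_signChar z ξ (fun u _ => h.measurable u) h.rightContinuous).aestronglyMeasurable 1
    (ae_of_all _ fun ω => norm_signChar_le hz hz1 ξ t ω)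

lemma integrable_increment (s t : ℝ≥0) (k : ℕ) :
    Integrable (fun ω => if N t ω - N s ω = k then (1 : ℝ) else 0) P := by
  refine Integrable.of_bound ((measurable_of_countable fun n : ℕ => if n = k then (1 : ℝ) else 0).comp
    (h.measurable_increment s t)).aestronglyMeasurable 1 (ae_of_all _ fun ω => ?_)
  split_ifs <;> simp

omit [IsProbabilityMeasure P] in
lemma integral_increment (s t : ℝ≥0) (k : ℕ) :
    ∫ ω, (if N t ω - N s ω = k then (1 : ℝ) else 0) ∂P = P.real {ω | N t ω - N s ω = k} := by
  have h5 : (fun ω => if N t ω - N s ω = k then (1 : ℝ) else 0)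
      = {ω | N t ω - N s ω = k}.indicator fun _ => 1 := by
    funext ω; simp [indicator]
  rw [h5, integral_indicator_const _ (h.measurableSet_increment s t k)]
  simp

lemma norm_integral_signChar_sub_le (hr : ∀ x, 0 ≤ r x) (hz : 0 ≤ z) (hz1 : z ≤ 1) (ξ : ℝ)
    {s t : ℝ≥0} (hst : s ≤ t) :
    ‖∫ ω, signChar N z ξ t ω ∂P
      - Complex.exp ((ξ * (t - s) : ℝ) * Complex.I) * (∫ ω, signChar N z ξ s ω ∂P) *
        (Real.exp (-∫ u in (s : ℝ)..t, r u) : ℝ)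
      - z * (∫ ω, signChar N z (-ξ) s ω ∂P) *
        ((∫ u in (s : ℝ)..t, r u) * Real.exp (-∫ u in (s : ℝ)..t, r u) : ℝ)‖
      ≤ |ξ| * (t - s) * (∫ u in (s : ℝ)..t, r u) + (∫ u in (s : ℝ)..t, r u) ^ 2 := by
  set δ := ∫ u in (s : ℝ)..t, r u with hδ
  have hδ0 : 0 ≤ δ :=
    intervalIntegral.integral_nonneg (NNReal.coe_le_coe.2 hst) fun u _ => hr u
  have p0 := h.real_increment hr hst 0
  have p1 := h.real_increment hr hst 1
  rw [← hδ] at p0 p1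
  simp only [pow_zero, Nat.factorial_zero, Nat.cast_one, div_one, mul_one, pow_one,
    Nat.factorial_one] at p0 p1
  have q0 := h.integral_mul_increment (z := z) hst ξ 0
  have q1 := h.integral_mul_increment (z := z) hst (-ξ) 1
  have i0 := h.integrable_signChar hz hz1 ξ t
  have hint : ∀ ξ k, Integrable (fun ω => signChar N z ξ s ω *
      (if N t ω - N s ω = k then (1 : ℂ) else 0)) P := by
    intro ξ k
    refine (h.integrable_signChar hz hz1 ξ s).mul_bdd (c := 1) ?_ (ae_of_all _ fun ω => ?_)
    · exact ((measurable_of_countable fun n : ℕ => if n = k then (1 : ℂ) else 0).comp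
        (h.measurable_increment s t)).aestronglyMeasurable
    · split_ifs <;> simp
  have hkey := norm_integral_le_of_norm_le (μ := P)
    ((((h.integrable_increment s t 1).const_mul (|ξ| * (t - s)))).add
      (((integrable_const (1 : ℝ)).sub (h.integrable_increment s t 0)).sub
        (h.integrable_increment s t 1)))
    (ae_of_all _ fun ω => norm_signChar_sub_le hz hz1 ξ h.measurable h.rightContinuous hst (h.mono ω))
  simp only [Pi.add_apply, Pi.sub_apply] at hkey
  have j1 := h.integrable_increment s t 1
  have j0 := h.integrable_increment s t 0
  rw [integral_sub, integral_sub, integral_const_mul, integral_const_mul, q0, q1, p0, p1,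
    integral_add, integral_sub, integral_sub, integral_const_mul, h.integral_increment,
    h.integral_increment, p0, p1] at hkey
  rotate_left
  · exact integrable_const _
  · exact j0
  · exact (integrable_const _).sub j0
  · exact j1
  · exact j1.const_mul _
  · exact ((integrable_const _).sub j0).sub j1
  · exact i0
  · exact (hint ξ 0).const_mul _
  · exact i0.sub ((hint ξ 0).const_mul _)
  · exact (hint (-ξ) 1).const_mul _
  simp only [integral_const, probReal_univ, smul_eq_mul, mul_one] at hkey
  have hE1 : Real.exp (-δ) ≤ 1 := Real.exp_le_one_iff.2 (by linarith)
  -- This bounds the probability of at least two events: `1 - (1 + δ) exp(-δ) ≤ δ²`.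
  have hE2 : 1 - δ ≤ Real.exp (-δ) := by linarith [Real.add_one_le_exp (-δ)]
  have hts : (0 : ℝ) ≤ t - s := sub_nonneg.2 (NNReal.coe_le_coe.2 hst)
  calc _ = _ := by
        rw [mul_comm δ, mul_assoc (Complex.exp _), mul_assoc (z : ℂ)]
    _ ≤ _ := hkey
    _ ≤ _ := by
      have a1 : |ξ| * (t - s) * (Real.exp (-δ) * δ) ≤ |ξ| * (t - s) * δ := by
        refine mul_le_mul_of_nonneg_left ?_ (mul_nonneg (abs_nonneg _) hts)
        nlinarith
      nlinarith

end IsPoissonProcess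

/-- A family of functions with the one-step expansion of a weighted Poisson characteristic function
solves the corresponding system of differential equations. -/
lemma isCharSolution_of_expansion {r : ℝ → ℝ} (hr : IsRate r) {z : ℝ} (hz : 0 ≤ z)
    {L : ℝ → ℝ → ℂ} (hzero : ∀ ξ, L ξ 0 = 1)
    (hbound : ∀ ξ t, 0 ≤ t → ‖L ξ t‖ ≤ Real.exp (∫ u in (0 : ℝ)..t, r u))
    (hexp : ∀ ξ s t, 0 ≤ s → s ≤ t →
      ‖L ξ t - L ξ s - z * (∫ u in s..t, r u : ℝ) *
        (Complex.exp (-(ξ * (t + s) : ℝ) * Complex.I) * L (-ξ) s)‖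
      ≤ Real.exp (∫ u in (0 : ℝ)..t, r u) *
        (|ξ| * (t - s) * (∫ u in s..t, r u) + (∫ u in s..t, r u) ^ 2)) :
    IsCharSolution (fun x => z * r x) L := by
  set Λ : ℝ → ℝ := fun t => ∫ u in (0 : ℝ)..t, r u with hΛ
  have hΛc : Continuous Λ := hr.continuous_primitive
  have hsub : ∀ s t, ∫ u in s..t, r u = Λ t - Λ s := fun s t =>
    (intervalIntegral.integral_interval_sub_left (hr.intervalIntegrable 0 t)
      (hr.intervalIntegrable 0 s)).symm
  have hmono : Monotone Λ := fun s t hst => by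
    have : 0 ≤ ∫ u in s..t, r u := intervalIntegral.integral_nonneg hst fun u _ => hr.nonneg u
    rw [hsub] at this; linarith
  have hΛ0 : Λ 0 = 0 := by simp [hΛ]
  have hexp1 : ∀ x : ℝ, ‖Complex.exp (-(x : ℂ) * Complex.I)‖ = 1 := fun x => by
    rw [← Complex.ofReal_neg, Complex.norm_exp_ofReal_mul_I]
  simp only [hsub, hΛ0, sub_zero] at hexp
  -- The expansion is only available from the earlier time to the later one; for a two-sided
  -- derivative it is rewritten with base point `min t s`.
  have hsymm : ∀ ξ T s t, 0 ≤ s → s ≤ T → 0 ≤ t → t ≤ T →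
      ‖L ξ t - L ξ s - z * (Λ t - Λ s : ℝ) *
        (Complex.exp (-(ξ * (t + s) : ℝ) * Complex.I) * L (-ξ) (min t s))‖
      ≤ Real.exp (Λ T) * (|ξ| * |t - s| * |Λ t - Λ s| + |Λ t - Λ s| ^ 2) := by
    intro ξ T s t hs hsT ht htT
    rcases le_total s t with hst | hst
    · rw [min_eq_right hst, abs_of_nonneg (sub_nonneg.2 hst),
        abs_of_nonneg (sub_nonneg.2 (hmono hst))]
      refine (hexp ξ s t hs hst).trans (mul_le_mul_of_nonneg_right
        (Real.exp_le_exp.2 (hmono htT)) ?_)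
      have := mul_nonneg (mul_nonneg (abs_nonneg ξ) (sub_nonneg.2 hst)) (sub_nonneg.2 (hmono hst))
      positivity
    · rw [min_eq_left hst, abs_sub_comm t s, abs_sub_comm (Λ t), abs_of_nonneg (sub_nonneg.2 hst),
        abs_of_nonneg (sub_nonneg.2 (hmono hst)), ← norm_neg]
      refine le_trans (le_of_eq ?_) ((hexp ξ t s ht hst).trans (mul_le_mul_of_nonneg_right
        (Real.exp_le_exp.2 (hmono hsT)) ?_))
      · congr 1
        rw [add_comm t s]
        push_cast; ring
      · have := mul_nonneg (mul_nonneg (abs_nonneg ξ) (sub_nonneg.2 hst))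
          (sub_nonneg.2 (hmono hst))
        positivity
  have hcont : ∀ ξ, ContinuousOn (L ξ) (Ici 0) := by
    intro ξ t₀ ht₀
    have ht₀' : 0 ≤ t₀ := ht₀
    set T := t₀ + 1
    rw [ContinuousWithinAt, tendsto_iff_norm_sub_tendsto_zero]
    have hlim : Tendsto (fun t => z * |Λ t - Λ t₀| * Real.exp (Λ T) + Real.exp (Λ T) *
        (|ξ| * |t - t₀| * |Λ t - Λ t₀| + |Λ t - Λ t₀| ^ 2)) (𝓝[Ici 0] t₀) (𝓝 0) := by
      have : Continuous fun t => z * |Λ t - Λ t₀| * Real.exp (Λ T) + Real.exp (Λ T) *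
        (|ξ| * |t - t₀| * |Λ t - Λ t₀| + |Λ t - Λ t₀| ^ 2) := by fun_prop
      have h2 := this.tendsto t₀
      simp only [sub_self, abs_zero, mul_zero, zero_mul, add_zero, ne_eq, OfNat.ofNat_ne_zero,
        not_false_eq_true, zero_pow] at h2
      exact h2.mono_left nhdsWithin_le_nhds
    refine squeeze_zero' (Eventually.of_forall fun t => norm_nonneg _) ?_ hlim
    filter_upwards [self_mem_nhdsWithin, mem_nhdsWithin_of_mem_nhds (Iio_mem_nhds (lt_add_one t₀))]
      with t ht htT
    have h1 := hsymm ξ T t₀ t ht₀' (by simp [T]) ht (le_of_lt htT)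
    have h2 : ‖(z : ℂ) * (Λ t - Λ t₀ : ℝ) *
        (Complex.exp (-(ξ * (t + t₀) : ℝ) * Complex.I) * L (-ξ) (min t t₀))‖
        ≤ z * |Λ t - Λ t₀| * Real.exp (Λ T) := by
      rw [norm_mul, norm_mul, norm_mul, hexp1, one_mul, Complex.norm_of_nonneg hz,
        Complex.norm_real, Real.norm_eq_abs]
      refine mul_le_mul_of_nonneg_left ((hbound _ _ (le_min ht ht₀')).trans
        (Real.exp_le_exp.2 (hmono ((min_le_left _ _).trans (le_of_lt htT)))))
        (mul_nonneg hz (abs_nonneg _))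
    calc ‖L ξ t - L ξ t₀‖ = ‖(z : ℂ) * (Λ t - Λ t₀ : ℝ) *
        (Complex.exp (-(ξ * (t + t₀) : ℝ) * Complex.I) * L (-ξ) (min t t₀))
          + (L ξ t - L ξ t₀ - z * (Λ t - Λ t₀ : ℝ) *
        (Complex.exp (-(ξ * (t + t₀) : ℝ) * Complex.I) * L (-ξ) (min t t₀)))‖ := by
          congr 1; ring
      _ ≤ _ := (norm_add_le _ _).trans (add_le_add h2 h1)
  refine ⟨hzero, hcont, fun ξ t₀ ht₀ => ?_⟩
  set T := t₀ + 1
  have hslope : Tendsto (slope Λ t₀) (𝓝[≠] t₀) (𝓝 (r t₀)) :=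
    hasDerivAt_iff_tendsto_slope.1 (hr.hasDerivAt_primitive ht₀)
  rw [hasDerivAt_iff_tendsto_slope]
  set B : ℝ → ℂ := fun t => Complex.exp (-(ξ * (t + t₀) : ℝ) * Complex.I) * L (-ξ) (min t t₀)
    with hB
  have hBc : Tendsto B (𝓝[≠] t₀) (𝓝 (Complex.exp (-(2 * ξ * t₀ : ℝ) * Complex.I) * L (-ξ) t₀)) := by
    have h1 : ContinuousAt B t₀ := by
      have h2 : ContinuousAt (fun t => L (-ξ) (min t t₀)) t₀ := by
        have h3 : ContinuousAt (L (-ξ)) (min t₀ t₀) := by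
          rw [min_self]; exact (hcont (-ξ)).continuousAt (Ici_mem_nhds ht₀)
        exact ContinuousAt.comp (f := fun t => min t t₀) h3 (by fun_prop)
      exact ContinuousAt.mul (by fun_prop) h2
    have h2 : B t₀ = Complex.exp (-(2 * ξ * t₀ : ℝ) * Complex.I) * L (-ξ) t₀ := by
      simp only [hB, min_self]
      rw [show ξ * (t₀ + t₀) = 2 * ξ * t₀ by ring]
    rw [← h2]
    exact h1.tendsto.mono_left nhdsWithin_le_nhds
  -- The remainder is `O(|t - t₀| |Λ t - Λ t₀| + |Λ t - Λ t₀|²)`, which is `o(t - t₀)` because `Λ`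
  -- is differentiable at `t₀ > 0`.
  have hR : Tendsto (fun t => (t - t₀)⁻¹ • (L ξ t - L ξ t₀ - z * (Λ t - Λ t₀ : ℝ) * B t))
      (𝓝[≠] t₀) (𝓝 0) := by
    rw [tendsto_zero_iff_norm_tendsto_zero]
    have hδ : Tendsto (fun t => |Λ t - Λ t₀|) (𝓝[≠] t₀) (𝓝 0) := by
      have : Continuous fun t => |Λ t - Λ t₀| := by fun_prop
      have h2 := this.tendsto t₀
      simp only [sub_self, abs_zero] at h2
      exact h2.mono_left nhdsWithin_le_nhds
    have hlim : Tendsto (fun t => Real.exp (Λ T) *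
        (|ξ| * |Λ t - Λ t₀| + |slope Λ t₀ t| * |Λ t - Λ t₀|)) (𝓝[≠] t₀) (𝓝 0) := by
      have := ((hδ.const_mul |ξ|).add (hslope.abs.mul hδ)).const_mul (Real.exp (Λ T))
      simpa using this
    refine squeeze_zero' (Eventually.of_forall fun t => norm_nonneg _) ?_ hlim
    filter_upwards [self_mem_nhdsWithin, mem_nhdsWithin_of_mem_nhds (Ioo_mem_nhds ht₀ (lt_add_one t₀))]
      with t hne ht
    have hne' : t - t₀ ≠ 0 := sub_ne_zero.2 hne
    have h1 := hsymm ξ T t₀ t ht₀.le (by simp [T]) ht.1.le (le_of_lt ht.2)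
    rw [norm_smul, norm_inv, Real.norm_eq_abs]
    refine (mul_le_mul_of_nonneg_left h1 (by positivity)).trans (le_of_eq ?_)
    rw [slope_def_field, abs_div]
    field_simp
  have hmain : Tendsto (fun t => (z : ℂ) * (slope Λ t₀ t : ℝ) * B t) (𝓝[≠] t₀)
      (𝓝 ((z : ℂ) * (r t₀ : ℝ) * (Complex.exp (-(2 * ξ * t₀ : ℝ) * Complex.I) * L (-ξ) t₀))) :=
    (((Complex.continuous_ofReal.tendsto _).comp hslope).const_mul _).mul hBc
  have hsum := hmain.add hR
  rw [add_zero] at hsum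
  refine (hsum.congr' ?_).trans (le_of_eq ?_)
  · filter_upwards [self_mem_nhdsWithin] with t hne
    have hne' : ((t - t₀ : ℝ) : ℂ) ≠ 0 := Complex.ofReal_ne_zero.2 (sub_ne_zero.2 hne)
    rw [slope_def_field, slope_def_module, Complex.real_smul, Complex.real_smul]
    push_cast at hne' ⊢
    field_simp
    ring
  · congr 1
    push_cast; ring

/-- The normalised weighted characteristic function of a Poisson process. -/
noncomputable def poissonChar {Ω : Type*} [MeasurableSpace Ω] (P : Measure Ω) (r : ℝ → ℝ)
    (N : ℝ≥0 → Ω → ℕ) (z ξ t : ℝ) : ℂ :=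
  (Real.exp (∫ u in (0 : ℝ)..t, r u) : ℝ) * Complex.exp (-(ξ * t : ℝ) * Complex.I) *
    ∫ ω, signChar N z ξ t.toNNReal ω ∂P

/-- The one-step estimate is multiplied by `exp (∫ r)` and by a phase of modulus one. This
normalisation absorbs both the no-event probability `exp(-δ)` and the phase advance `exp(i ξ (t -
s))`. -/
lemma IsPoissonProcess.isCharSolution {Ω : Type*} [MeasurableSpace Ω] {P : Measure Ω}
    [IsProbabilityMeasure P] {r : ℝ → ℝ} {N : ℝ≥0 → Ω → ℕ} (h : IsPoissonProcess P r N)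
    (hr : IsRate r) {z : ℝ} (hz : 0 ≤ z) (hz1 : z ≤ 1) :
    IsCharSolution (fun x => z * r x) (poissonChar P r N z) := by
  have hexp1 : ∀ x : ℝ, ‖Complex.exp (-(x : ℂ) * Complex.I)‖ = 1 := fun x => by
    rw [← Complex.ofReal_neg, Complex.norm_exp_ofReal_mul_I]
  refine isCharSolution_of_expansion hr hz (fun ξ => ?_) (fun ξ t ht => ?_)
    fun ξ s t hs hst => ?_
  · simp [poissonChar, signChar, h.zero, signedTime]
  · rw [poissonChar, norm_mul, norm_mul, hexp1, mul_one,
      Complex.norm_of_nonneg (Real.exp_pos _).le]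
    refine mul_le_of_le_one_right (Real.exp_pos _).le ?_
    refine (norm_integral_le_of_norm_le_const (C := 1)
      (ae_of_all _ fun ω => norm_signChar_le hz hz1 ξ _ ω)).trans ?_
    simp
  · have ht : 0 ≤ t := hs.trans hst
    have key := h.norm_integral_signChar_sub_le hr.nonneg hz hz1 ξ
      (Real.toNNReal_le_toNNReal hst)
    rw [Real.coe_toNNReal _ hs, Real.coe_toNNReal _ ht] at key
    set δ := ∫ u in s..t, r u
    have hΛ : ∫ u in (0 : ℝ)..t, r u = (∫ u in (0 : ℝ)..s, r u) + δ :=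
      (intervalIntegral.integral_add_adjacent_intervals (hr.intervalIntegrable 0 s)
        (hr.intervalIntegrable s t)).symm
    have hk := mul_le_mul_of_nonneg_left key (Real.exp_pos (∫ u in (0 : ℝ)..t, r u)).le
    refine le_trans (le_of_eq ?_) hk
    rw [← Complex.norm_of_nonneg (Real.exp_pos (∫ u in (0 : ℝ)..t, r u)).le,
      ← mul_one ‖((Real.exp (∫ u in (0 : ℝ)..t, r u) : ℝ) : ℂ)‖, ← hexp1 (ξ * t),
      ← norm_mul, ← norm_mul]
    congr 1
    simp only [poissonChar]
    rw [mul_sub, mul_sub]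
    have e0 : (Real.exp (∫ u in (0 : ℝ)..t, r u) : ℂ) * (Real.exp (-δ) : ℝ)
        = (Real.exp (∫ u in (0 : ℝ)..s, r u) : ℝ) := by
      rw [← Complex.ofReal_mul, ← Real.exp_add, hΛ]; congr 2; ring
    have e1 : Complex.exp (-(ξ * t : ℝ) * Complex.I) * Complex.exp ((ξ * (t - s) : ℝ) * Complex.I)
        = Complex.exp (-(ξ * s : ℝ) * Complex.I) := by
      rw [← Complex.exp_add]; congr 1; push_cast; ring
    have e2 : Complex.exp (-(ξ * (t + s) : ℝ) * Complex.I) * Complex.exp (-(-ξ * s : ℝ) * Complex.I)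
        = Complex.exp (-(ξ * t : ℝ) * Complex.I) := by
      rw [← Complex.exp_add]; congr 1; push_cast; ring
    rw [← e0, ← e1, ← e2]
    push_cast
    ring

/-! ### From characteristic functions to the symmetrised weighted law. -/

/-- The unnormalised density of the absolutely continuous part of the law of the position `v U_t`,
symmetrised, where `U_t` is the signed time of a Poisson process. -/
noncomputable def signedDensity (m : ℝ → ℝ) (v t : ℝ) : ℝ → ℝ :=
  (Ioo (-(v * t)) (v * t)).indicator fun η =>
    (2 * v)⁻¹ * (edgeKernel m ((t + η / v) / 2) ((t - η / v) / 2)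
      + edgeKernel m ((t - η / v) / 2) ((t + η / v) / 2))

lemma signedDensity_nonneg (m : ℝ → ℝ) {v : ℝ} (hv : 0 < v) (t η : ℝ) :
    0 ≤ signedDensity m v t η :=
  indicator_nonneg (fun η _ => mul_nonneg (by positivity)
    (add_nonneg (edgeKernel_nonneg _ _ _) (edgeKernel_nonneg _ _ _))) η

lemma intervalIntegrable_comp_half_sub {E : Type*} [NormedAddCommGroup E] {f : ℝ → E} {v t : ℝ}
    (hv : 0 < v) (hf : IntervalIntegrable f volume 0 t) :
    IntervalIntegrable (fun η => f (t / 2 - (2 * v)⁻¹ * η)) volume (-(v * t)) (v * t) := by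
  have h1 := (hf.comp_sub_left (t / 2)).comp_mul_left (c := (2 * v)⁻¹)
  have h2 : (t / 2 - 0) / (2 * v)⁻¹ = v * t := by field_simp; ring
  have h3 : (t / 2 - t) / (2 * v)⁻¹ = -(v * t) := by field_simp; ring
  rw [h2, h3] at h1
  exact h1.symm

lemma intervalIntegrable_comp_half_add {E : Type*} [NormedAddCommGroup E] {f : ℝ → E} {v t : ℝ}
    (hv : 0 < v) (hf : IntervalIntegrable f volume 0 t) :
    IntervalIntegrable (fun η => f (t / 2 + (2 * v)⁻¹ * η)) volume (-(v * t)) (v * t) := by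
  have h1 := (hf.comp_add_left (t / 2)).comp_mul_left (c := (2 * v)⁻¹)
  have h2 : (t - t / 2) / (2 * v)⁻¹ = v * t := by field_simp; ring
  have h3 : (0 - t / 2) / (2 * v)⁻¹ = -(v * t) := by field_simp; ring
  rw [h2, h3] at h1
  exact h1

section

variable {m : ℝ → ℝ} (hm : IsRate m)
include hm

lemma measurable_signedDensity (v t : ℝ) : Measurable (signedDensity m v t) := by
  have h := measurable_edgeKernel hm
  refine Measurable.indicator (Measurable.const_mul (Measurable.add ?_ ?_) _) measurableSet_Ioo
  · exact h.comp (by fun_prop : Measurable fun η : ℝ => ((t + η / v) / 2, (t - η / v) / 2))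
  · exact h.comp (by fun_prop : Measurable fun η : ℝ => ((t - η / v) / 2, (t + η / v) / 2))

lemma intervalIntegrable_edgeKernel_antidiag {t : ℝ} (ht : 0 ≤ t) :
    IntervalIntegrable (fun b => edgeKernel m (t - b) b) volume 0 t := by
  rw [intervalIntegrable_iff_integrableOn_Ioc_of_le ht]
  exact integrableOn_edgeKernel_antidiag hm ht

lemma intervalIntegrable_edgeKernel_fst {v t : ℝ} (hv : 0 < v) (ht : 0 ≤ t) :
    IntervalIntegrable (fun η => edgeKernel m ((t + η / v) / 2) ((t - η / v) / 2)) volume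
      (-(v * t)) (v * t) := by
  convert! intervalIntegrable_comp_half_sub hv (intervalIntegrable_edgeKernel_antidiag hm ht)
    using 3 <;> (field_simp; try ring)

lemma intervalIntegrable_edgeKernel_snd {v t : ℝ} (hv : 0 < v) (ht : 0 ≤ t) :
    IntervalIntegrable (fun η => edgeKernel m ((t - η / v) / 2) ((t + η / v) / 2)) volume
      (-(v * t)) (v * t) := by
  convert! intervalIntegrable_comp_half_add hv (intervalIntegrable_edgeKernel_antidiag hm ht)
    using 3 <;> (field_simp; try ring)

lemma integrable_signedDensity {v t : ℝ} (hv : 0 < v) (ht : 0 ≤ t) :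
    Integrable (signedDensity m v t) := by
  rw [signedDensity, integrable_indicator_iff measurableSet_Ioo]
  have h := ((intervalIntegrable_edgeKernel_fst hm hv ht).add
    (intervalIntegrable_edgeKernel_snd hm hv ht)).const_mul (2 * v)⁻¹
  rw [intervalIntegrable_iff_integrableOn_Ioo_of_le (by nlinarith)] at h
  exact h

/-- The substitutions `b = (t ∓ η / v) / 2`, with Jacobian `(2 v)⁻¹`, one for each initial sense of
motion. -/
lemma integral_exp_mul_signedDensity {v t : ℝ} (hv : 0 < v) (ht : 0 ≤ t) (ξ : ℝ) :
    ∫ η : ℝ, Complex.exp (ξ * η * Complex.I) * (signedDensity m v t η : ℂ)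
      = (∫ b in (0 : ℝ)..t, Complex.exp ((v * ξ * (t - 2 * b) : ℝ) * Complex.I)
          * (edgeKernel m (t - b) b : ℂ))
        + ∫ b in (0 : ℝ)..t, Complex.exp ((-(v * ξ) * (t - 2 * b) : ℝ) * Complex.I)
          * (edgeKernel m (t - b) b : ℂ) := by
  have hvt : -(v * t) ≤ v * t := by nlinarith
  have hc : (2 * v)⁻¹ ≠ 0 := by positivity
  have hI : IntervalIntegrable (fun b => (edgeKernel m (t - b) b : ℂ)) volume 0 t :=
    ⟨(intervalIntegrable_edgeKernel_antidiag hm ht).1.ofReal,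
      (intervalIntegrable_edgeKernel_antidiag hm ht).2.ofReal⟩
  have e1 := intervalIntegral.integral_comp_sub_mul (a := -(v * t)) (b := v * t) (fun b =>
    Complex.exp ((v * ξ * (t - 2 * b) : ℝ) * Complex.I) * (edgeKernel m (t - b) b : ℂ)) hc (t / 2)
  have e2 := intervalIntegral.integral_comp_add_mul (a := -(v * t)) (b := v * t) (fun b =>
    Complex.exp ((-(v * ξ) * (t - 2 * b) : ℝ) * Complex.I) * (edgeKernel m (t - b) b : ℂ)) hc (t / 2)
  have h1 : t / 2 - (2 * v)⁻¹ * (v * t) = 0 := by field_simp; ring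
  have h2 : t / 2 - (2 * v)⁻¹ * (-(v * t)) = t := by field_simp; ring
  have h3 : t / 2 + (2 * v)⁻¹ * (-(v * t)) = 0 := by field_simp; ring
  have h4 : t / 2 + (2 * v)⁻¹ * (v * t) = t := by field_simp; ring
  rw [h1, h2] at e1
  rw [h3, h4] at e2
  have e1' := (inv_smul_eq_iff₀ hc).1 e1.symm
  have e2' := (inv_smul_eq_iff₀ hc).1 e2.symm
  rw [e1', e2', ← smul_add, ← intervalIntegral.integral_add, ← intervalIntegral.integral_smul,
    intervalIntegral.integral_of_le hvt, integral_Ioc_eq_integral_Ioo,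
    ← integral_indicator measurableSet_Ioo]
  · congr 1
    funext η
    by_cases hη : η ∈ Ioo (-(v * t)) (v * t)
    · rw [signedDensity, indicator_of_mem hη, indicator_of_mem hη]
      have a1 : t - (t / 2 - (2 * v)⁻¹ * η) = (t + η / v) / 2 := by field_simp; ring
      have a2 : t / 2 - (2 * v)⁻¹ * η = (t - η / v) / 2 := by field_simp
      have a3 : t - (t / 2 + (2 * v)⁻¹ * η) = (t - η / v) / 2 := by field_simp; ring
      have a4 : t / 2 + (2 * v)⁻¹ * η = (t + η / v) / 2 := by field_simp
      have a5 : v * ξ * (t - 2 * ((t - η / v) / 2)) = ξ * η := by field_simp; ring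
      have a6 : -(v * ξ) * (t - 2 * ((t + η / v) / 2)) = ξ * η := by field_simp; ring
      rw [a1, a2, a3, a4, a5, a6, Complex.real_smul]
      push_cast; ring
    · rw [signedDensity, indicator_of_notMem hη, indicator_of_notMem hη]; simp
  · exact intervalIntegrable_comp_half_sub (f := fun b =>
      Complex.exp ((v * ξ * (t - 2 * b) : ℝ) * Complex.I) * (edgeKernel m (t - b) b : ℂ)) hv
      (hI.continuousOn_mul (by fun_prop))
  · exact intervalIntegrable_comp_half_add (f := fun b =>
      Complex.exp ((-(v * ξ) * (t - 2 * b) : ℝ) * Complex.I) * (edgeKernel m (t - b) b : ℂ)) hv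
      (hI.continuousOn_mul (by fun_prop))

end

namespace IsPoissonProcess

variable {Ω : Type*} [MeasurableSpace Ω] {P : Measure Ω} [IsProbabilityMeasure P] {r : ℝ → ℝ}
  {N : ℝ≥0 → Ω → ℕ} {z : ℝ}

lemma _root_.IsRate.const_mul (hr : IsRate r) (hz : 0 ≤ z) : IsRate fun x => z * r x where
  measurable := hr.measurable.const_mul z
  nonneg x := mul_nonneg hz (hr.nonneg x)
  zero x hx := by rw [hr.zero x hx, mul_zero]
  contDiffOn := contDiffOn_const.mul hr.contDiffOn
  integrableOn t ht := (hr.integrableOn t ht).const_mul z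

/-- Uniqueness identifies `poissonChar` with `edgeChar` for `m = z r`; the normalisation is then
undone. The first term is the contribution of paths without events. -/
lemma integral_signChar (h : IsPoissonProcess P r N) (hr : IsRate r) (hz : 0 ≤ z) (hz1 : z ≤ 1)
    (ξ : ℝ) (t : ℝ≥0) :
    ∫ ω, signChar N z ξ t ω ∂P = (Real.exp (-∫ u in (0 : ℝ)..t, r u) : ℝ) *
      (Complex.exp ((ξ * t : ℝ) * Complex.I) + ∫ b in (0 : ℝ)..t,
        Complex.exp ((ξ * (t - 2 * b) : ℝ) * Complex.I)
          * (edgeKernel (fun x => z * r x) (t - b) b : ℂ)) := by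
  have hm := hr.const_mul hz
  have key := (h.isCharSolution hr hz hz1).unique hm (isCharSolution_edgeChar hm) ξ
    (t := t) t.coe_nonneg
  rw [poissonChar, edgeChar, Real.toNNReal_coe] at key
  have e1 : (Real.exp (-∫ u in (0 : ℝ)..t, r u) : ℂ) * (Real.exp (∫ u in (0 : ℝ)..t, r u) : ℝ)
      = 1 := by
    rw [← Complex.ofReal_mul, ← Real.exp_add]; simp
  have e2 : Complex.exp ((ξ * t : ℝ) * Complex.I) * Complex.exp (-(ξ * t : ℝ) * Complex.I) = 1 := by
    rw [← Complex.exp_add]; simp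
  have e3 : ∫ b in (0 : ℝ)..t, Complex.exp ((ξ * (t - 2 * b) : ℝ) * Complex.I)
      * (edgeKernel (fun x => z * r x) (t - b) b : ℂ) = Complex.exp ((ξ * t : ℝ) * Complex.I) *
        ∫ b in (0 : ℝ)..t, Complex.exp (-(2 * ξ * b : ℝ) * Complex.I) *
          (edgeKernel (fun x => z * r x) (t - b) b : ℂ) := by
    rw [← intervalIntegral.integral_const_mul]
    congr 1
    funext b
    rw [← mul_assoc, ← Complex.exp_add]
    congr 2
    push_cast; ring
  rw [e3]
  linear_combination (Real.exp (-∫ u in (0 : ℝ)..t, r u) : ℂ) *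
    Complex.exp ((ξ * t : ℝ) * Complex.I) * key - (∫ ω, signChar N z ξ t ω ∂P) *
      (Complex.exp ((ξ * t : ℝ) * Complex.I) * Complex.exp (-(ξ * t : ℝ) * Complex.I)) * e1 -
    (∫ ω, signChar N z ξ t ω ∂P) * e2

/-- The weighted law of the position of a particle whose velocity changes sign at the events of a
Poisson process, symmetrised over the initial direction. -/
theorem map_signedTime_add (h : IsPoissonProcess P r N) (hr : IsRate r) (hz : 0 ≤ z) (hz1 : z ≤ 1)
    {v : ℝ} (hv : 0 < v) (t : ℝ≥0) :
    (P.withDensity fun ω => ENNReal.ofReal (z ^ N t ω)).map (fun ω => v * signedTime N t ω)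
      + (P.withDensity fun ω => ENNReal.ofReal (z ^ N t ω)).map (fun ω => -(v * signedTime N t ω))
    = ENNReal.ofReal (Real.exp (-∫ u in (0 : ℝ)..t, r u)) •
      (Measure.dirac (v * t) + Measure.dirac (-(v * t)) + volume.withDensity
        fun η => ENNReal.ofReal (signedDensity (fun x => z * r x) v t η)) := by
  have hm := hr.const_mul hz
  have hU : Measurable (signedTime N t) :=
    measurable_signedTime (fun u _ => h.measurable u) h.rightContinuous
  have hzN : Measurable fun ω => ENNReal.ofReal (z ^ N t ω) :=
    (measurable_of_countable fun n : ℕ => ENNReal.ofReal (z ^ n)).comp (h.measurable t)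
  have hfin := integrable_signedDensity hm hv t.coe_nonneg
  have i1 : IsFiniteMeasure (P.withDensity fun ω => ENNReal.ofReal (z ^ N t ω)) := by
    refine isFiniteMeasure_withDensity (ne_top_of_le_ne_top ENNReal.one_ne_top ?_)
    calc ∫⁻ ω, ENNReal.ofReal (z ^ N t ω) ∂P ≤ ∫⁻ _, 1 ∂P :=
          lintegral_mono fun ω => ENNReal.ofReal_le_one.2 (pow_le_one₀ hz hz1)
      _ = 1 := by simp
  have i2 := isFiniteMeasure_withDensity_ofReal hfin.hasFiniteIntegral
  have i3 : IsFiniteMeasure (ENNReal.ofReal (Real.exp (-∫ u in (0 : ℝ)..t, r u)) •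
      (Measure.dirac (v * t) + Measure.dirac (-(v * t)) + volume.withDensity
        fun η => ENNReal.ofReal (signedDensity (fun x => z * r x) v t η))) :=
    Measure.smul_finite _ ENNReal.ofReal_ne_top
  refine Measure.ext_of_charFun (funext fun ξ => ?_)
  have hint : ∀ (μ : Measure ℝ) [IsFiniteMeasure μ], Integrable (fun x : ℝ =>
      Complex.exp (ξ * x * Complex.I)) μ := fun μ _ => by
    refine Integrable.of_bound (C := 1) (by fun_prop) (ae_of_all _ fun x => ?_)
    rw [← Complex.ofReal_mul, Complex.norm_exp_ofReal_mul_I]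
  simp only [charFun_apply_real]
  rw [integral_add_measure (hint _) (hint _), integral_smul_measure,
    integral_add_measure (hint _) (hint _), integral_add_measure (hint _) (hint _),
    integral_dirac, integral_dirac,
    integral_map (by fun_prop) (by fun_prop), integral_map (by fun_prop) (by fun_prop),
    integral_withDensity_eq_integral_toReal_smul hzN (by simp),
    integral_withDensity_eq_integral_toReal_smul hzN (by simp),
    integral_withDensity_eq_integral_toReal_smul (measurable_signedDensity hm v t).ennreal_ofReal
      (by simp)]
  simp only [ENNReal.toReal_ofReal (pow_nonneg hz _), ENNReal.toReal_ofReal (Real.exp_pos _).le,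
    ENNReal.toReal_ofReal (signedDensity_nonneg _ hv _ _)]
  have hmz : Measurable fun ω => z ^ N t ω :=
    (measurable_of_countable fun n : ℕ => z ^ n).comp (h.measurable t)
  have hint2 : ∀ g : Ω → ℝ, Measurable g → Integrable (fun ω =>
      z ^ N t ω • Complex.exp (ξ * (g ω : ℝ) * Complex.I)) P := fun g hg => by
    refine Integrable.of_bound (C := 1) (by fun_prop) (ae_of_all _ fun x => ?_)
    rw [norm_smul, ← Complex.ofReal_mul, Complex.norm_exp_ofReal_mul_I, mul_one, norm_pow,
      Real.norm_of_nonneg hz]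
    exact pow_le_one₀ hz hz1
  -- The sign `(-1)^N` either keeps or exchanges the two signs of the frequency, so it disappears
  -- from the symmetrised sum.
  have hsum : (∫ ω, z ^ N t ω • Complex.exp (ξ * (v * signedTime N t ω : ℝ) * Complex.I) ∂P)
      + ∫ ω, z ^ N t ω • Complex.exp (ξ * (-(v * signedTime N t ω) : ℝ) * Complex.I) ∂P
      = (∫ ω, signChar N z (v * ξ) t ω ∂P) + ∫ ω, signChar N z (-(v * ξ)) t ω ∂P := by
    rw [← integral_add (hint2 _ (by fun_prop)) (hint2 _ (by fun_prop)),
      ← integral_add (h.integrable_signChar hz hz1 _ t) (h.integrable_signChar hz hz1 _ t)]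
    congr 1
    funext ω
    rw [signChar, signChar, Complex.real_smul, Complex.real_smul]
    rcases neg_one_pow_eq_or ℝ (N t ω) with e | e <;> rw [e] <;> push_cast
    · rw [show (ξ : ℂ) * (v * signedTime N t ω) = v * ξ * (1 * signedTime N t ω) by ring,
        show (ξ : ℂ) * -(v * signedTime N t ω) = -(v * ξ) * (1 * signedTime N t ω) by ring]
    · rw [show (ξ : ℂ) * (v * signedTime N t ω) = -(v * ξ) * (-1 * signedTime N t ω) by ring,
        show (ξ : ℂ) * -(v * signedTime N t ω) = v * ξ * (-1 * signedTime N t ω) by ring, add_comm]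
  rw [hsum, h.integral_signChar hr hz hz1, h.integral_signChar hr hz hz1]
  have hlast := integral_exp_mul_signedDensity hm hv t.coe_nonneg ξ
  simp only [Complex.real_smul]
  simp only [mul_comm (Complex.exp _) ((signedDensity _ _ _ _ : ℝ) : ℂ)] at hlast
  rw [hlast]
  push_cast
  rw [show (ξ : ℂ) * (v * t) = v * ξ * t by ring,
    show (ξ : ℂ) * -(v * t) = -(v * ξ) * t by ring]
  ring

end IsPoissonProcess

namespace IsPoissonProcess

variable {Ω : Type*} [MeasurableSpace Ω] {P : Measure Ω} {r : ℝ → ℝ} {N : ℝ≥0 → Ω → ℕ} {z : ℝ}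

lemma integral_pow (h : IsPoissonProcess P r N) (hr : IsRate r) (z : ℝ) (t : ℝ≥0) :
    ∫ ω, z ^ N t ω ∂P = Real.exp (-((1 - z) * ∫ u in (0 : ℝ)..t, r u)) := by
  have hΛ : 0 ≤ ∫ u in (0 : ℝ)..t, r u :=
    intervalIntegral.integral_nonneg t.coe_nonneg fun u _ => hr.nonneg u
  have hlaw := h.law 0 t zero_le
  simp only [h.zero, Nat.sub_zero, NNReal.coe_zero] at hlaw
  rw [← integral_map (φ := N t) (f := fun n : ℕ => z ^ n) (h.measurable t).aemeasurable
    (measurable_of_countable _).aestronglyMeasurable, show P.map (N t) = _ from hlaw,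
    integral_poissonMeasure, Real.coe_toNNReal _ hΛ]
  set Λ := ∫ u in (0 : ℝ)..t, r u
  have h1 : ∀ n : ℕ, (Real.exp (-Λ) * Λ ^ n / n.factorial) • z ^ n
      = Real.exp (-Λ) * ((Λ * z) ^ n / n.factorial) := fun n => by
    rw [smul_eq_mul, mul_pow]; ring
  simp_rw [h1]
  rw [tsum_mul_left, (NormedSpace.expSeries_div_hasSum_exp (Λ * z)).tsum_eq, ← Real.exp_eq_exp_ℝ,
    ← Real.exp_add]
  congr 1; ring

/-- At `ξ = 0` the identity `integral_signChar` reads: `E[z^N]` equals the no-event probability plus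
half of the absolutely continuous mass. -/
lemma integral_signedDensity [IsProbabilityMeasure P] (h : IsPoissonProcess P r N) (hr : IsRate r)
    (hz : 0 ≤ z) (hz1 : z ≤ 1) {v : ℝ} (hv : 0 < v) (t : ℝ≥0) :
    Real.exp (-∫ u in (0 : ℝ)..t, r u) * ∫ η, signedDensity (fun x => z * r x) v t η
      = 2 * (Real.exp (-((1 - z) * ∫ u in (0 : ℝ)..t, r u))
        - Real.exp (-∫ u in (0 : ℝ)..t, r u)) := by
  have h1 := h.integral_signChar hr hz hz1 0 t
  have h2 := integral_exp_mul_signedDensity (hr.const_mul hz) hv t.coe_nonneg 0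
  have h3 : ∫ ω, signChar N z 0 t ω ∂P
      = (Real.exp (-((1 - z) * ∫ u in (0 : ℝ)..t, r u)) : ℝ) := by
    rw [← h.integral_pow hr, ← integral_complex_ofReal]
    simp [signChar]
  rw [h3] at h1
  simp only [mul_zero, neg_zero, zero_mul, Complex.ofReal_zero, Complex.exp_zero, one_mul] at h1 h2
  rw [integral_complex_ofReal] at h2
  have h4 : ((Real.exp (-∫ u in (0 : ℝ)..t, r u) *
      ∫ η, signedDensity (fun x => z * r x) v t η : ℝ) : ℂ)
      = (2 * (Real.exp (-((1 - z) * ∫ u in (0 : ℝ)..t, r u))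
        - Real.exp (-∫ u in (0 : ℝ)..t, r u)) : ℝ) := by
    push_cast at h1 h2 ⊢
    linear_combination Complex.exp (-((∫ u in (0 : ℝ)..t, r u : ℝ) : ℂ)) * h2 - 2 * h1
  exact_mod_cast h4

end IsPoissonProcess

/-! ### Sample paths of the Poisson process: all intermediate values are taken. -/

lemma isRate_indicator {lam : ℝ → ℝ} (hlam : ContDiffOn ℝ 1 lam (Ioi 0))
    (hlam_nonneg : ∀ t, 0 < t → 0 ≤ lam t) (hlam_int : ∀ t, 0 < t → IntegrableOn lam (Ioc 0 t)) :
    IsRate ((Ioi 0).indicator lam) where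
  measurable := by
    have := hlam.continuousOn.measurable_piecewise (g := (0 : ℝ → ℝ)) continuousOn_const
      measurableSet_Ioi
    rwa [piecewise_eq_indicator] at this
  nonneg x := indicator_nonneg (fun t ht => hlam_nonneg t ht) x
  zero x hx := indicator_of_notMem (by simpa using hx) _
  contDiffOn := hlam.congr fun x hx => indicator_of_mem hx _
  integrableOn t ht := (hlam_int t ht).congr_fun
    (fun x hx => (indicator_of_mem (show x ∈ Ioi (0 : ℝ) from hx.1) _).symm) measurableSet_Ioc

lemma integral_indicator_Ioi (lam : ℝ → ℝ) {s t : ℝ} (hs : 0 ≤ s) (hst : s ≤ t) :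
    ∫ u in s..t, (Ioi 0).indicator lam u = ∫ u in s..t, lam u := by
  rw [intervalIntegral.integral_of_le hst, intervalIntegral.integral_of_le hst]
  exact setIntegral_congr_fun measurableSet_Ioc fun x hx =>
    indicator_of_mem (show x ∈ Ioi (0 : ℝ) from hs.trans_lt hx.1) _

/-- An integer sequence that starts at `0` and increases by at most `1` takes all intermediate
values. -/
lemma exists_eq_of_le_succ {a : ℕ → ℕ} (h0 : a 0 = 0) {n : ℕ} (h : ∀ i < n, a (i + 1) ≤ a i + 1)
    {k : ℕ} (hk : k ≤ a n) : ∃ i ≤ n, a i = k := by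
  induction n with
  | zero => exact ⟨0, le_rfl, by omega⟩
  | succ n ih =>
    by_cases hk' : k ≤ a n
    · obtain ⟨i, hi, rfl⟩ := ih (fun i hi => h i (by omega)) hk'
      exact ⟨i, by omega, rfl⟩
    · have := h n (by omega)
      exact ⟨n + 1, le_rfl, by omega⟩

namespace IsPoissonProcess

variable {Ω : Type*} [MeasurableSpace Ω] {P : Measure Ω} {r : ℝ → ℝ} {N : ℝ≥0 → Ω → ℕ}

lemma indicator {lam : ℝ → ℝ} (h : IsPoissonProcess P lam N) :
    IsPoissonProcess P ((Ioi 0).indicator lam) N where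
  measurable := h.measurable
  zero := h.zero
  mono := h.mono
  rightContinuous := h.rightContinuous
  indepIncrements := h.indepIncrements
  law s t hst := by
    rw [h.law s t hst, integral_indicator_Ioi lam s.coe_nonneg (NNReal.coe_le_coe.2 hst)]

variable [IsProbabilityMeasure P]

lemma real_one_le_increment (h : IsPoissonProcess P r N) (hr : ∀ x, 0 ≤ r x) {s t : ℝ≥0}
    (hst : s ≤ t) : P.real {ω | 1 ≤ N t ω - N s ω} ≤ ∫ u in (s : ℝ)..t, r u := by
  have h1 : {ω | 1 ≤ N t ω - N s ω} = {ω | N t ω - N s ω = 0}ᶜ := by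
    ext ω; simp only [mem_ofPred_eq, mem_compl_iff]; omega
  rw [h1, probReal_compl_eq_one_sub (h.measurableSet_increment s t 0), h.real_increment hr hst]
  have := Real.add_one_le_exp (-∫ u in (s : ℝ)..t, r u)
  simp only [pow_zero, mul_one, Nat.factorial_zero, Nat.cast_one, div_one]
  linarith

lemma real_two_le_increment (h : IsPoissonProcess P r N) (hr : ∀ x, 0 ≤ r x) {s t : ℝ≥0}
    (hst : s ≤ t) : P.real {ω | 2 ≤ N t ω - N s ω} ≤ (∫ u in (s : ℝ)..t, r u) ^ 2 := by
  have h1 : {ω | 2 ≤ N t ω - N s ω} = ({ω | N t ω - N s ω = 0} ∪ {ω | N t ω - N s ω = 1})ᶜ := by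
    ext ω; simp only [mem_ofPred_eq, mem_compl_iff, mem_union]; omega
  have hdisj : Disjoint {ω | N t ω - N s ω = 0} {ω | N t ω - N s ω = 1} :=
    disjoint_left.2 fun ω h0 h1 => by simp only [mem_ofPred_eq] at h0 h1; omega
  rw [h1, probReal_compl_eq_one_sub ((h.measurableSet_increment s t 0).union
    (h.measurableSet_increment s t 1)), measureReal_union hdisj (h.measurableSet_increment s t 1),
    h.real_increment hr hst, h.real_increment hr hst]
  have h2 : 0 ≤ ∫ u in (s : ℝ)..t, r u :=
    intervalIntegral.integral_nonneg (NNReal.coe_le_coe.2 hst) fun u _ => hr u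
  set δ := ∫ u in (s : ℝ)..t, r u
  have := Real.add_one_le_exp (-δ)
  simp only [pow_zero, mul_one, Nat.factorial_zero, Nat.cast_one, div_one, pow_one,
    Nat.factorial_one]
  nlinarith

/-- Almost surely, the process takes before time `t` all the values up to `N t`. -/
lemma ae_exists_eq (h : IsPoissonProcess P r N) (hr : IsRate r) {t : ℝ≥0} (ht : 0 < t) :
    ∀ᵐ ω ∂P, ∀ k ≤ N t ω, ∃ s < t, N s ω = k := by
  set Λ : ℝ → ℝ := fun x => ∫ u in (0 : ℝ)..x, r u with hΛ
  have hsub : ∀ s t, ∫ u in s..t, r u = Λ t - Λ s := fun s t =>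
    (intervalIntegral.integral_interval_sub_left (hr.intervalIntegrable 0 t)
      (hr.intervalIntegrable 0 s)).symm
  have hmono : Monotone Λ := fun s t hst => by
    have : 0 ≤ ∫ u in s..t, r u := intervalIntegral.integral_nonneg hst fun u _ => hr.nonneg u
    rw [hsub] at this; linarith
  have hΛ0 : Λ 0 = 0 := by simp [hΛ]
  set τ : ℕ → ℕ → ℝ≥0 := fun n i => t * (i / (n + 1)) with hτ
  have hτmono : ∀ n, Monotone (τ n) := fun n i j hij => by
    simp only [hτ]; gcongr
  -- Outside `A n` the values at the grid points before `t` rise by at most one at a time, and the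
  -- last cell has no event; so every value up to `N t` is taken at a grid point strictly before
  -- `t`.
  set A : ℕ → Set Ω := fun n => (⋃ i ∈ Finset.range n, {ω | 2 ≤ N (τ n (i + 1)) ω - N (τ n i) ω}) ∪
    {ω | 1 ≤ N (τ n (n + 1)) ω - N (τ n n) ω} with hA
  have hτt : ∀ n, τ n (n + 1) = t := fun n => by
    simp only [hτ]; push_cast
    rw [div_self (by positivity), mul_one]
  have hτlt : ∀ n i, i ≤ n → τ n i < t := fun n i hi => by
    have : (i : ℝ≥0) / (n + 1) < 1 := by
      rw [div_lt_one (by positivity)]; exact_mod_cast Nat.lt_succ_of_le hi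
    calc τ n i < t * 1 := mul_lt_mul_of_pos_left this ht
      _ = t := mul_one t
  have hgood : ∀ n ω, ω ∉ A n → ∀ k ≤ N t ω, ∃ s < t, N s ω = k := by
    intro n ω hω k hk
    simp only [hA, mem_union, mem_iUnion, mem_ofPred_eq, not_or, not_exists, Finset.mem_range] at hω
    obtain ⟨h1, h2⟩ := hω
    rw [hτt] at h2
    obtain ⟨i, hi, hik⟩ := exists_eq_of_le_succ (a := fun i => N (τ n i) ω) (n := n) (k := k)
      (by simp [hτ, h.zero]) (fun i hi => by have := h1 i hi; omega) (by omega)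
    exact ⟨τ n i, hτlt n i hi, hik⟩
  -- The probabilities of double events are at most the squared increments of `Λ`, whose sum is at
  -- most `ε Λ t`; the last cell adds `ε`.
  have hle : ∀ n ε, (∀ i ≤ n, Λ (τ n (i + 1)) - Λ (τ n i) ≤ ε) → P.real (A n) ≤ ε * Λ t + ε := by
    intro n ε hε
    refine (measureReal_union_le _ _).trans (add_le_add ?_ ?_)
    · refine (measureReal_biUnion_finset_le _ _).trans ?_
      have hnn : ∀ i, 0 ≤ Λ (τ n (i + 1)) - Λ (τ n i) := fun i =>
        sub_nonneg.2 (hmono (NNReal.coe_le_coe.2 (hτmono n (Nat.le_succ i))))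
      calc ∑ i ∈ Finset.range n, P.real {ω | 2 ≤ N (τ n (i + 1)) ω - N (τ n i) ω}
          ≤ ∑ i ∈ Finset.range n, ε * (Λ (τ n (i + 1)) - Λ (τ n i)) := by
            refine Finset.sum_le_sum fun i hi => ?_
            refine (h.real_two_le_increment hr.nonneg (hτmono n (Nat.le_succ i))).trans ?_
            rw [hsub, sq]
            exact mul_le_mul_of_nonneg_right (hε i (Finset.mem_range.1 hi).le) (hnn i)
        _ = ε * Λ (τ n n) := by
            rw [← Finset.mul_sum, Finset.sum_range_sub (fun i => Λ (τ n i))]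
            simp [hτ, hΛ0]
        _ ≤ ε * Λ t := mul_le_mul_of_nonneg_left
            (hmono (NNReal.coe_le_coe.2 (hτlt n n le_rfl).le)) ((hnn n).trans (hε n le_rfl))
    · refine (h.real_one_le_increment hr.nonneg (hτmono n (Nat.le_succ n))).trans ?_
      rw [hsub]
      exact hε n le_rfl
  have huc : UniformContinuousOn Λ (Icc 0 t) :=
    isCompact_Icc.uniformContinuousOn_of_continuous hr.continuous_primitive.continuousOn
  rw [Metric.uniformContinuousOn_iff] at huc
  have hΛt : 0 ≤ Λ t := hΛ0 ▸ hmono t.coe_nonneg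
  have hnull : P.real (⋂ n, A n) = 0 := by
    refine le_antisymm (le_of_forall_pos_le_add fun ε hε => ?_) measureReal_nonneg
    -- The oscillation `ε / (Λ t + 1)` is chosen so that the bound on the probability of `A n` adds
    -- up to `ε`.
    obtain ⟨δ, hδ, hδ'⟩ := huc (ε / (Λ t + 1)) (by positivity)
    obtain ⟨n, hn⟩ := exists_nat_gt ((t : ℝ) / δ)
    rw [zero_add]
    calc P.real (⋂ n, A n) ≤ P.real (A n) := measureReal_mono (iInter_subset _ _)
      _ ≤ ε / (Λ t + 1) * Λ t + ε / (Λ t + 1) := hle n _ fun i hi => ?_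
      _ = ε := by field_simp
    have hmem : ∀ i ≤ n + 1, (τ n i : ℝ) ∈ Icc (0 : ℝ) t := fun i hi =>
      ⟨(τ n i).coe_nonneg, NNReal.coe_le_coe.2 ((hτmono n hi).trans_eq (hτt n))⟩
    have := hδ' _ (hmem (i + 1) (by omega)) _ (hmem i (by omega)) ?_
    · rw [Real.dist_eq] at this
      exact (le_abs_self _).trans this.le
    · have e : (τ n (i + 1) : ℝ) - τ n i = t / (n + 1) := by
        simp only [hτ]; push_cast; ring
      rw [Real.dist_eq, e, abs_of_nonneg (by positivity), div_lt_iff₀ (by positivity)]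
      rw [div_lt_iff₀ hδ] at hn
      nlinarith
  rw [measureReal_eq_zero_iff] at hnull
  rw [ae_iff]
  refine measure_mono_null (fun ω hω => mem_iInter.2 fun n => ?_) hnull
  by_contra hn
  exact hω (hgood n ω hn)

end IsPoissonProcess

section Path

variable {Ω : Type*} [MeasurableSpace Ω] {P : Measure Ω} {r : ℝ → ℝ} {N : ℝ≥0 → Ω → ℕ}

namespace IsPoissonProcess

lemma intervalIntegrable_comp_path (h : IsPoissonProcess P r N) (ω : Ω) {G : ℕ → ℝ} {C : ℝ}
    (hG : ∀ k, |G k| ≤ C) (a b : ℝ) :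
    IntervalIntegrable (fun s : ℝ => G (N s.toNNReal ω)) volume a b := by
  have hmeas : Measurable fun s : ℝ => N s.toNNReal ω :=
    Monotone.measurable fun s t hst => h.mono ω (Real.toNNReal_mono hst)
  refine (intervalIntegrable_const (c := C)).mono_fun
    ((measurable_of_countable G).comp hmeas).aestronglyMeasurable (ae_of_all _ fun s => ?_)
  exact (hG _).trans (le_abs_self C)

/-- If `G ≤ 1`, then the integral of `c G(N)` is maximal if and only if `G = 1` at all values taken
by the path. -/
lemma integral_comp_path_eq_iff (h : IsPoissonProcess P r N) {ω : Ω} {t : ℝ≥0}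
    (hω : ∀ k ≤ N t ω, ∃ s < t, N s ω = k) {c : ℝ} (hc : 0 < c) {G : ℕ → ℝ} (hG : ∀ k, |G k| ≤ 1) :
    ∫ s in (0 : ℝ)..t, c * G (N s.toNNReal ω) = c * t ↔ ∀ k ≤ N t ω, G k = 1 := by
  have hint := (h.intervalIntegrable_comp_path ω hG 0 t).const_mul c
  constructor
  · intro heq k hk
    have hzero : ∫ s in (0 : ℝ)..t, (c - c * G (N s.toNNReal ω)) = 0 := by
      rw [intervalIntegral.integral_sub intervalIntegrable_const hint, heq]
      simp [mul_comm]
    rw [intervalIntegral.integral_eq_zero_iff_of_le_of_nonneg_ae t.coe_nonneg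
      (ae_of_all _ fun s => ?_) (intervalIntegrable_const.sub hint)] at hzero
    swap
    · have := (abs_le.1 (hG (N s.toNNReal ω))).2
      simp only [Pi.zero_apply]
      nlinarith
    obtain ⟨s, hst, rfl⟩ := hω k hk
    -- By right-continuity the value is kept on an interval of positive length, which meets `[0, t]`
    -- in positive measure because `s < t`.
    have hev : {u | N u ω = N s ω} ∈ 𝓝[≥] s :=
      (h.rightContinuous ω s).tendsto ((isOpen_discrete {N s ω}).mem_nhds rfl)
    obtain ⟨s', hs', hsub⟩ := (mem_nhdsGE_iff_exists_Ico_subset' (lt_add_one s)).1 hev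
    by_contra hne
    have hpos : 0 < volume (Ioo (s : ℝ) (min s' t : ℝ≥0)) := by
      rw [Real.volume_Ioo, ENNReal.ofReal_pos, sub_pos]
      exact NNReal.coe_lt_coe.2 (lt_min hs' hst)
    refine hpos.ne' (measure_mono_null (t := {u | ¬ (u ∈ Ioc (0 : ℝ) t → c - c * G (N u.toNNReal ω)
      = 0)}) (fun u hu => ?_) ((ae_restrict_iff' measurableSet_Ioc).1 hzero))
    have hu0 : 0 < u := s.coe_nonneg.trans_lt hu.1
    have hu1 : u < s' ∧ u < t := by
      have := hu.2
      rw [NNReal.coe_min, lt_min_iff] at this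
      exact this
    have hmem : N u.toNNReal ω = N s ω := hsub ⟨NNReal.le_toNNReal_of_coe_le hu.1.le,
      (Real.toNNReal_lt_iff_lt_coe hu0.le).2 hu1.1⟩
    simp only [mem_ofPred_eq, Classical.not_imp]
    refine ⟨⟨hu0, hu1.2.le⟩, fun h0 => hne ?_⟩
    rw [hmem] at h0
    have : c * (1 - G (N s ω)) = 0 := by linarith
    rcases mul_eq_zero.1 this with h1 | h1
    · exact absurd h1 hc.ne'
    · linarith
  · intro hall
    have : ∫ s in (0 : ℝ)..t, c * G (N s.toNNReal ω) = ∫ s in (0 : ℝ)..t, c := by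
      refine intervalIntegral.integral_congr fun s hs => ?_
      rw [uIcc_of_le t.coe_nonneg] at hs
      rw [hall _ (h.mono ω (Real.toNNReal_le_iff_le_coe.2 hs.2)), mul_one]
    rw [this]
    simp [mul_comm]

end IsPoissonProcess

end Path

/-! ### Directions of motion on the edge. -/

/-- The sequence of directions that alternates between `d_0` and `d_1`, starting from `d_0` if `j`
is even and from `d_1` if `j` is odd. -/
def altDir (j k : ℕ) : Fin 4 := if Even (j + k) then 0 else 1

lemma dirX_add_dirY_altDir (j k : ℕ) : dirX (altDir j k) + dirY (altDir j k) = 1 := by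
  unfold altDir dirX dirY
  split_ifs <;> simp

lemma dirX_sub_dirY_altDir (j k : ℕ) : dirX (altDir j k) - dirY (altDir j k) = (-1) ^ (j + k) := by
  unfold altDir dirX dirY
  split_ifs with h
  · simp [h.neg_one_pow]
  · simp [(Nat.not_even_iff_odd.1 h).neg_one_pow]

lemma abs_dirX_add_dirY_le (i : Fin 4) : |dirX i + dirY i| ≤ 1 := by
  fin_cases i <;> simp [dirX, dirY]

lemma abs_dirX_le (i : Fin 4) : |dirX i| ≤ 1 := by
  fin_cases i <;> simp [dirX]

lemma abs_dirY_le (i : Fin 4) : |dirY i| ≤ 1 := by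
  fin_cases i <;> simp [dirY]

lemma dirX_add_dirY_eq_one {i : Fin 4} (h : dirX i + dirY i = 1) : i = 0 ∨ i = 1 := by
  fin_cases i <;> simp [dirX, dirY] at h ⊢ <;> norm_num at h

lemma altDir_succ_ne (j k : ℕ) : altDir j (k + 1) ≠ altDir j k := by
  unfold altDir
  rw [← add_assoc]
  by_cases h : Even (j + k) <;> simp [h, Nat.even_add_one]

lemma eq_altDir_succ {j k : ℕ} {i : Fin 4} (hi : i = 0 ∨ i = 1) (hne : i ≠ altDir j k) :
    i = altDir j (k + 1) := by
  unfold altDir at hne ⊢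
  rw [← add_assoc]
  by_cases h : Even (j + k) <;> rcases hi with rfl | rfl <;> simp_all [Nat.even_add_one]

namespace IsReflectingChain

variable {Ω : Type*} [MeasurableSpace Ω] {P : Measure Ω} {E : ℕ → Ω → Fin 4}

lemma real_altDir (h : IsReflectingChain P E) (j n : ℕ) :
    P.real {ω | ∀ k ≤ n, E k ω = altDir j k} = 1 / 4 * (1 / 3) ^ n := by
  rw [h.law]
  simp [altDir_succ_ne]

/-- The chain law is given only on finite words. The event of a repetition at step `k` is a finite
union of words, each with a vanishing factor in its probability. -/
lemma ae_succ_ne [IsFiniteMeasure P] (h : IsReflectingChain P E) :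
    ∀ᵐ ω ∂P, ∀ k, E (k + 1) ω ≠ E k ω := by
  rw [ae_all_iff]
  intro k
  rw [ae_iff]
  have hnull : P (⋃ e : {e : Fin (k + 2) → Fin 4 // e ⟨k + 1, by omega⟩ = e ⟨k, by omega⟩},
      {ω | ∀ i ≤ k + 1, E i ω = if hi : i < k + 2 then e.1 ⟨i, hi⟩ else 0}) = 0 := by
    refine measure_iUnion_null fun e => ?_
    rw [← measureReal_eq_zero_iff, h.law (k + 1) fun i => if hi : i < k + 2 then e.1 ⟨i, hi⟩ else 0]
    refine mul_eq_zero_of_right _ (Finset.prod_eq_zero (Finset.self_mem_range_succ k) ?_)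
    simp [e.2]
  refine measure_mono_null (fun ω hω => ?_) hnull
  rw [mem_ofPred_eq, not_ne_iff] at hω
  refine mem_iUnion.2 ⟨⟨fun i => E i ω, hω⟩, fun i hi => ?_⟩
  rw [dif_pos (by omega)]

end IsReflectingChain

section Motion

variable {Ω : Type*} [MeasurableSpace Ω] {P : Measure Ω} {r : ℝ → ℝ} {N : ℝ≥0 → Ω → ℕ}
  {E : ℕ → Ω → Fin 4}

namespace IsPoissonProcess

/-- The events `X + Y = c t`, `X - Y ∈ B` in terms of the signed time. -/
lemma edge_event_iff (h : IsPoissonProcess P r N) {ω : Ω} {t : ℝ≥0}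
    (hω : ∀ k ≤ N t ω, ∃ s < t, N s ω = k) (hE : ∀ k, E (k + 1) ω ≠ E k ω) {c : ℝ} (hc : 0 < c)
    (B : Set ℝ) :
    ((∫ s in (0 : ℝ)..t, c * dirX (E (N s.toNNReal ω) ω))
        + (∫ s in (0 : ℝ)..t, c * dirY (E (N s.toNNReal ω) ω)) = c * t ∧
      (∫ s in (0 : ℝ)..t, c * dirX (E (N s.toNNReal ω) ω))
        - (∫ s in (0 : ℝ)..t, c * dirY (E (N s.toNNReal ω) ω)) ∈ B) ↔
    ((∀ k ≤ N t ω, E k ω = altDir 0 k) ∧ c * signedTime N t ω ∈ B) ∨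
      ((∀ k ≤ N t ω, E k ω = altDir 1 k) ∧ -(c * signedTime N t ω) ∈ B) := by
  have iX := (h.intervalIntegrable_comp_path ω (G := fun k => dirX (E k ω))
    (fun k => abs_dirX_le _) 0 t).const_mul c
  have iY := (h.intervalIntegrable_comp_path ω (G := fun k => dirY (E k ω))
    (fun k => abs_dirY_le _) 0 t).const_mul c
  have hsum : (∫ s in (0 : ℝ)..t, c * dirX (E (N s.toNNReal ω) ω))
      + (∫ s in (0 : ℝ)..t, c * dirY (E (N s.toNNReal ω) ω)) = c * t ↔
      ∀ k ≤ N t ω, dirX (E k ω) + dirY (E k ω) = 1 := by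
    rw [← h.integral_comp_path_eq_iff hω hc (G := fun k => dirX (E k ω) + dirY (E k ω))
      fun k => abs_dirX_add_dirY_le _, ← intervalIntegral.integral_add iX iY]
    simp only [mul_add]
  have hdiff : ∀ j, (∀ k ≤ N t ω, E k ω = altDir j k) →
      (∫ s in (0 : ℝ)..t, c * dirX (E (N s.toNNReal ω) ω))
        - (∫ s in (0 : ℝ)..t, c * dirY (E (N s.toNNReal ω) ω)) =
      (-1) ^ j * (c * signedTime N t ω) := by
    intro j hj
    rw [← intervalIntegral.integral_sub iX iY, signedTime, ← intervalIntegral.integral_const_mul,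
      ← intervalIntegral.integral_const_mul]
    refine intervalIntegral.integral_congr fun s hs => ?_
    rw [uIcc_of_le t.coe_nonneg] at hs
    have h1 : N s.toNNReal ω ≤ N t ω := h.mono ω (Real.toNNReal_le_iff_le_coe.2 hs.2)
    rw [← mul_sub, hj _ h1, dirX_sub_dirY_altDir, pow_add]
    ring
  have halt : ∀ j, (∀ k ≤ N t ω, E k ω = altDir j k) →
      ∀ k ≤ N t ω, dirX (E k ω) + dirY (E k ω) = 1 := fun j hj k hk => by
    rw [hj k hk, dirX_add_dirY_altDir]
  constructor
  · rintro ⟨h1, h2⟩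
    rw [hsum] at h1
    -- Only two directions are admissible and each must differ from its predecessor, so the first
    -- one determines the word.
    have hstep : ∀ j, E 0 ω = altDir j 0 → ∀ k ≤ N t ω, E k ω = altDir j k := by
      intro j h0 k
      induction k with
      | zero => exact fun _ => h0
      | succ k ih =>
        intro hk
        refine eq_altDir_succ (dirX_add_dirY_eq_one (h1 _ hk)) ?_
        rw [← ih (by omega)]
        exact hE k
    rcases dirX_add_dirY_eq_one (h1 0 (Nat.zero_le _)) with h0 | h0
    · have := hstep 0 (by rw [h0]; rfl)
      rw [hdiff 0 this, pow_zero, one_mul] at h2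
      exact Or.inl ⟨this, h2⟩
    · have := hstep 1 (by rw [h0]; rfl)
      rw [hdiff 1 this, pow_one, neg_one_mul] at h2
      exact Or.inr ⟨this, h2⟩
  · rintro (⟨h1, h2⟩ | ⟨h1, h2⟩)
    · refine ⟨hsum.2 (halt 0 h1), ?_⟩
      rwa [hdiff 0 h1, pow_zero, one_mul]
    · refine ⟨hsum.2 (halt 1 h1), ?_⟩
      rwa [hdiff 1 h1, pow_one, neg_one_mul]

variable [IsProbabilityMeasure P]

/-- Splitting according to `N t = n` and using independence, the word has probability `(1/4)
(1/3)^n`; the power is constant on each piece and becomes the density `(1/3)^N`. -/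
lemma measure_altDir (h : IsPoissonProcess P r N) (hE : IsReflectingChain P E)
    (hind : IndepFun (fun ω t => N t ω) (fun ω n => E n ω) P) (t : ℝ≥0) (j : ℕ) {g : Ω → ℝ}
    (hg : Measurable[MeasurableSpace.comap (fun ω t => N t ω) MeasurableSpace.pi] g)
    {B : Set ℝ} (hB : MeasurableSet B) :
    P {ω | (∀ k ≤ N t ω, E k ω = altDir j k) ∧ g ω ∈ B} = ENNReal.ofReal (1 / 4) *
      ((P.withDensity fun ω => ENNReal.ofReal ((1 / 3) ^ N t ω)).map g) B := by
  have hNpath : Measurable fun ω t => N t ω := measurable_pi_lambda _ h.measurable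
  have hgm : Measurable g := hg.mono hNpath.comap_le le_rfl
  have hfib : ∀ n, MeasurableSet {ω | N t ω = n} := fun n => h.measurable t (measurableSet_singleton n)
  have hS : MeasurableSet (g ⁻¹' B) := hgm hB
  have hA : ∀ n, MeasurableSet {ω | ∀ k ≤ n, E k ω = altDir j k} := fun n => by
    have : {ω | ∀ k ≤ n, E k ω = altDir j k} = ⋂ k ∈ Iic n, {ω | E k ω = altDir j k} := by
      ext ω; simp
    rw [this]
    exact MeasurableSet.biInter (to_countable _) fun k _ =>
      hE.measurable k (measurableSet_singleton _)
  have hsplit : {ω | (∀ k ≤ N t ω, E k ω = altDir j k) ∧ g ω ∈ B}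
      = ⋃ n, ({ω | N t ω = n} ∩ g ⁻¹' B) ∩ {ω | ∀ k ≤ n, E k ω = altDir j k} := by
    ext ω
    simp only [mem_ofPred_eq, mem_iUnion, mem_inter_iff, mem_preimage]
    constructor
    · rintro ⟨h1, h2⟩; exact ⟨_, ⟨rfl, h2⟩, h1⟩
    · rintro ⟨n, ⟨rfl, h2⟩, h1⟩; exact ⟨h1, h2⟩
  have hsplit2 : g ⁻¹' B = ⋃ n, {ω | N t ω = n} ∩ g ⁻¹' B := by
    ext ω; simp
  have hdisj : ∀ F : ℕ → Set Ω, (∀ n, F n ⊆ {ω | N t ω = n}) → Pairwise (Function.onFun Disjoint F) :=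
    fun F hF i k hik => disjoint_left.2 fun ω h1 h2 => hik ((hF i h1).symm.trans (hF k h2))
  have hmap : (P.withDensity fun ω => ENNReal.ofReal ((1 / 3) ^ N t ω)) (g ⁻¹' B)
      = ∑' n, (P.withDensity fun ω => ENNReal.ofReal ((1 / 3) ^ N t ω))
        ({ω | N t ω = n} ∩ g ⁻¹' B) := by
    conv_lhs => rw [hsplit2]
    exact measure_iUnion (hdisj _ fun n => inter_subset_left) fun n => (hfib n).inter hS
  rw [hsplit, measure_iUnion (hdisj _ fun n => inter_subset_left.trans inter_subset_left)
    fun n => ((hfib n).inter hS).inter (hA n), Measure.map_apply hgm hB, hmap,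
    ← ENNReal.tsum_mul_left]
  congr 1
  funext n
  have hindep := (IndepFun_iff _ _ P).1 hind ({ω | N t ω = n} ∩ g ⁻¹' B)
    {ω | ∀ k ≤ n, E k ω = altDir j k} ?_ ?_
  · rw [hindep, withDensity_apply _ ((hfib n).inter hS),
      setLIntegral_congr_fun (g := fun _ => ENNReal.ofReal ((1 / 3) ^ n)) ((hfib n).inter hS)
        (fun ω hω => by
          have : N t ω = n := hω.1
          simp only [this]), setLIntegral_const, ← ofReal_measureReal (s := {ω | ∀ k ≤ n, _}),
      hE.real_altDir, ENNReal.ofReal_mul (by norm_num)]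
    ring
  · refine MeasurableSet.inter ?_ (hg hB)
    exact ⟨{x | x t = n}, (measurable_pi_apply t : Measurable fun x : ℝ≥0 → ℕ => x t)
      (measurableSet_singleton n), rfl⟩
  · refine ⟨{x | ∀ k ≤ n, x k = altDir j k}, ?_, rfl⟩
    have : {x : ℕ → Fin 4 | ∀ k ≤ n, x k = altDir j k} = ⋂ k ∈ Iic n, {x | x k = altDir j k} := by
      ext ω; simp
    rw [this]
    exact MeasurableSet.biInter (to_countable _) fun k _ =>
      measurable_pi_apply k (measurableSet_singleton _)

omit [IsProbabilityMeasure P] in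
lemma measurable_comap_signedTime (h : IsPoissonProcess P r N) (t : ℝ≥0) :
    Measurable[MeasurableSpace.comap (fun ω t => N t ω) MeasurableSpace.pi] (signedTime N t) := by
  refine @measurable_signedTime Ω (MeasurableSpace.comap (fun ω t => N t ω) MeasurableSpace.pi)
    N t (fun u _ => ?_) h.rightContinuous
  exact (measurable_pi_apply u : Measurable fun x : ℝ≥0 → ℕ => x u).comp (comap_measurable _)

end IsPoissonProcess

/-- The law of the motion on the edge `x + y = c t`. -/
theorem IsReflectingMotion.measure_edge [IsProbabilityMeasure P] {c : ℝ} (hc : 0 < c)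
    (hr : IsRate r) {X Y : ℝ≥0 → Ω → ℝ} (hXY : IsReflectingMotion P c r X Y) {t : ℝ≥0} (ht : 0 < t)
    {B : Set ℝ} (hB : MeasurableSet B) (hBt : B ⊆ Ioo (-(c * t)) (c * t)) :
    P {ω | X t ω + Y t ω = c * t ∧ X t ω - Y t ω ∈ B} = ENNReal.ofReal (1 / 4) *
      (ENNReal.ofReal (Real.exp (-∫ u in (0 : ℝ)..t, r u)) *
        ∫⁻ η in B, ENNReal.ofReal (signedDensity (fun x => 1 / 3 * r x) c t η)) := by
  obtain ⟨N, E, hN, hE, hind, hX, hY⟩ := hXY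
  have hU := hN.measurable_comap_signedTime t
  have hEv : P {ω | X t ω + Y t ω = c * t ∧ X t ω - Y t ω ∈ B} =
      P ({ω | (∀ k ≤ N t ω, E k ω = altDir 0 k) ∧ c * signedTime N t ω ∈ B} ∪
        {ω | (∀ k ≤ N t ω, E k ω = altDir 1 k) ∧ -(c * signedTime N t ω) ∈ B}) := by
    refine measure_congr ?_
    filter_upwards [hN.ae_exists_eq hr ht, hE.ae_succ_ne] with ω h1 h2
    have := hN.edge_event_iff h1 h2 hc B
    rw [← hX, ← hY] at this
    exact propext this
  have hdisj : Disjoint {ω | (∀ k ≤ N t ω, E k ω = altDir 0 k) ∧ c * signedTime N t ω ∈ B}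
      {ω | (∀ k ≤ N t ω, E k ω = altDir 1 k) ∧ -(c * signedTime N t ω) ∈ B} := by
    refine disjoint_left.2 fun ω h1 h2 => ?_
    have := (h1.1 0 (Nat.zero_le _)).symm.trans (h2.1 0 (Nat.zero_le _))
    simp [altDir] at this
  have hNpath : Measurable fun ω t => N t ω := measurable_pi_lambda _ hN.measurable
  have hms : MeasurableSet {ω | (∀ k ≤ N t ω, E k ω = altDir 1 k) ∧ -(c * signedTime N t ω) ∈ B} := by
    have h1 : MeasurableSet {ω | ∀ k ≤ N t ω, E k ω = altDir 1 k} := by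
      have : {ω | ∀ k ≤ N t ω, E k ω = altDir 1 k}
          = ⋂ k, {ω | N t ω < k} ∪ {ω | E k ω = altDir 1 k} := by
        ext ω
        simp only [mem_ofPred_eq, mem_iInter, mem_union]
        exact forall_congr' fun k => by rw [← not_le, imp_iff_not_or]
      rw [this]
      exact MeasurableSet.iInter fun k => (hN.measurable t measurableSet_Iio).union
        (hE.measurable k (measurableSet_singleton _))
    exact h1.inter ((((hU.mono hNpath.comap_le le_rfl).const_mul c).neg) hB)
  -- The two initial directions give the two signs of `c U`, whose weighted laws are added. The
  -- atoms at `± c t` do not charge `B`, a subset of the open interval.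
  rw [hEv, measure_union hdisj hms, hN.measure_altDir hE hind t 0 (hU.const_mul c) hB,

    hN.measure_altDir hE hind t 1 (g := fun ω => -(c * signedTime N t ω)) (hU.const_mul c).neg hB, ← mul_add, ← Measure.add_apply,
    hN.map_signedTime_add hr (by norm_num) (by norm_num) hc, Measure.smul_apply,
    Measure.add_apply, Measure.add_apply, Measure.dirac_apply' _ hB, Measure.dirac_apply' _ hB,
    withDensity_apply _ hB, indicator_of_notMem (fun hmem => lt_irrefl _ (hBt hmem).2),
    indicator_of_notMem (fun hmem => lt_irrefl _ (hBt hmem).1), zero_add, zero_add, smul_eq_mul]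

end Motion

/-! ### The telegraph process. -/

/-- The law at time `t` of a telegraph process. -/
theorem IsTelegraphProcess.map_eq {Ω : Type*} [MeasurableSpace Ω] {Q : Measure Ω}
    [IsProbabilityMeasure Q] {v : ℝ} (hv : 0 < v) {m : ℝ → ℝ} (hm : IsRate m) {T : ℝ≥0 → Ω → ℝ}
    (hT : IsTelegraphProcess Q v m T) (t : ℝ≥0) :
    Q.map (T t) = ENNReal.ofReal (1 / 2 * Real.exp (-∫ u in (0 : ℝ)..t, m u)) •
      (Measure.dirac (v * t) + Measure.dirac (-(v * t)) + volume.withDensity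
        fun η => ENNReal.ofReal (signedDensity m v t η)) := by
  obtain ⟨N, S, hN, hS, hS1, hS2, hind, hTeq⟩ := hT
  have hU := hN.measurable_comap_signedTime t
  have hNpath : Measurable fun ω t => N t ω := measurable_pi_lambda _ hN.measurable
  have hUm : Measurable (signedTime N t) := hU.mono hNpath.comap_le le_rfl
  have hTt : T t = fun ω => v * S ω * signedTime N t ω := by
    funext ω
    rw [hTeq, signedTime, intervalIntegral.integral_const_mul]
  -- With `z = 1` the weight is trivial and the kernel is that of the rate itself.
  have key := hN.map_signedTime_add hm zero_le_one le_rfl hv t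
  simp only [one_pow, one_mul, ENNReal.ofReal_one] at key
  rw [withDensity_const, one_smul] at key
  rw [ENNReal.ofReal_mul (by norm_num), mul_smul, ← key]
  have hfib : ∀ x, MeasurableSet {ω | S ω = x} := fun x => hS (measurableSet_singleton x)
  have hdisj1 : Disjoint {ω | S ω = 1} {ω | S ω = -1} := disjoint_left.2 fun ω h1 h2 => by
    simp only [mem_ofPred_eq] at h1 h2
    norm_num [h1] at h2
  have hae : ∀ᵐ ω ∂Q, S ω = 1 ∨ S ω = -1 := by
    rw [ae_iff, ← measureReal_eq_zero_iff]
    have : {ω | ¬ (S ω = 1 ∨ S ω = -1)} = ({ω | S ω = 1} ∪ {ω | S ω = -1})ᶜ := rfl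
    rw [this, probReal_compl_eq_one_sub ((hfib 1).union (hfib (-1))),
      measureReal_union hdisj1 (hfib (-1)), hS1, hS2]
    norm_num
  refine Measure.ext fun B hB => ?_
  have hpart : ∀ (x : ℝ), Q.real {ω | S ω = x} = 1 / 2 → ∀ g : Ω → ℝ,
      Measurable[MeasurableSpace.comap (fun ω t => N t ω) MeasurableSpace.pi] g →
      Q (g ⁻¹' B ∩ {ω | S ω = x}) = ENNReal.ofReal (1 / 2) * Q.map g B := by
    intro x hx g hg
    rw [(IndepFun_iff _ _ Q).1 hind (g ⁻¹' B) {ω | S ω = x} (hg hB)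
        ⟨{x}, measurableSet_singleton x, rfl⟩,
      Measure.map_apply (hg.mono hNpath.comap_le le_rfl) hB, mul_comm]
    congr 1
    rw [← ofReal_measureReal]
    exact congrArg _ hx
  have hg1 : Measurable fun ω => v * signedTime N t ω := hUm.const_mul v
  have hg2 : Measurable fun ω => -(v * signedTime N t ω) := hg1.neg
  have hTm : Measurable fun ω => v * S ω * signedTime N t ω := (hS.const_mul v).mul hUm
  rw [hTt, Measure.map_apply hTm hB, Measure.smul_apply, Measure.add_apply, smul_eq_mul, mul_add,
    ← hpart 1 hS1 _ (hU.const_mul v), ← hpart (-1) hS2 (fun ω => -(v * signedTime N t ω))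
      (hU.const_mul v).neg, ← measure_union (hdisj1.mono inter_subset_right inter_subset_right)
      (MeasurableSet.inter (hg2 hB) (hfib (-1)))]
  refine measure_congr ?_
  filter_upwards [hae] with ω hω
  refine propext ?_
  change v * S ω * signedTime N t ω ∈ B ↔
    (v * signedTime N t ω ∈ B ∧ S ω = 1) ∨ (-(v * signedTime N t ω) ∈ B ∧ S ω = -1)
  rcases hω with h1 | h1
  · rw [h1, mul_one]
    norm_num
  · rw [h1, mul_neg_one, neg_mul]
    norm_num

/-- The density of the absolutely continuous component of the law of a telegraph process. -/
lemma IsTelegraphProcess.rnDeriv_eq {Ω : Type*} [MeasurableSpace Ω] {Q : Measure Ω}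
    [IsProbabilityMeasure Q] {v : ℝ} (hv : 0 < v) {m : ℝ → ℝ} (hm : IsRate m) {T : ℝ≥0 → Ω → ℝ}
    (hT : IsTelegraphProcess Q v m T) (t : ℝ≥0) :
    (Q.map (T t)).rnDeriv volume =ᵐ[volume] fun x => ENNReal.ofReal
      (1 / 2 * Real.exp (-∫ u in (0 : ℝ)..t, m u) * signedDensity m v t x) := by
  have hmeas : Measurable fun x => ENNReal.ofReal (signedDensity m v t x) :=
    (measurable_signedDensity hm v t).ennreal_ofReal
  set κ := 1 / 2 * Real.exp (-∫ u in (0 : ℝ)..t, m u) with hκ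
  have hκ0 : 0 ≤ κ := by positivity
  have hfun : (fun x => ENNReal.ofReal (κ * signedDensity m v t x))
      = ENNReal.ofReal κ • fun x => ENNReal.ofReal (signedDensity m v t x) := by
    funext x; rw [Pi.smul_apply, smul_eq_mul, ENNReal.ofReal_mul hκ0]
  rw [hfun]
  refine (Measure.eq_rnDeriv (s := ENNReal.ofReal κ •
    (Measure.dirac (v * t) + Measure.dirac (-(v * t)))) (hmeas.const_smul _) ?_ ?_).symm
  · refine Measure.MutuallySingular.smul _ (Measure.MutuallySingular.add_left ?_ ?_)
    · exact mutuallySingular_dirac _ _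
    · exact mutuallySingular_dirac _ _
  · rw [hT.map_eq hv hm, withDensity_smul _ hmeas, smul_add]

/-! ### Comparison of the densities and conclusion. -/

section Density

variable {r : ℝ → ℝ} {c : ℝ}

lemma integral_const_mul_third (r : ℝ → ℝ) (t : ℝ) :
    ∫ u in (0 : ℝ)..t, 1 / 3 * r u = 1 / 3 * ∫ u in (0 : ℝ)..t, r u :=
  intervalIntegral.integral_const_mul _ _

/-- With `m = r / 3` the damping `exp(-3 ∫ m)` is the no-event probability at rate `r`, and `(8 c)⁻¹
= (1/4) (2 c)⁻¹` combines the word probability with the Jacobian. -/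
lemma edgeDensity_eq_signedDensity (hc : 0 < c) {η t : ℝ} (h : (η, t) ∈ edgeCone c) :
    edgeDensity (fun x => 1 / 3 * r x) c (η, t) = 1 / 4 *
      (Real.exp (-∫ u in (0 : ℝ)..t, r u) * signedDensity (fun x => 1 / 3 * r x) c t η) := by
  have hη : η ∈ Ioo (-(c * t)) (c * t) := abs_lt.1 h
  rw [edgeDensity, edgeWave, edgeWave, signedDensity, indicator_of_mem hη]
  simp only
  rw [integral_const_mul_third, neg_div, sub_neg_eq_add, ← sub_eq_add_neg, ← mul_assoc 3,
    show (3 : ℝ) * (1 / 3) = 1 by norm_num, one_mul]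
  field_simp
  ring

/-- Halving both `η` and the velocity leaves `η / v` unchanged and doubles the Jacobian, which
offsets the factor `1/2` of the telegraph law. The exponentials agree through `exp(-Λ) = exp(-2Λ/3)
exp(-Λ/3)`. -/
lemma edgeDensity_eq_signedDensity_half (hc : 0 < c) {η t : ℝ} (h : (η, t) ∈ edgeCone c) :
    edgeDensity (fun x => 1 / 3 * r x) c (η, t) =
      Real.exp (-(2 * (∫ u in (0 : ℝ)..t, r u) / 3)) / 4 *
        (1 / 2 * Real.exp (-∫ u in (0 : ℝ)..t, 1 / 3 * r u) *
          signedDensity (fun x => 1 / 3 * r x) (c / 2) t (η / 2)) := by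
  have hη : η ∈ Ioo (-(c * t)) (c * t) := abs_lt.1 h
  have hη2 : η / 2 ∈ Ioo (-(c / 2 * t)) (c / 2 * t) := by
    constructor <;> linarith [hη.1, hη.2]
  rw [edgeDensity_eq_signedDensity hc h, signedDensity, signedDensity, indicator_of_mem hη,
    indicator_of_mem hη2, integral_const_mul_third, div_div_div_cancel_right₀ two_ne_zero]
  have e : Real.exp (-∫ u in (0 : ℝ)..t, r u) = Real.exp (-(2 * (∫ u in (0 : ℝ)..t, r u) / 3)) *
      Real.exp (-(1 / 3 * ∫ u in (0 : ℝ)..t, r u)) := by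
    rw [← Real.exp_add]; congr 1; ring
  rw [e]
  field_simp

end Density

lemma IsReflectingMotion.indicator {Ω : Type*} [MeasurableSpace Ω] {P : Measure Ω} {c : ℝ}
    {lam : ℝ → ℝ} {X Y : ℝ≥0 → Ω → ℝ} (h : IsReflectingMotion P c lam X Y) :
    IsReflectingMotion P c ((Ioi 0).indicator lam) X Y := by
  obtain ⟨N, E, hN, h'⟩ := h
  exact ⟨N, E, hN.indicator, h'⟩

lemma IsTelegraphProcess.indicator {Ω : Type*} [MeasurableSpace Ω] {Q : Measure Ω} {v : ℝ}
    {mu : ℝ → ℝ} {T : ℝ≥0 → Ω → ℝ} (h : IsTelegraphProcess Q v mu T) :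
    IsTelegraphProcess Q v ((Ioi 0).indicator mu) T := by
  obtain ⟨N, S, hN, h'⟩ := h
  exact ⟨N, S, hN.indicator, h'⟩

theorem mainTheorem8 {Ω : Type*} [MeasurableSpace Ω] (P : Measure Ω) [IsProbabilityMeasure P]
    (c : ℝ) (hc : 0 < c) (lam : ℝ → ℝ) (hlam : ContDiffOn ℝ 1 lam (Ioi 0))
    (hlam_nonneg : ∀ t, 0 < t → 0 ≤ lam t)
    (hlam_int : ∀ t, 0 < t → IntegrableOn lam (Ioc 0 t))
    (X Y : ℝ≥0 → Ω → ℝ) (hXY : IsReflectingMotion P c lam X Y) :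
    ∃ f : ℝ → ℝ → ℝ,
      -- regularity of the density (it makes `f` unique on the domain)
      ContDiffOn ℝ 1 (fun z : ℝ × ℝ => f z.1 z.2) (edgeCone c) ∧
      (ContDiffOn ℝ 2 lam (Ioi 0) →
        ContDiffOn ℝ 2 (fun z : ℝ × ℝ => f z.1 z.2) (edgeCone c)) ∧
      -- `f(η, t) dη = P {X(t) + Y(t) = c t, X(t) - Y(t) ∈ dη}` on `|η| < c t`
      (∀ t : ℝ≥0, 0 < t → ∀ B : Set ℝ, MeasurableSet B → B ⊆ Ioo (-(c * t)) (c * t) →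
        P {ω | X t ω + Y t ω = c * t ∧ X t ω - Y t ω ∈ B} =
          ∫⁻ η in B, ENNReal.ofReal (f η t)) ∧
      -- the differential problem
      IsWeakEdgeSolution c lam f ∧
      (ContDiffOn ℝ 2 lam (Ioi 0) → IsClassicalEdgeSolution c lam f) ∧
      (∀ η t : ℝ, (η, t) ∈ edgeCone c → 0 ≤ f η t) ∧
      (∀ t : ℝ, 0 < t →
        IntegrableOn (fun η => f η t) (Ioo (-(c * t)) (c * t)) ∧
        ∫ η in Ioo (-(c * t)) (c * t), f η t =
          1 / 2 * (Real.exp (-(2 * (∫ s in (0 : ℝ)..t, lam s) / 3))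
            - Real.exp (-(∫ s in (0 : ℝ)..t, lam s)))) ∧
      -- the explicit form, through the density of a telegraph process
      (∀ (Ω' : Type*) [MeasurableSpace Ω'] (Q : Measure Ω') [IsProbabilityMeasure Q]
        (T : ℝ≥0 → Ω' → ℝ), IsTelegraphProcess Q (c / 2) (fun t => lam t / 3) T →
        ∃ pbar : ℝ → ℝ → ℝ,
          (∀ t : ℝ≥0, 0 < t → (∀ x, 0 ≤ pbar x t) ∧
            (Q.map (T t)).rnDeriv volume =ᵐ[volume] fun x => ENNReal.ofReal (pbar x t)) ∧
          ∀ η t : ℝ, (η, t) ∈ edgeCone c →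
            f η t =
              Real.exp (-(2 * (∫ s in (0 : ℝ)..t, lam s) / 3)) / 4 * pbar (η / 2) t) := by
  have hrate := isRate_indicator hlam hlam_nonneg hlam_int
  set r : ℝ → ℝ := (Ioi 0).indicator lam with hr
  set m : ℝ → ℝ := fun x => 1 / 3 * r x with hm
  have hmr : IsRate m := hrate.const_mul (by norm_num)
  have hlamm : ∀ t, 0 < t → lam t = 3 * m t := fun t ht => by
    simp only [hm, hr]
    rw [indicator_of_mem (mem_Ioi.2 ht)]; ring
  have hm2 : ContDiffOn ℝ 2 lam (Ioi 0) → ContDiffOn ℝ 2 m (Ioi 0) := fun h =>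
    contDiffOn_const.mul (h.congr fun x hx => indicator_of_mem hx _)
  have hint : ∀ t, 0 ≤ t → ∫ s in (0 : ℝ)..t, r s = ∫ s in (0 : ℝ)..t, lam s := fun t ht =>
    integral_indicator_Ioi lam le_rfl ht
  have hsys := isEdgeSystem_edgeDensity hmr hc
  have hXr : IsReflectingMotion P c r X Y := hXY.indicator
  -- The total mass is computed with the Poisson process that drives the motion.
  obtain ⟨N, -, hN, -⟩ := hXr
  refine ⟨fun η t => edgeDensity m c (η, t), hsys.contDiffOn_density,
    fun h => contDiffOn_edgeDensity_two hmr hc (hm2 h), fun t ht B hB hBt => ?_,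
    hsys.weak hc hmr.contDiffOn hlamm,
    fun h => hsys.classical hc hmr.contDiffOn hlamm (contDiffOn_edgeDensity_two hmr hc (hm2 h))
      (contDiffOn_edgeFlow_two hmr hc (hm2 h)), fun η t _ => edgeDensity_nonneg hc m (η, t),
    fun t ht => ?_, fun Ω' _ Q _ T hT => ?_⟩
  · rw [hXY.indicator.measure_edge hc hrate ht hB hBt, ← mul_assoc,
      ← ENNReal.ofReal_mul (by norm_num), ← lintegral_const_mul _
        (measurable_signedDensity hmr c t).ennreal_ofReal]
    refine setLIntegral_congr_fun hB fun η hη => ?_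
    simp only
    rw [show edgeDensity m c (η, (t : ℝ)) = _ from edgeDensity_eq_signedDensity (r := r) hc
      (abs_lt.2 (hBt hη)), ← ENNReal.ofReal_mul (by positivity), mul_assoc]
  · have hi : Integrable fun η => 1 / 4 *
        (Real.exp (-∫ u in (0 : ℝ)..t, r u) * signedDensity m c t η) :=
      ((integrable_signedDensity hmr hc ht.le).const_mul _).const_mul _
    have heq : EqOn (fun η => 1 / 4 *
        (Real.exp (-∫ u in (0 : ℝ)..t, r u) * signedDensity m c t η))
        (fun η => edgeDensity m c (η, t)) (Ioo (-(c * t)) (c * t)) := fun η hη =>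
      (edgeDensity_eq_signedDensity hc (abs_lt.2 hη)).symm
    refine ⟨hi.integrableOn.congr_fun heq measurableSet_Ioo, ?_⟩
    have hmass := hN.integral_signedDensity hrate (z := 1 / 3) (by norm_num) (by norm_num) hc
      ⟨t, ht.le⟩
    change Real.exp (-∫ u in (0 : ℝ)..t, r u) * ∫ η, signedDensity m c t η = 2 *
      (Real.exp (-((1 - 1 / 3) * ∫ u in (0 : ℝ)..t, r u)) - Real.exp (-∫ u in (0 : ℝ)..t, r u))
      at hmass
    rw [hint t ht.le] at hmass
    rw [← setIntegral_congr_fun measurableSet_Ioo heq, setIntegral_eq_integral_of_forall_compl_eq_zero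
      (fun η hη => by rw [signedDensity, indicator_of_notMem hη]; simp),
      integral_const_mul, integral_const_mul, hint t ht.le, hmass]
    ring_nf
  · have hTr : IsTelegraphProcess Q (c / 2) m T := by
      have : m = (Ioi 0).indicator fun t => lam t / 3 := by
        funext x
        by_cases hx : x ∈ Ioi (0 : ℝ)
        · simp only [hm, hr, indicator_of_mem hx]; ring
        · simp only [hm, hr, indicator_of_notMem hx, mul_zero]
      rw [this]
      exact hT.indicator
    -- The density does not depend on the realisation `T`: it is the explicit one from the kernel
    -- with the rate `lam / 3`.
    refine ⟨fun x t => 1 / 2 * Real.exp (-∫ u in (0 : ℝ)..t, m u) * signedDensity m (c / 2) t x,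
      fun t _ => ⟨fun x => mul_nonneg (by positivity) (signedDensity_nonneg m (by positivity) _ _),
        hTr.rnDeriv_eq (by positivity) hmr t⟩, fun η t hz => ?_⟩
    simp only
    rw [edgeDensity_eq_signedDensity_half hc hz, hint t (pos_of_mem_edgeCone hc hz).le]
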